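/- Let $n\ge 1$ be an integer and $\nu\in(0,1]$. For $t>0$ let $u_{2n}(x,t)=\frac1{2\pi}\int_{\mathbb R}e^{-i\xi x}e^{-\xi^{2n}t}\,d\xi$ be the signed density of the pseudoprocess $X_{2n}(t)$ on the line, and let the signed law of $\Theta_{2n}(t)$ be the image of $u_{2n}(x,t)\,dx$ under the wrapping $\mathbb R\to\mathcal R=\mathbb R/2\pi\mathbb Z$. Let $H^\nu$ be a $\nu$-stable subordinator, i.e. a process with independent stationary increments and nondecreasing right-continuous paths, with $H^\nu(0)=0$ and $\mathbb E e^{-\mu H^\nu(t)}=e^{-t\mu^\nu}$ for $\mu\ge 0$; let $L^\nu(t)=\inf\{s>0:H^\nu(s)\ge t\}$, independent of $\Theta_{2n}$, so that the signed law of $\Theta_{2n}(L^\nu(t))$ is $A\mapsto\int \{\Theta_{2n}(s)\in A\}\,\Pr\{L^\nu(t)\in ds\}$. Let $E_{\nu,1}(x)=\sum_{j\ge0}x^j/\Gamma(\nu j+1)$, and for $\nu<1$ let $\partial_t^\nu f(t)=\frac1{\Gamma(1-\nu)}\int_0^t\frac{f'(s)}{(t-s)^\nu}\,ds$ be the Caputo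 derivative, with $\partial_t^1=\frac{d}{dt}$. Then: 1. For every $t>0$ and every $\theta$ the series in $$v^\nu_{2n}(\theta,t)=\frac1{2\pi}\Big(1+2\sum_{k=1}^\infty E_{\nu,1}(-k^{2n}t^\nu)\cos k\theta\Big)$$ converges absolutely, and for every $t>0$ the signed law of $\Theta_{2n}(L^\nu(t))$ has the density $v^\nu_{2n}(\cdot,t)$ on $[0,2\pi)$. 2. The function $v^\nu_{2n}$ solves $$\partial_t^\nu v=-\big(-\partial_\theta^2\big)^n v\quad(t>0),\qquad v(\theta,0)=\delta(\theta)$$ on the ring $\mathcal R$ in the sense of distributions in $\theta$: $v(\cdot,t)$ is integrable on $[0,2\pi)$ for every $t>0$, and for every smooth $2\pi$-periodic $\varphi$ the function $m_\varphi(t)=\int_0^{2\pi}v(\theta,t)\varphi(\theta)\,d\theta$ satisfies $\partial_t^\nu m_\varphi(t)=-\int_0^{2\pi}v(\theta,t)\,\big((-\partial_\theta^2)^n\varphi\big)(\theta)\,d\theta$ for all $t>0$ and $m_\varphi(t)\to\varphi(0)$ as $t\downarrow0$. For $\nu<1$ the Caputo derivative is taken of functions that are differentiable in $t>0$ with an absolutely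 convergent integral. Any other solution in this sense agrees with $v^\nu_{2n}(\cdot,t)$ almost everywhere, for every $t>0$. 3. The equation also holds in the classical, pointwise sense (with $v^\nu_{2n}(\cdot,t)$ of class $C^{2n}$ near $\theta$) for all $t>0$ and all $\theta\in(0,2\pi)$, and if $\nu=1$ also for $\theta=0$. -/

import Mathlib

open Set Filter Topology MeasureTheory ProbabilityTheory
open scoped NNReal

noncomputable section

namespace CircPseudo

/-- The Mittag-Leffler function `E_{ν,1}(x) = ∑_{j ≥ 0} x^j / Γ(ν j + 1)`. -/
def mittagLeffler (ν x : ℝ) : ℝ :=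
  ∑' j : ℕ, x ^ j / Real.Gamma (ν * j + 1)

/-- The signed density of the pseudoprocess `X_{2n}(t)` on the line, started at `0`:
`u_{2n}(x,t) = (1/2π) ∫_ℝ e^{-iξx} e^{-ξ^{2n} t} dξ`
(the integral is real by symmetry in `ξ`; the real part only changes the type). -/
def lineDensity (n : ℕ) (x t : ℝ) : ℝ :=
  (1 / (2 * Real.pi)) *
    (∫ ξ : ℝ, Complex.exp (-Complex.I * ξ * x) * (Real.exp (-ξ ^ (2 * n) * t) : ℂ)).re

/-- The signed law of `X_{2n}(t)` on the line. -/
def lineLaw (n : ℕ) (t : ℝ) : SignedMeasure ℝ :=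
  (volume : Measure ℝ).withDensityᵥ (fun x => lineDensity n x t)

/-- The ring of radius one, `ℝ / 2πℤ`. -/
abbrev Ring1 : Type := AddCircle (2 * Real.pi)

/-- The signed law of the circular pseudoprocess `Θ_{2n}(t)`: the law of `X_{2n}(t)` wrapped up
around the ring, that is `{Θ(t) ∈ dθ} = ⋃_m {X(t) ∈ d(θ + 2mπ)}`. -/
def ringLaw (n : ℕ) (t : ℝ) : SignedMeasure Ring1 :=
  (lineLaw n t).map (fun x : ℝ => (x : Ring1))

/-- `H` is a stable subordinator of order `ν`: a process with independent stationary increments,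
started at `0`, with nondecreasing right-continuous paths, normalised by
`𝔼 e^{-μ H(t)} = e^{-t μ^ν}`. -/
structure IsStableSubordinator {Ω : Type*} [MeasurableSpace Ω] (ν : ℝ) (H : ℝ≥0 → Ω → ℝ)
    (P : Measure Ω) : Prop where
  measurable : ∀ t, Measurable (H t)
  zero : ∀ᵐ ω ∂P, H 0 ω = 0
  indep : HasIndepIncrements H P
  laplace : ∀ s t : ℝ≥0, s ≤ t → ∀ μ : ℝ, 0 ≤ μ →
    ∫ ω, Real.exp (-μ * (H t ω - H s ω)) ∂P = Real.exp (-((t : ℝ) - s) * μ ^ ν)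
  paths : ∀ᵐ ω ∂P, Monotone (fun s => H s ω) ∧
    ∀ s, ContinuousWithinAt (fun r => H r ω) (Ici s) s

/-- The inverse process `L(t) = inf {s > 0 : H(s) ≥ t}`. -/
def inverseProcess {Ω : Type*} (H : ℝ≥0 → Ω → ℝ) (t : ℝ) (ω : Ω) : ℝ :=
  ((sInf {s : ℝ≥0 | 0 < s ∧ t ≤ H s ω} : ℝ≥0) : ℝ)

/-- The signed law of `Θ_{2n}(τ)` for a random time `τ` on a probability space `(Ω, P)`
independent of the pseudoprocess: the value at `A` is the mean of the signed mass that
`Θ_{2n}(s)` gives to `A`, at `s = τ`, i.e. `∫ P(Θ_{2n}(s) ∈ A) P(τ ∈ ds)`. -/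
def timeChangedLaw {Ω : Type*} [MeasurableSpace Ω] (n : ℕ) (P : Measure Ω) (τ : Ω → ℝ)
    (A : Set Ring1) : ℝ :=
  ∫ ω, ringLaw n (τ ω) A ∂P

/-- The function
`(1/2π) (1 + 2 ∑_{k ≥ 1} E_{ν,1}(-k^{2n} t^ν) cos kθ)` (the sum is indexed by `k = j + 1`). -/
def vFrac (n : ℕ) (ν θ t : ℝ) : ℝ :=
  (1 / (2 * Real.pi)) * (1 + 2 * ∑' j : ℕ,
    mittagLeffler ν (-((j : ℝ) + 1) ^ (2 * n) * t ^ ν) * Real.cos (((j : ℝ) + 1) * θ))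

/-- `f` has at time `t` the Caputo derivative `d` of order `ν ∈ (0,1]`. For `ν < 1` this means that
`f` is differentiable on `(0,t)`, that the integral below converges absolutely and that
`(1/Γ(1-ν)) ∫_0^t f'(s) (t-s)^{-ν} ds = d`; for `ν = 1` it is the ordinary derivative. -/
structure HasCaputoDerivAt (ν : ℝ) (f : ℝ → ℝ) (d t : ℝ) : Prop where
  ordinary : ν = 1 → HasDerivAt f d t
  differentiable : ν < 1 → ∀ s ∈ Ioo 0 t, DifferentiableAt ℝ f s
  integrable : ν < 1 → IntervalIntegrable (fun s => deriv f s / (t - s) ^ ν) volume 0 t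
  eq : ν < 1 → (1 / Real.Gamma (1 - ν)) * ∫ s in (0 : ℝ)..t, deriv f s / (t - s) ^ ν = d

/-- The operator `(-∂²)^n = (-1)^n ∂^{2n}` on functions of one variable. -/
def negLaplacePow (n : ℕ) (g : ℝ → ℝ) (θ : ℝ) : ℝ :=
  (-1) ^ n * iteratedDeriv (2 * n) g θ

/-- `w(θ,t)` solves `∂_t^ν w = -(-∂_θ²)^n w`, `t > 0`, on the whole ring with `w(·,0) = δ`, in the
sense of distributions in `θ`: the pairing of `w(·,t)` with each smooth `2π`-periodic test function
`φ` satisfies the equation pointwise in `t > 0`, with the (symmetric) operator `(-∂²)^n` on `φ`,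
and tends to `φ(0)` as `t → 0+`. -/
structure IsRingSolution (n : ℕ) (ν : ℝ) (w : ℝ → ℝ → ℝ) : Prop where
  integrable : ∀ t, 0 < t → IntegrableOn (fun θ => w θ t) (Ico 0 (2 * Real.pi))
  equation : ∀ φ : ℝ → ℝ, ContDiff ℝ (⊤ : ℕ∞) φ → Function.Periodic φ (2 * Real.pi) → ∀ t, 0 < t →
    HasCaputoDerivAt ν (fun s => ∫ θ in Ico 0 (2 * Real.pi), w θ s * φ θ)
      (-∫ θ in Ico 0 (2 * Real.pi), w θ t * negLaplacePow n φ θ) t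
  initial : ∀ φ : ℝ → ℝ, ContDiff ℝ (⊤ : ℕ∞) φ → Function.Periodic φ (2 * Real.pi) →
    Tendsto (fun t => ∫ θ in Ico 0 (2 * Real.pi), w θ t * φ θ) (𝓝[>] 0) (𝓝 (φ 0))

end CircPseudo

end

/-! Put Y = H(1)^{-ν}. Almost surely L(t) ≤ s exactly when H(s) ≥ t, and H(s) is distributed as
s^{1/ν} H(1), so L(t) has the law of t^ν Y (`map_inverse`). The moments of Y are j!/Γ(νj+1), hence 𝔼
e^{-xY} = E_{ν,1}(-x), and an elementary comparison gives 𝔼 e^{-xY} ≤ C/x, which makes the series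
converge absolutely.

At a fixed time s > 0, Poisson summation turns the wrapped line density into (1/2π)(1 + 2 Σ
e^{-k^{2n}s} cos kθ) (`tsum_fourierInv_eq`, `ringLaw_apply`). Putting s = t^ν Y and averaging
replaces each exponential by a Mittag-Leffler function (`timeChangedLaw_eq`).

The equation rests on one identity: for ν < 1 the Caputo derivative of 𝔼 F(t^ν Y) is 𝔼 F'(t^ν Y).
Differentiating under the expectation and inserting the fractional kernel gives a weighted measure
on (0,t) × Ω. By the Beta integral the image of this measure under s^ν Y has the moments of t^ν Y,
so the two laws coincide (`map_caputoWeight`, `hasCaputoDerivAt_of_lt`). It is applied to an F that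
solves the equation with the ordinary time derivative, and it needs F' bounded on all positive
times. That holds for the pairing of the kernel with a smooth test function, and for the kernel
itself at θ ≠ 0, where Poisson summation and self-similarity bound the angular derivatives uniformly
in time (`exists_abs_ringKernel_le`). If ν = 1 then Y = 1 almost surely, no bound is needed, and θ =
0 is allowed.

For uniqueness, each Fourier coefficient f of the difference of two solutions satisfies ∂_t^ν f =
-k^{2n} f and tends to 0 at time 0. A maximum principle for the Caputo derivative, or an integrating
factor when ν = 1, gives f = 0 (`eq_zero_of_caputo`), and an integrable function with vanishing
Fourier coefficients is zero almost everywhere (`ae_eq_zero_of_fourier_coeff`). -/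

noncomputable section

namespace CircPseudo

/-! ### Laws determined by their moments -/

section Moments

variable {Ω Ω' : Type*} [MeasurableSpace Ω] [MeasurableSpace Ω'] {μ : Measure Ω} {μ' : Measure Ω'}

/-- Expand the exponential and integrate term by term. As X ≥ 0, the norms of the terms integrate to
the moment series at ‖z‖, and its convergence justifies the exchange. -/
lemma hasSum_integral_cexp_of_moments {X : Ω → ℝ} (hX : ∀ᵐ ω ∂μ, 0 ≤ X ω)
    (hint : ∀ j : ℕ, Integrable (fun ω => X ω ^ j) μ)
    (hs : ∀ r : ℝ, 0 ≤ r → Summable fun j : ℕ => r ^ j / (j.factorial : ℝ) * ∫ ω, X ω ^ j ∂μ)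
    (z : ℂ) :
    HasSum (fun j : ℕ => z ^ j / (j.factorial : ℂ) * ((∫ ω, X ω ^ j ∂μ : ℝ) : ℂ))
      (∫ ω, Complex.exp (z * X ω) ∂μ) := by
  have h := hasSum_integral_of_summable_integral_norm (μ := μ)
    (F := fun (j : ℕ) ω => z ^ j / (j.factorial : ℂ) * ((X ω ^ j : ℝ) : ℂ))
    (fun j => ((hint j).ofReal).const_mul _) ?_
  · convert! h using 1
    · funext j
      rw [integral_const_mul, integral_complex_ofReal]
    · refine integral_congr_ae (Eventually.of_forall fun ω => ?_)
      simp only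
      rw [Complex.exp_eq_exp_ℂ, NormedSpace.exp_eq_tsum_div]
      simp only
      refine tsum_congr fun j => ?_
      push_cast
      ring
  · refine (hs ‖z‖ (norm_nonneg _)).congr fun j => ?_
    rw [← integral_const_mul]
    refine integral_congr_ae ?_
    filter_upwards [hX] with ω hω
    simp [abs_of_nonneg hω]

lemma hasSum_integral_exp_of_moments {X : Ω → ℝ} (hX : ∀ᵐ ω ∂μ, 0 ≤ X ω)
    (hint : ∀ j : ℕ, Integrable (fun ω => X ω ^ j) μ)
    (hs : ∀ r : ℝ, 0 ≤ r → Summable fun j : ℕ => r ^ j / (j.factorial : ℝ) * ∫ ω, X ω ^ j ∂μ)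
    (x : ℝ) :
    HasSum (fun j : ℕ => x ^ j / (j.factorial : ℝ) * ∫ ω, X ω ^ j ∂μ)
      (∫ ω, Real.exp (x * X ω) ∂μ) := by
  have h := hasSum_integral_cexp_of_moments hX hint hs x
  rw [← Complex.hasSum_ofReal]
  convert! h using 1
  · push_cast; rfl
  · rw [← integral_complex_ofReal]
    push_cast; rfl

/-- A nonnegative random variable whose moments grow moderately is determined by its moments. -/
lemma map_eq_map_of_moments [IsFiniteMeasure μ] [IsFiniteMeasure μ'] {X : Ω → ℝ} {X' : Ω' → ℝ}
    (hXm : AEMeasurable X μ) (hXm' : AEMeasurable X' μ')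
    (hX : ∀ᵐ ω ∂μ, 0 ≤ X ω) (hX' : ∀ᵐ ω ∂μ', 0 ≤ X' ω)
    (hint : ∀ j : ℕ, Integrable (fun ω => X ω ^ j) μ)
    (hint' : ∀ j : ℕ, Integrable (fun ω => X' ω ^ j) μ')
    (hs : ∀ r : ℝ, 0 ≤ r → Summable fun j : ℕ => r ^ j / (j.factorial : ℝ) * ∫ ω, X ω ^ j ∂μ)
    (heq : ∀ j : ℕ, ∫ ω, X ω ^ j ∂μ = ∫ ω, X' ω ^ j ∂μ') :
    μ.map X = μ'.map X' := by
  refine Measure.ext_of_charFun ?_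
  funext t
  rw [charFun_apply_real, charFun_apply_real, integral_map hXm (by fun_prop),
    integral_map hXm' (by fun_prop)]
  have h1 := hasSum_integral_cexp_of_moments hX hint hs (t * Complex.I)
  have h2 := hasSum_integral_cexp_of_moments hX' hint' (by simpa only [← heq] using hs)
    (t * Complex.I)
  simp only [← heq] at h2
  have h3 := h1.unique h2
  have h4 : ∀ x : ℝ, (t : ℂ) * Complex.I * x = t * x * Complex.I := fun x => by ring
  simpa only [h4] using h3

end Moments

/-! ### The Mittag-Leffler function and distribution -/

section MittagLeffler

/-- Keep only the part x > a of the Gamma integral, where x^s ≥ a^s. -/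
lemma rpow_mul_exp_neg_le_Gamma {a s : ℝ} (ha : 0 < a) (hs : 0 ≤ s) :
    a ^ s * Real.exp (-a) ≤ Real.Gamma (s + 1) := by
  rw [Real.Gamma_eq_integral (by linarith)]
  have hint := Real.GammaIntegral_convergent (s := s + 1) (by linarith)
  have h1 : ∫ x in Ioi a, Real.exp (-x) * a ^ s ≤ ∫ x in Ioi a, Real.exp (-x) * x ^ (s + 1 - 1) := by
    refine setIntegral_mono_on ?_ (hint.mono_set (Ioi_subset_Ioi ha.le)) measurableSet_Ioi ?_
    · exact (integrableOn_exp_neg_Ioi a).mul_const _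
    · intro x hx
      have : a ^ s ≤ x ^ (s + 1 - 1) := by
        rw [add_sub_cancel_right]
        exact Real.rpow_le_rpow ha.le (le_of_lt hx) hs
      gcongr
  rw [integral_mul_const, integral_exp_neg_Ioi] at h1
  refine le_trans (by linarith [h1]) (setIntegral_mono_set hint ?_ ?_)
  · filter_upwards [ae_restrict_mem measurableSet_Ioi] with x hx
    have : (0:ℝ) < x := hx
    simp only [Pi.zero_apply]; positivity
  · exact (Ioi_subset_Ioi ha.le).eventuallyLE

lemma summable_mittagLeffler {ν : ℝ} (hν : 0 < ν) (x : ℝ) :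
    Summable fun j : ℕ => x ^ j / Real.Gamma (ν * j + 1) := by
  -- Chosen so that a^ν = 2|x| + 1: then Γ(νj+1) ≥ e^{-a} (2|x|+1)^j, and the series is dominated by
  -- a geometric one of ratio 1/2.
  set a : ℝ := (2 * |x| + 1) ^ (1 / ν) with ha
  have hx : 0 < 2 * |x| + 1 := by positivity
  have ha0 : 0 < a := by positivity
  have haν : a ^ ν = 2 * |x| + 1 := by
    rw [ha, ← Real.rpow_mul hx.le, one_div, inv_mul_cancel₀ hν.ne', Real.rpow_one]
  refine Summable.of_norm_bounded (g := fun j : ℕ => Real.exp a * (1 / 2) ^ j)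
    ((summable_geometric_of_lt_one (by norm_num) (by norm_num)).mul_left _) fun j => ?_
  have hG := rpow_mul_exp_neg_le_Gamma ha0 (s := ν * j) (by positivity)
  rw [Real.rpow_mul ha0.le, haν, Real.rpow_natCast] at hG
  have hpos : 0 < (2 * |x| + 1) ^ j * Real.exp (-a) := by positivity
  rw [Real.norm_eq_abs, abs_div, abs_pow, abs_of_pos (hpos.trans_le hG)]
  calc |x| ^ j / Real.Gamma (ν * j + 1) ≤ |x| ^ j / ((2 * |x| + 1) ^ j * Real.exp (-a)) := by gcongr
    _ = Real.exp a * (|x| / (2 * |x| + 1)) ^ j := by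
        rw [Real.exp_neg, div_pow]; field_simp
    _ ≤ _ := by
        have : |x| / (2 * |x| + 1) ≤ 1 / 2 := by
          rw [div_le_div_iff₀ hx (by norm_num)]
          linarith
        gcongr

/-- `Y` has the Mittag-Leffler distribution of order `ν` (moments `j! / Γ(ν j + 1)`), and its
Laplace transform decays at least like `1 / x`. -/
structure IsMittagLefflerVar {Ω : Type*} [MeasurableSpace Ω] (ν : ℝ) (P : Measure Ω)
    (Y : Ω → ℝ) : Prop where
  measurable : Measurable Y
  pos : ∀ᵐ ω ∂P, 0 < Y ω
  integrable_pow : ∀ j : ℕ, Integrable (fun ω => Y ω ^ j) P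
  moment : ∀ j : ℕ, ∫ ω, Y ω ^ j ∂P = j.factorial / Real.Gamma (ν * j + 1)
  decay : ∃ C : ℝ, 0 ≤ C ∧ ∀ x : ℝ, 0 < x → ∫ ω, Real.exp (-x * Y ω) ∂P ≤ C / x

variable {Ω : Type*} [MeasurableSpace Ω] {P : Measure Ω} {ν : ℝ} {Y : Ω → ℝ}

lemma IsMittagLefflerVar.summable_moments (hY : IsMittagLefflerVar ν P Y) (hν : 0 < ν) (r : ℝ) :
    Summable fun j : ℕ => r ^ j / (j.factorial : ℝ) * ∫ ω, Y ω ^ j ∂P := by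
  refine (summable_mittagLeffler hν r).congr fun j => ?_
  rw [hY.moment]
  have : (j.factorial : ℝ) ≠ 0 := by positivity
  field_simp

lemma IsMittagLefflerVar.nonneg (hY : IsMittagLefflerVar ν P Y) : ∀ᵐ ω ∂P, 0 ≤ Y ω :=
  hY.pos.mono fun _ h => h.le

/-- The factorials in the moments cancel those of the exponential series. This representation as a
Laplace transform is the source of 0 ≤ E_{ν,1}(-x) ≤ 1 for x ≥ 0 and of the decay in x. -/
lemma IsMittagLefflerVar.integral_exp (hY : IsMittagLefflerVar ν P Y) (hν : 0 < ν) (x : ℝ) :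
    ∫ ω, Real.exp (x * Y ω) ∂P = mittagLeffler ν x := by
  rw [← (hasSum_integral_exp_of_moments hY.nonneg hY.integrable_pow
    (fun r _ => hY.summable_moments hν r) x).tsum_eq, mittagLeffler]
  refine tsum_congr fun j => ?_
  rw [hY.moment]
  have : (j.factorial : ℝ) ≠ 0 := by positivity
  field_simp

lemma IsMittagLefflerVar.integrable_exp [IsFiniteMeasure P] (hY : IsMittagLefflerVar ν P Y)
    {x : ℝ} (hx : 0 ≤ x) : Integrable (fun ω => Real.exp (-x * Y ω)) P := by
  refine Integrable.of_bound (C := 1)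
    ((Real.measurable_exp.comp (hY.measurable.const_mul _)).aestronglyMeasurable) ?_
  filter_upwards [hY.nonneg] with ω hω
  rw [Real.norm_eq_abs, abs_of_pos (Real.exp_pos _), Real.exp_le_one_iff]
  nlinarith

end MittagLeffler

/-! ### The stable subordinator and its inverse -/

section Subordinator

variable {Ω Ω' : Type*} [MeasurableSpace Ω] [MeasurableSpace Ω']

lemma integrable_exp_neg_pow {P : Measure Ω} [IsFiniteMeasure P] {X : Ω → ℝ} (hm : Measurable X)
    (h : ∀ᵐ ω ∂P, 0 ≤ X ω) (j : ℕ) : Integrable (fun ω => Real.exp (-X ω) ^ j) P := by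
  refine Integrable.of_bound (C := 1)
    (((Real.measurable_exp.comp hm.neg).pow_const j).aestronglyMeasurable) ?_
  filter_upwards [h] with ω hω
  rw [Real.norm_eq_abs, abs_of_pos (by positivity)]
  exact pow_le_one₀ (Real.exp_pos _).le (Real.exp_le_one_iff.2 (by linarith))

/-- The law of a nonnegative random variable is determined by its Laplace transform at the
natural numbers. -/
lemma map_eq_map_of_laplace {P : Measure Ω} {P' : Measure Ω'} [IsFiniteMeasure P]
    [IsFiniteMeasure P'] {X : Ω → ℝ} {X' : Ω' → ℝ} (hXm : Measurable X) (hXm' : Measurable X')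
    (hX : ∀ᵐ ω ∂P, 0 ≤ X ω) (hX' : ∀ᵐ ω ∂P', 0 ≤ X' ω)
    (h : ∀ k : ℕ, ∫ ω, Real.exp (-k * X ω) ∂P = ∫ ω, Real.exp (-k * X' ω) ∂P') :
    P.map X = P'.map X' := by
  have hpow : ∀ (j : ℕ) (y : ℝ), Real.exp (-y) ^ j = Real.exp (-j * y) := fun j y => by
    rw [← Real.exp_nat_mul]; ring_nf
  -- The values of the Laplace transform at the natural numbers are the moments of the bounded
  -- variable e^{-X}, so they fix its law; -log then recovers X.
  have hW : P.map (fun ω => Real.exp (-X ω)) = P'.map (fun ω => Real.exp (-X' ω)) := by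
    refine map_eq_map_of_moments (by fun_prop) (by fun_prop)
      (Eventually.of_forall fun _ => (Real.exp_pos _).le)
      (Eventually.of_forall fun _ => (Real.exp_pos _).le) (integrable_exp_neg_pow hXm hX) (integrable_exp_neg_pow hXm' hX') ?_ ?_
    · intro r hr
      refine Summable.of_nonneg_of_le (fun j => ?_) (fun j => ?_)
        ((Real.summable_pow_div_factorial r).mul_right (P.real univ))
      · have : 0 ≤ ∫ ω, Real.exp (-X ω) ^ j ∂P := integral_nonneg fun _ => by positivity
        positivity
      · have : ∫ ω, Real.exp (-X ω) ^ j ∂P ≤ ∫ ω, (1 : ℝ) ∂P := by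
          refine integral_mono_ae (integrable_exp_neg_pow hXm hX j) (integrable_const _) ?_
          filter_upwards [hX] with ω hω
          exact pow_le_one₀ (Real.exp_pos _).le (Real.exp_le_one_iff.2 (by linarith))
        rw [integral_const, smul_eq_mul, mul_one] at this
        gcongr
    · intro j
      simp only [hpow]
      exact h j
  have h2 := congrArg (Measure.map (fun w => -Real.log w)) hW
  rw [Measure.map_map (by fun_prop) (by fun_prop),
    Measure.map_map (by fun_prop) (by fun_prop)] at h2
  simpa [Function.comp_def] using h2

variable {P : Measure Ω} {ν : ℝ} {H : ℝ≥0 → Ω → ℝ}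

lemma IsStableSubordinator.nonneg (hH : IsStableSubordinator ν H P) (t : ℝ≥0) :
    ∀ᵐ ω ∂P, 0 ≤ H t ω := by
  filter_upwards [hH.zero, hH.paths] with ω h0 hp
  rw [← h0]
  exact hp.1 (zero_le)

lemma IsStableSubordinator.laplace_zero (hH : IsStableSubordinator ν H P) (t : ℝ≥0) {μ : ℝ}
    (hμ : 0 ≤ μ) : ∫ ω, Real.exp (-μ * H t ω) ∂P = Real.exp (-t * μ ^ ν) := by
  have h := hH.laplace 0 t (zero_le) μ hμ
  rw [NNReal.coe_zero, sub_zero] at h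
  rw [← h]
  refine integral_congr_ae ?_
  filter_upwards [hH.zero] with ω h0
  simp [h0]

variable [IsProbabilityMeasure P]

/-- Self-similarity: both Laplace transforms equal e^{-s k^ν} at k. -/
lemma IsStableSubordinator.map_eq (hH : IsStableSubordinator ν H P) (hν : 0 < ν) (s : ℝ≥0) :
    P.map (H s) = P.map (fun ω => (s : ℝ) ^ (1 / ν) * H 1 ω) := by
  refine map_eq_map_of_laplace (hH.measurable s) ((hH.measurable 1).const_mul _) (hH.nonneg s) ?_ ?_
  · filter_upwards [hH.nonneg 1] with ω h
    positivity
  · intro k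
    have h1 := hH.laplace_zero 1 (μ := k * (s : ℝ) ^ (1 / ν)) (by positivity)
    rw [hH.laplace_zero s (Nat.cast_nonneg k)]
    rw [Real.mul_rpow (by positivity) (by positivity), ← Real.rpow_mul (by positivity), one_div,
      inv_mul_cancel₀ hν.ne', Real.rpow_one] at h1
    have h2 : -(s : ℝ) * (k : ℝ) ^ ν = -((1 : ℝ≥0) : ℝ) * ((k : ℝ) ^ ν * s) := by
      push_cast; ring
    rw [h2, ← h1]
    refine integral_congr_ae (Eventually.of_forall fun ω => ?_)
    simp only [one_div]
    ring_nf

lemma IsStableSubordinator.integrable_exp (hH : IsStableSubordinator ν H P) (t : ℝ≥0) {μ : ℝ}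
    (hμ : 0 ≤ μ) : Integrable (fun ω => Real.exp (-μ * H t ω)) P := by
  refine Integrable.of_bound (C := 1)
    ((Real.measurable_exp.comp ((hH.measurable t).const_mul _)).aestronglyMeasurable) ?_
  filter_upwards [hH.nonneg t] with ω hω
  rw [Real.norm_eq_abs, abs_of_pos (Real.exp_pos _), Real.exp_le_one_iff]
  nlinarith

/-- Chernoff bound with the negative exponent -μ. Sending μ to infinity at level 0 gives H(1) > 0;
sending s to infinity shows that the paths are unbounded. -/
lemma IsStableSubordinator.measure_le (hH : IsStableSubordinator ν H P) (s : ℝ≥0) (t : ℝ) {μ : ℝ}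
    (hμ : 0 ≤ μ) : P.real {ω | H s ω ≤ t} ≤ Real.exp (μ * t) * Real.exp (-s * μ ^ ν) := by
  have h := measure_le_le_exp_mul_mgf (μ := P) (X := H s) t (t := -μ) (by linarith)
    (hH.integrable_exp s hμ)
  rwa [neg_neg, mgf, hH.laplace_zero s hμ] at h

lemma ae_of_forall_measureReal_le {p : Ω → Prop} {u : ℕ → ℝ} (hu : Tendsto u atTop (𝓝 0))
    (h : ∀ k, P.real {ω | ¬ p ω} ≤ u k) : ∀ᵐ ω ∂P, p ω := by
  have h0 : P.real {ω | ¬ p ω} ≤ 0 := ge_of_tendsto' hu h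
  rw [ae_iff]
  exact (measureReal_eq_zero_iff).1 (le_antisymm h0 measureReal_nonneg)

lemma IsStableSubordinator.pos_one (hH : IsStableSubordinator ν H P) (hν : 0 < ν) :
    ∀ᵐ ω ∂P, 0 < H 1 ω := by
  refine ae_of_forall_measureReal_le (u := fun k : ℕ => Real.exp (-((k : ℝ) ^ ν))) ?_ fun k => ?_
  · exact Real.tendsto_exp_neg_atTop_nhds_zero.comp
      ((tendsto_rpow_atTop hν).comp tendsto_natCast_atTop_atTop)
  · have h := hH.measure_le 1 0 (Nat.cast_nonneg k)
    simpa [not_lt] using h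

/-- Guarantees that the infimum defining L(t) is over a nonempty set, so that `sInf` does not take
its default value 0. -/
lemma IsStableSubordinator.exists_le (hH : IsStableSubordinator ν H P) (t : ℝ) :
    ∀ᵐ ω ∂P, ∃ N : ℕ, t ≤ H N ω := by
  refine ae_of_forall_measureReal_le (u := fun k : ℕ => Real.exp t * Real.exp (-(k : ℝ))) ?_
    fun k => ?_
  · rw [← mul_zero (Real.exp t)]
    exact (Real.tendsto_exp_neg_atTop_nhds_zero.comp tendsto_natCast_atTop_atTop).const_mul _
  · have h := hH.measure_le k t zero_le_one
    rw [Real.one_rpow, mul_one, one_mul] at h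
    refine le_trans (measureReal_mono fun ω hω => ?_) h
    simp only [mem_ofPred_eq, not_exists, not_le] at hω
    exact (hω k).le

/-- Monotonicity gives H ≥ t at every time after L(t), and right-continuity carries this to L(t)
itself. The exceptional null set does not depend on s. -/
lemma IsStableSubordinator.inverse_le_iff (hH : IsStableSubordinator ν H P) {t : ℝ} (ht : 0 < t) :
    ∀ᵐ ω ∂P, ∀ s : ℝ≥0, inverseProcess H t ω ≤ s ↔ t ≤ H s ω := by
  filter_upwards [hH.zero, hH.paths, hH.exists_le t] with ω h0 hp hN s
  obtain ⟨N, hN⟩ := hN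
  have hpos : ∀ r : ℝ≥0, t ≤ H r ω → 0 < r := fun r hr => by
    rcases eq_or_ne r 0 with rfl | h
    · rw [h0] at hr; linarith
    · exact pos_iff_ne_zero.2 h
  have hne : {s : ℝ≥0 | 0 < s ∧ t ≤ H s ω}.Nonempty := ⟨N, hpos _ hN, hN⟩
  rw [inverseProcess, NNReal.coe_le_coe]
  constructor
  · intro hs
    have hr : ∀ r ∈ Ioi s, t ≤ H r ω := fun r hr => by
      obtain ⟨q, hq, hqr⟩ := exists_lt_of_csInf_lt hne (lt_of_le_of_lt hs hr)
      exact hq.2.trans (hp.1 hqr.le)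
    exact ge_of_tendsto ((hp.2 s).mono_left (nhdsWithin_mono s Ioi_subset_Ici_self))
      (eventually_mem_nhdsWithin.mono hr)
  · intro hs
    exact csInf_le (OrderBot.bddBelow _) ⟨hpos _ hs, hs⟩

/-- Needed because at time 0 the integral in `lineDensity` diverges and takes the default value 0,
so `ringLaw` is not the unit mass there. -/
lemma IsStableSubordinator.inverse_pos (hH : IsStableSubordinator ν H P) {t : ℝ} (ht : 0 < t) :
    ∀ᵐ ω ∂P, 0 < inverseProcess H t ω := by
  filter_upwards [hH.zero, hH.inverse_le_iff ht] with ω h0 h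
  by_contra! hc
  have := (h 0).1 (by simpa using hc)
  linarith

lemma IsStableSubordinator.aemeasurable_inverse (hH : IsStableSubordinator ν H P) {t : ℝ}
    (ht : 0 < t) : AEMeasurable (inverseProcess H t) P := by
  refine NullMeasurable.aemeasurable ?_
  -- The description of the events {L(t) ≤ s} through H(s) is only almost sure, so they are
  -- measurable only up to null sets.
  have : @Measurable (NullMeasurableSpace Ω P) ℝ _ _ (inverseProcess H t) := by
    refine measurable_of_Iic fun s => ?_
    change NullMeasurableSet (inverseProcess H t ⁻¹' Iic s) P
    rcases lt_or_ge s 0 with hs | hs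
    · have : inverseProcess H t ⁻¹' Iic s = ∅ := by
        ext ω
        simp only [mem_preimage, mem_Iic, mem_empty_iff_false, iff_false, not_le]
        exact hs.trans_le (NNReal.coe_nonneg _)
      rw [this]; exact nullMeasurableSet_empty
    · lift s to ℝ≥0 using hs
      refine NullMeasurableSet.congr
        ((measurableSet_le measurable_const (hH.measurable s)).nullMeasurableSet :
          NullMeasurableSet {ω | t ≤ H s ω} P) ?_
      filter_upwards [hH.inverse_le_iff ht] with ω h
      exact propext (h s).symm
  exact fun s hs => this hs

/-- P(L(t) ≤ s) = P(H(s) ≥ t) = P(s^{1/ν} H(1) ≥ t) = P(t^ν H(1)^{-ν} ≤ s) for s > 0. -/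
lemma IsStableSubordinator.map_inverse (hH : IsStableSubordinator ν H P) (hν : 0 < ν) {t : ℝ}
    (ht : 0 < t) :
    P.map (inverseProcess H t) = P.map (fun ω => t ^ ν * H 1 ω ^ (-ν)) := by
  have hm : Measurable fun ω => t ^ ν * H 1 ω ^ (-ν) :=
    ((hH.measurable 1).pow_const _).const_mul _
  have : IsFiniteMeasure (P.map (inverseProcess H t)) := Measure.isFiniteMeasure_map _ _
  refine Measure.ext_of_Iic _ _ fun s => ?_
  rw [Measure.map_apply_of_aemeasurable (hH.aemeasurable_inverse ht) measurableSet_Iic,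
    Measure.map_apply hm measurableSet_Iic]
  rcases le_or_gt s 0 with hs | hs
  · refine measure_congr ?_
    filter_upwards [hH.inverse_pos ht, hH.pos_one hν] with ω h1 h2
    refine propext (iff_of_false (fun h => ?_) (fun h => ?_))
    · exact absurd (h1.trans_le h) (not_lt.2 hs)
    · have h3 : 0 < t ^ ν * H 1 ω ^ (-ν) := by positivity
      exact absurd (h3.trans_le h) (not_lt.2 hs)
  · lift s to ℝ≥0 using hs.le
    have h1 : P (inverseProcess H t ⁻¹' Iic ↑s) = P (H s ⁻¹' Ici t) := by
      refine measure_congr ?_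
      filter_upwards [hH.inverse_le_iff ht] with ω h
      exact propext (h s)
    rw [h1, ← Measure.map_apply (hH.measurable s) measurableSet_Ici, hH.map_eq hν s,
      Measure.map_apply ((hH.measurable 1).const_mul _) measurableSet_Ici]
    refine measure_congr ?_
    filter_upwards [hH.pos_one hν] with ω hZ
    refine propext ?_
    change t ≤ (s : ℝ) ^ (1 / ν) * H 1 ω ↔ t ^ ν * H 1 ω ^ (-ν) ≤ s
    rw [Real.rpow_neg hZ.le, ← div_eq_mul_inv, div_le_iff₀ (by positivity)]
    have h2 : ((s : ℝ) ^ (1 / ν) * H 1 ω) ^ ν = s * H 1 ω ^ ν := by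
      rw [Real.mul_rpow (by positivity) hZ.le, ← Real.rpow_mul (by positivity), one_div,
        inv_mul_cancel₀ hν.ne', Real.rpow_one]
    rw [← h2, Real.rpow_le_rpow_iff ht.le (by positivity) hν]

lemma lintegral_rpow_mul_exp_neg_mul {a r : ℝ} (ha : 0 < a) (hr : 0 < r) :
    ∫⁻ x in Ioi 0, ENNReal.ofReal (x ^ (a - 1) * Real.exp (-(r * x))) =
      ENNReal.ofReal ((1 / r) ^ a * Real.Gamma a) := by
  have h := Real.integral_rpow_mul_exp_neg_mul_Ioi ha hr
  have hpos : 0 < (1 / r) ^ a * Real.Gamma a := by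
    have := Real.Gamma_pos_of_pos ha
    positivity
  rw [← h, ofReal_integral_eq_lintegral_ofReal]
  -- A nonintegrable function has integral 0 by convention, so a positive value of the integral
  -- proves integrability.
  · by_contra hc
    rw [integral_undef hc] at h
    linarith
  · filter_upwards [ae_restrict_mem measurableSet_Ioi] with x hx
    have : (0 : ℝ) < x := hx
    simp only [Pi.zero_apply]; positivity

/-- Write Γ(νj) z^{-νj} = ∫ x^{νj-1} e^{-zx} dx at z = H(1), exchange by Tonelli, and insert the
Laplace transform e^{-x^ν}; the remaining integral is Γ(j)/ν. The case j = 0 is separate because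
Γ(νj) is then not given by a convergent integral. -/
lemma IsStableSubordinator.lintegral_moment (hH : IsStableSubordinator ν H P) (hν : 0 < ν) (j : ℕ) :
    ∫⁻ ω, ENNReal.ofReal ((H 1 ω ^ (-ν)) ^ j) ∂P =
      ENNReal.ofReal (j.factorial / Real.Gamma (ν * j + 1)) := by
  rcases Nat.eq_zero_or_pos j with rfl | hj
  · simp
  have hj' : (0 : ℝ) < j := by exact_mod_cast hj
  have ha : 0 < ν * j := by positivity
  have hΓ := Real.Gamma_pos_of_pos ha
  have h1 : ∀ᵐ ω ∂P, ENNReal.ofReal ((H 1 ω ^ (-ν)) ^ j) * ENNReal.ofReal (Real.Gamma (ν * j)) =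
      ∫⁻ x in Ioi 0, ENNReal.ofReal (x ^ (ν * j - 1) * Real.exp (-(H 1 ω * x))) := by
    filter_upwards [hH.pos_one hν] with ω hZ
    rw [lintegral_rpow_mul_exp_neg_mul ha hZ, ← ENNReal.ofReal_mul (by positivity)]
    congr 2
    rw [← Real.rpow_natCast, ← Real.rpow_mul hZ.le, one_div, Real.inv_rpow hZ.le, neg_mul,
      Real.rpow_neg hZ.le]
  have hΓ' : ENNReal.ofReal (Real.Gamma (ν * j)) ≠ 0 := by simpa using hΓ
  rw [← ENNReal.mul_left_inj hΓ' ENNReal.ofReal_ne_top, ← lintegral_mul_const' _ _ ENNReal.ofReal_ne_top,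
    lintegral_congr_ae h1]
  have hmeas : Measurable (Function.uncurry fun (ω : Ω) (x : ℝ) =>
      ENNReal.ofReal (x ^ (ν * j - 1) * Real.exp (-(H 1 ω * x)))) := by
    have := hH.measurable 1
    unfold Function.uncurry
    fun_prop
  rw [lintegral_lintegral_swap hmeas.aemeasurable]
  have h2 : ∀ x ∈ Ioi (0 : ℝ), ∫⁻ ω, ENNReal.ofReal (x ^ (ν * j - 1) * Real.exp (-(H 1 ω * x))) ∂P =
      ENNReal.ofReal (x ^ (ν * j - 1) * Real.exp (-x ^ ν)) := by
    intro x hx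
    have hx : 0 < x := hx
    have h3 := hH.laplace_zero 1 hx.le
    rw [NNReal.coe_one, neg_one_mul] at h3
    rw [← h3, ← integral_const_mul, ofReal_integral_eq_lintegral_ofReal
      ((hH.integrable_exp 1 hx.le).const_mul _) (Eventually.of_forall fun ω => by positivity)]
    refine lintegral_congr fun ω => ?_
    ring_nf
  rw [setLIntegral_congr_fun measurableSet_Ioi h2]
  have h4 := integral_rpow_mul_exp_neg_rpow (p := ν) (q := ν * j - 1) hν (by linarith)
  have h5 : (ν * j - 1 + 1) / ν = j := by field_simp; ring
  rw [h5] at h4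
  have h6 : (j.factorial : ℝ) / Real.Gamma (ν * j + 1) * Real.Gamma (ν * j) =
      1 / ν * Real.Gamma j := by
    rw [Real.Gamma_add_one ha.ne']
    obtain ⟨m, rfl⟩ : ∃ m, j = m + 1 := ⟨j - 1, by omega⟩
    rw [Nat.factorial_succ]
    have h7 := Real.Gamma_nat_eq_factorial m
    push_cast at h7 hΓ hj' ⊢
    rw [h7]
    field_simp
  have hpos : 0 < 1 / ν * Real.Gamma j := by
    have := Real.Gamma_pos_of_pos hj'
    positivity
  rw [← ENNReal.ofReal_mul (by have := Real.Gamma_pos_of_pos (by linarith : 0 < ν * j + 1); positivity),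
    h6, ← h4, ofReal_integral_eq_lintegral_ofReal]
  · by_contra hc
    rw [integral_undef hc] at h4
    linarith
  · filter_upwards [ae_restrict_mem measurableSet_Ioi] with x hx
    have : (0 : ℝ) < x := hx
    simp only [Pi.zero_apply]; positivity

/-- For r ≥ 1 the bracket is at least 1/2. For r ≤ 1 it is at least r/2, while e^{-r^{-ν}} ≤ k!
r^{νk} ≤ k! r as soon as νk ≥ 1. -/
lemma exists_exp_neg_rpow_neg_le (hν : 0 < ν) :
    ∃ C : ℝ, 0 ≤ C ∧ ∀ r : ℝ, 0 < r → Real.exp (-r ^ (-ν)) ≤ C * (1 - Real.exp (-r)) := by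
  obtain ⟨k, hk⟩ := exists_nat_gt (1 / ν)
  have hk' : 1 ≤ ν * k := by
    rw [div_lt_iff₀ hν] at hk; linarith
  have he : ∀ r : ℝ, 0 < r → r / (1 + r) ≤ 1 - Real.exp (-r) := fun r hr => by
    have h1 := Real.add_one_le_exp r
    have h2 : Real.exp (-r) ≤ 1 / (1 + r) := by
      rw [Real.exp_neg, ← one_div]
      exact one_div_le_one_div_of_le (by positivity) (by linarith)
    have h3 : r / (1 + r) = 1 - 1 / (1 + r) := by field_simp; ring
    linarith
  refine ⟨2 * k.factorial, by positivity, fun r hr => ?_⟩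
  have hf : (1 : ℝ) ≤ k.factorial := by exact_mod_cast Nat.succ_le_of_lt k.factorial_pos
  rcases le_total 1 r with h1 | h1
  · have h2 := he r hr
    have h3 : 1 / 2 ≤ r / (1 + r) := by
      rw [div_le_div_iff₀ (by norm_num) (by positivity)]; linarith
    have h4 : Real.exp (-r ^ (-ν)) ≤ 1 := Real.exp_le_one_iff.2 (by
      have : 0 < r ^ (-ν) := by positivity
      linarith)
    nlinarith
  · have h2 := Real.pow_div_factorial_le_exp (r ^ (-ν)) (by positivity) k
    have h3 : Real.exp (-r ^ (-ν)) ≤ k.factorial * r := by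
      rw [Real.exp_neg]
      have h4 : (r ^ (-ν)) ^ k = (r ^ (ν * k))⁻¹ := by
        rw [← Real.rpow_natCast, ← Real.rpow_mul hr.le, neg_mul, Real.rpow_neg hr.le]
      rw [h4] at h2
      have h5 : r ^ (ν * k) ≤ r := by
        simpa using Real.rpow_le_rpow_of_exponent_ge hr h1 hk'
      have h6 : 0 < r ^ (ν * k) := by positivity
      calc (Real.exp (r ^ (-ν)))⁻¹ ≤ ((r ^ (ν * k))⁻¹ / k.factorial)⁻¹ := by gcongr
        _ = k.factorial * r ^ (ν * k) := by field_simp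
        _ ≤ _ := by gcongr
    have h7 : r / 2 ≤ r / (1 + r) := by gcongr; linarith
    have h8 := he r hr
    calc _ ≤ _ := h3
      _ = 2 * k.factorial * (r / 2) := by ring
      _ ≤ _ := by gcongr; linarith

lemma one_sub_exp_neg_le (x : ℝ) : 1 - Real.exp (-x) ≤ x := by
  have := Real.add_one_le_exp (-x); linarith

/-- The inverse power of a stable variable has the Mittag-Leffler distribution. -/
lemma IsStableSubordinator.isMittagLefflerVar (hH : IsStableSubordinator ν H P) (hν : 0 < ν) :
    IsMittagLefflerVar ν P (fun ω => H 1 ω ^ (-ν)) := by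
  have hm : Measurable fun ω => H 1 ω ^ (-ν) := (hH.measurable 1).pow_const _
  have hpos : ∀ᵐ ω ∂P, 0 < H 1 ω ^ (-ν) := by
    filter_upwards [hH.pos_one hν] with ω h
    positivity
  have hnn : ∀ j : ℕ, 0 ≤ᵐ[P] fun ω => (H 1 ω ^ (-ν)) ^ j := fun j => by
    filter_upwards [hpos] with ω h
    simp only [Pi.zero_apply]; positivity
  refine ⟨hm, hpos, fun j => ?_, fun j => ?_, ?_⟩
  · rw [← lintegral_ofReal_ne_top_iff_integrable (hm.pow_const j).aestronglyMeasurable (hnn j),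
      hH.lintegral_moment hν]
    exact ENNReal.ofReal_ne_top
  · rw [integral_eq_lintegral_of_nonneg_ae (hnn j) (hm.pow_const j).aestronglyMeasurable,
      hH.lintegral_moment hν, ENNReal.toReal_ofReal]
    have := Real.Gamma_pos_of_pos (by positivity : 0 < ν * j + 1)
    positivity
  · obtain ⟨C, hC, hb⟩ := exists_exp_neg_rpow_neg_le hν
    refine ⟨C, hC, fun x hx => ?_⟩
    -- With m^{-ν} = x the integrand is exp(-(m H(1))^{-ν}), which the comparison bounds by C(1 -
    -- e^{-m H(1)}); its mean is C(1 - e^{-m^ν}) ≤ C m^ν = C/x.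
    set m : ℝ := x ^ (-(1 / ν)) with hmdef
    have hm0 : 0 < m := by positivity
    have hmν : m ^ (-ν) = x := by
      rw [hmdef, ← Real.rpow_mul hx.le, neg_mul_neg, one_div, inv_mul_cancel₀ hν.ne', Real.rpow_one]
    have hint := hH.integrable_exp 1 hm0.le
    have h1 : ∫ ω, Real.exp (-x * H 1 ω ^ (-ν)) ∂P ≤
        ∫ ω, C * (1 - Real.exp (-m * H 1 ω)) ∂P := by
      refine integral_mono_of_nonneg (Eventually.of_forall fun _ => (Real.exp_pos _).le)
        (((integrable_const _).sub hint).const_mul _) ?_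
      filter_upwards [hH.pos_one hν] with ω hZ
      have h2 := hb (m * H 1 ω) (by positivity)
      rw [Real.mul_rpow hm0.le hZ.le, hmν] at h2
      simpa [neg_mul] using h2
    refine h1.trans ?_
    rw [integral_const_mul, integral_sub (integrable_const _) hint, hH.laplace_zero 1 hm0.le]
    have h3 : m ^ ν = 1 / x := by
      rw [← hmν, Real.rpow_neg hm0.le, one_div, inv_inv]
    have h4 := one_sub_exp_neg_le (1 / x)
    rw [h3]
    simp only [integral_const, probReal_univ, smul_eq_mul, mul_one, NNReal.coe_one, neg_one_mul]
    exact (mul_le_mul_of_nonneg_left h4 hC).trans_eq (by ring)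

end Subordinator

/-! ### Caputo derivatives of averages over the random time -/

section Caputo

lemma integral_rpow_mul_sub_rpow {a b t : ℝ} (ha : 0 < a) (hb : 0 < b) (ht : 0 < t) :
    ∫ s in Ioo 0 t, s ^ (a - 1) * (t - s) ^ (b - 1) =
      t ^ (a + b - 1) * (Real.Gamma a * Real.Gamma b / Real.Gamma (a + b)) := by
  have h := Complex.betaIntegral_scaled a b ht
  rw [Complex.betaIntegral_eq_Gamma_mul_div _ _ (by simpa) (by simpa), ← Complex.ofReal_add,
    Complex.Gamma_ofReal, Complex.Gamma_ofReal, Complex.Gamma_ofReal,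
    intervalIntegral.integral_of_le ht.le, integral_Ioc_eq_integral_Ioo] at h
  have h2 : ∫ s in Ioo 0 t, (s : ℂ) ^ ((a : ℂ) - 1) * ((t : ℂ) - s) ^ ((b : ℂ) - 1) =
      ∫ s in Ioo 0 t, ((s ^ (a - 1) * (t - s) ^ (b - 1) : ℝ) : ℂ) := by
    refine setIntegral_congr_fun measurableSet_Ioo fun s hs => ?_
    rw [Complex.ofReal_mul, Complex.ofReal_cpow hs.1.le, Complex.ofReal_cpow (sub_pos.2 hs.2).le]
    push_cast
    rfl
  rw [h2, integral_complex_ofReal] at h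
  rw [← Complex.ofReal_inj, h, Complex.ofReal_mul, Complex.ofReal_cpow ht.le]
  push_cast
  rfl

lemma integrableOn_rpow_mul_sub_rpow {a b t : ℝ} (ha : 0 < a) (hb : 0 < b) (ht : 0 < t) :
    IntegrableOn (fun s => s ^ (a - 1) * (t - s) ^ (b - 1)) (Ioo 0 t) := by
  by_contra hc
  have h := integral_rpow_mul_sub_rpow ha hb ht
  rw [integral_undef hc] at h
  have h1 := Real.Gamma_pos_of_pos ha
  have h2 := Real.Gamma_pos_of_pos hb
  have h3 := Real.Gamma_pos_of_pos (add_pos ha hb)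
  have : 0 < t ^ (a + b - 1) * (Real.Gamma a * Real.Gamma b / Real.Gamma (a + b)) := by positivity
  linarith

variable {Ω : Type*} {ν : ℝ} {Y : Ω → ℝ}

/-- The weight `ν s^{ν-1} (t-s)^{-ν} / Γ(1-ν) · Y` on `(0,t) × Ω`. -/
def caputoWeight (ν t : ℝ) (Y : Ω → ℝ) (z : ℝ × Ω) : ℝ :=
  (ν / Real.Gamma (1 - ν) * (z.1 ^ (ν - 1) * (t - z.1) ^ (-ν))) * Y z.2

/-- The weight raises the power of Y by one and leaves a Beta integrand in the time variable. -/
lemma caputoWeight_mul_pow {t : ℝ} (z : ℝ × Ω) (hz : 0 < z.1) (j : ℕ) :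
    caputoWeight ν t Y z * (z.1 ^ ν * Y z.2) ^ j =
      (ν / Real.Gamma (1 - ν) * (z.1 ^ (ν * (j + 1) - 1) * (t - z.1) ^ ((1 - ν) - 1))) *
        Y z.2 ^ (j + 1) := by
  have h1 : z.1 ^ (ν * (j + 1) - 1) = z.1 ^ (ν - 1) * (z.1 ^ ν) ^ j := by
    rw [← Real.rpow_natCast, ← Real.rpow_mul hz.le, ← Real.rpow_add hz]; ring_nf
  have h2 : (1 - ν) - 1 = -ν := by ring
  rw [caputoWeight, h1, h2, mul_pow]
  ring

variable [MeasurableSpace Ω] {P : Measure Ω}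

lemma ae_fst_mem [SFinite P] {t : ℝ} : ∀ᵐ z ∂((volume : Measure ℝ).restrict (Ioo 0 t)).prod P,
    z.1 ∈ Ioo 0 t :=
  Measure.quasiMeasurePreserving_fst.ae (ae_restrict_mem measurableSet_Ioo)

namespace IsMittagLefflerVar

lemma measurable_caputoWeight (hY : IsMittagLefflerVar ν P Y) (t : ℝ) :
    Measurable (caputoWeight ν t Y) := by
  have := hY.measurable
  unfold caputoWeight
  fun_prop

lemma hasDerivAt_integral_comp (hY : IsMittagLefflerVar ν P Y) (hν0 : 0 < ν) (hν1 : ν ≤ 1)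
    {F G : ℝ → ℝ} (hF : ∀ y, 0 < y → HasDerivAt F (G y) y) (hG : Measurable G) {C : ℝ}
    (hC : ∀ y, 0 < y → |G y| ≤ C)
    (hint : ∀ t, 0 < t → Integrable (fun ω => F (t ^ ν * Y ω)) P) {t : ℝ} (ht : 0 < t) :
    HasDerivAt (fun s => ∫ ω, F (s ^ ν * Y ω) ∂P)
      (∫ ω, ν * t ^ (ν - 1) * Y ω * G (t ^ ν * Y ω) ∂P) t := by
  have hYm := hY.measurable
  -- On (t/2, ∞) the factor s^{ν-1} is at most (t/2)^{ν-1} because ν ≤ 1, so a multiple of Y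
  -- dominates.
  have hs : Ioi (t / 2) ∈ 𝓝 t := Ioi_mem_nhds (by linarith)
  refine (hasDerivAt_integral_of_dominated_loc_of_deriv_le
    (bound := fun ω => ν * (t / 2) ^ (ν - 1) * C * Y ω)
    (F' := fun s ω => ν * s ^ (ν - 1) * Y ω * G (s ^ ν * Y ω)) hs ?_ (hint t ht) ?_ ?_ ?_ ?_).2
  · filter_upwards [Ioi_mem_nhds ht] with s hs
    exact (hint s hs).aestronglyMeasurable
  · exact Measurable.aestronglyMeasurable (by fun_prop)
  · filter_upwards [hY.pos] with ω hω s hs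
    have hs0 : 0 < s := lt_trans (by positivity) (mem_Ioi.1 hs)
    have h1 : s ^ (ν - 1) ≤ (t / 2) ^ (ν - 1) :=
      Real.rpow_le_rpow_of_nonpos (by positivity) (le_of_lt hs) (by linarith)
    have h2 := hC (s ^ ν * Y ω) (by positivity)
    have hC0 : 0 ≤ C := (abs_nonneg _).trans h2
    rw [Real.norm_eq_abs, abs_mul, abs_of_pos (by positivity : 0 < ν * s ^ (ν - 1) * Y ω)]
    calc _ ≤ ν * (t / 2) ^ (ν - 1) * Y ω * C := by gcongr
      _ = _ := by ring
  · simpa using (hY.integrable_pow 1).const_mul (ν * (t / 2) ^ (ν - 1) * C)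
  · filter_upwards [hY.pos] with ω hω s hs
    have hs0 : 0 < s := lt_trans (by positivity) (mem_Ioi.1 hs)
    have h := (hF (s ^ ν * Y ω) (by positivity)).comp s
      ((Real.hasDerivAt_rpow_const (p := ν) (Or.inl hs0.ne')).mul_const (Y ω))
    convert! h using 1
    ring

lemma ae_snd_pos [SFinite P] (hY : IsMittagLefflerVar ν P Y) {t : ℝ} :
    ∀ᵐ z ∂((volume : Measure ℝ).restrict (Ioo 0 t)).prod P, 0 < Y z.2 :=
  Measure.quasiMeasurePreserving_snd.ae hY.pos

variable [IsProbabilityMeasure P]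

lemma caputoWeight_nonneg (hY : IsMittagLefflerVar ν P Y) (hν0 : 0 < ν) (hν1 : ν < 1) {t : ℝ} :
    ∀ᵐ z ∂((volume : Measure ℝ).restrict (Ioo 0 t)).prod P, 0 ≤ caputoWeight ν t Y z := by
  filter_upwards [ae_fst_mem, hY.ae_snd_pos] with z h1 h2
  have := Real.Gamma_pos_of_pos (sub_pos.2 hν1)
  have h3 := h1.1
  have h4 := sub_pos.2 h1.2
  unfold caputoWeight
  positivity

lemma integrable_caputoWeight_mul_pow (hY : IsMittagLefflerVar ν P Y) (hν0 : 0 < ν) (hν1 : ν < 1)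
    {t : ℝ} (ht : 0 < t) (j : ℕ) :
    Integrable (fun z => caputoWeight ν t Y z * (z.1 ^ ν * Y z.2) ^ j)
      (((volume : Measure ℝ).restrict (Ioo 0 t)).prod P) := by
  refine (Integrable.mul_prod
    ((integrableOn_rpow_mul_sub_rpow (a := ν * (j + 1)) (b := 1 - ν) (by positivity)
      (sub_pos.2 hν1) ht).const_mul (ν / Real.Gamma (1 - ν)))
    (hY.integrable_pow (j + 1))).congr ?_
  filter_upwards [ae_fst_mem] with z hz
  exact (caputoWeight_mul_pow z hz.1 j).symm

/-- The Beta integral turns the moment (j+1)!/Γ(ν(j+1)+1) into j!/Γ(νj+1): this is the power rule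
for the Caputo derivative. -/
lemma integral_caputoWeight_mul_pow (hY : IsMittagLefflerVar ν P Y) (hν0 : 0 < ν) (hν1 : ν < 1)
    {t : ℝ} (ht : 0 < t) (j : ℕ) :
    ∫ z, caputoWeight ν t Y z * (z.1 ^ ν * Y z.2) ^ j
      ∂(((volume : Measure ℝ).restrict (Ioo 0 t)).prod P) =
    ∫ ω, (t ^ ν * Y ω) ^ j ∂P := by
  have h1 : ∀ᵐ z ∂((volume : Measure ℝ).restrict (Ioo 0 t)).prod P, _ :=
    ae_fst_mem.mono fun z hz => caputoWeight_mul_pow (ν := ν) (Y := Y) (t := t) z hz.1 j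
  rw [integral_congr_ae h1, integral_prod_mul (fun s : ℝ => ν / Real.Gamma (1 - ν) *
    (s ^ (ν * ((j : ℝ) + 1) - 1) * (t - s) ^ ((1 - ν) - 1))) (fun ω => Y ω ^ (j + 1)),
    integral_const_mul,
    integral_rpow_mul_sub_rpow (by positivity) (sub_pos.2 hν1) ht, hY.moment]
  simp only [mul_pow]
  rw [integral_const_mul, hY.moment]
  have hj : 0 < ν * ((j : ℝ) + 1) := by positivity
  have e1 : ν * ((j : ℝ) + 1) + (1 - ν) = ν * j + 1 := by ring
  have e2 : t ^ (ν * j + 1 - 1) = (t ^ ν) ^ j := by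
    rw [add_sub_cancel_right, Real.rpow_mul ht.le, Real.rpow_natCast]
  have g1 := Real.Gamma_pos_of_pos hj
  have g2 := Real.Gamma_pos_of_pos (sub_pos.2 hν1)
  have g3 := Real.Gamma_pos_of_pos (by positivity : 0 < ν * (j : ℝ) + 1)
  rw [e1, e2, Nat.factorial_succ]
  push_cast
  rw [Real.Gamma_add_one hj.ne']
  field_simp

/-- The weighted law of `s^ν Y` on `(0,t) × Ω` is the law of `t^ν Y`. -/
lemma map_caputoWeight (hY : IsMittagLefflerVar ν P Y) (hν0 : 0 < ν) (hν1 : ν < 1) {t : ℝ}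
    (ht : 0 < t) :
    ((((volume : Measure ℝ).restrict (Ioo 0 t)).prod P).withDensity
      fun z => ((caputoWeight ν t Y z).toNNReal : ENNReal)).map (fun z => z.1 ^ ν * Y z.2) =
    P.map fun ω => t ^ ν * Y ω := by
  have hYm := hY.measurable
  have hwm := (hY.measurable_caputoWeight t).real_toNNReal
  have hae : ∀ᵐ z ∂(((volume : Measure ℝ).restrict (Ioo 0 t)).prod P).withDensity
      fun z => ((caputoWeight ν t Y z).toNNReal : ENNReal), 0 < z.1 ^ ν * Y z.2 := by
    refine (withDensity_absolutelyContinuous _ _).ae_le ?_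
    filter_upwards [ae_fst_mem, hY.ae_snd_pos] with z h1 h2
    have := h1.1
    positivity
  have hsm : ∀ (j : ℕ), (fun z : ℝ × Ω => (caputoWeight ν t Y z).toNNReal • (z.1 ^ ν * Y z.2) ^ j)
      =ᵐ[((volume : Measure ℝ).restrict (Ioo 0 t)).prod P]
      fun z => caputoWeight ν t Y z * (z.1 ^ ν * Y z.2) ^ j := fun j => by
    filter_upwards [hY.caputoWeight_nonneg hν0 hν1] with z hz
    rw [NNReal.smul_def, Real.coe_toNNReal _ hz, smul_eq_mul]
  have hfin : IsFiniteMeasure ((((volume : Measure ℝ).restrict (Ioo 0 t)).prod P).withDensity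
      fun z => ((caputoWeight ν t Y z).toNNReal : ENNReal)) :=
    isFiniteMeasure_withDensity_ofReal
      (by simpa using (hY.integrable_caputoWeight_mul_pow hν0 hν1 ht 0).2)
  have hint' : ∀ j : ℕ, Integrable (fun ω => (t ^ ν * Y ω) ^ j) P := fun j => by
    simpa only [mul_pow] using (hY.integrable_pow j).const_mul _
  symm
  refine map_eq_map_of_moments (by fun_prop) (by fun_prop) ?_ (hae.mono fun _ h => h.le) hint' ?_
    ?_ ?_
  · filter_upwards [hY.pos] with ω h
    positivity
  · intro j
    rw [integrable_withDensity_iff_integrable_smul hwm]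
    exact (hY.integrable_caputoWeight_mul_pow hν0 hν1 ht j).congr (hsm j).symm
  · intro r hr
    refine (hY.summable_moments hν0 (r * t ^ ν)).congr fun j => ?_
    simp only [mul_pow]
    rw [integral_const_mul]
    ring
  · intro j
    rw [integral_withDensity_eq_integral_smul hwm, integral_congr_ae (hsm j),
      hY.integral_caputoWeight_mul_pow hν0 hν1 ht]

/-- If G = F', the left integral is the Caputo derivative of 𝔼 F(t^ν Y) written on the product
space. The equality integrates G against the two equal laws of `map_caputoWeight`. -/
lemma caputo_identity (hY : IsMittagLefflerVar ν P Y) (hν0 : 0 < ν) (hν1 : ν < 1) {t : ℝ}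
    (ht : 0 < t) {G : ℝ → ℝ} (hG : Measurable G) {C : ℝ} (hC : ∀ y, |G y| ≤ C) :
    Integrable (fun z : ℝ × Ω => caputoWeight ν t Y z * G (z.1 ^ ν * Y z.2))
      (((volume : Measure ℝ).restrict (Ioo 0 t)).prod P) ∧
    ∫ z, caputoWeight ν t Y z * G (z.1 ^ ν * Y z.2)
      ∂(((volume : Measure ℝ).restrict (Ioo 0 t)).prod P) = ∫ ω, G (t ^ ν * Y ω) ∂P := by
  have hYm := hY.measurable
  have hw := hY.measurable_caputoWeight t
  have hwm := hw.real_toNNReal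
  constructor
  · refine (Integrable.mul_bdd (c := C)
      (by simpa using hY.integrable_caputoWeight_mul_pow hν0 hν1 ht 0)
      (Measurable.aestronglyMeasurable (by fun_prop)) (Eventually.of_forall fun z => hC _))
  · have h := congrArg (fun m : Measure ℝ => ∫ y, G y ∂m) (hY.map_caputoWeight hν0 hν1 ht)
    rw [integral_map (by fun_prop) hG.aestronglyMeasurable,
      integral_map (by fun_prop) hG.aestronglyMeasurable,
      integral_withDensity_eq_integral_smul hwm] at h
    rw [← h]
    refine integral_congr_ae ?_
    filter_upwards [hY.caputoWeight_nonneg hν0 hν1] with z hz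
    rw [NNReal.smul_def, Real.coe_toNNReal _ hz, smul_eq_mul]

/-- The first two moments are 1, so 𝔼(Y-1)² = 0. -/
lemma ae_eq_one (hY : IsMittagLefflerVar 1 P Y) : ∀ᵐ ω ∂P, Y ω = 1 := by
  have h1 := hY.moment 1
  have h2 := hY.moment 2
  have i1 := hY.integrable_pow 1
  have i2 := hY.integrable_pow 2
  have e1 : Real.Gamma (1 * ((1 : ℕ) : ℝ) + 1) = 1 := by
    rw [one_mul, Real.Gamma_nat_eq_factorial]; simp
  have e2 : Real.Gamma (1 * ((2 : ℕ) : ℝ) + 1) = 2 := by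
    rw [one_mul, Real.Gamma_nat_eq_factorial]; simp
  rw [e1] at h1
  rw [e2] at h2
  have hz : ∫ ω, (Y ω - 1) ^ 2 ∂P = 0 := by
    have : ∀ ω, (Y ω - 1) ^ 2 = Y ω ^ 2 - 2 * Y ω ^ 1 + 1 := fun ω => by ring
    simp only [this]
    rw [integral_add (f := fun ω => Y ω ^ 2 - 2 * Y ω ^ 1) (i2.sub (i1.const_mul 2))
      (integrable_const _),
      integral_sub i2 (i1.const_mul 2), integral_const_mul, h1, h2]
    norm_num
  have hint : Integrable (fun ω => (Y ω - 1) ^ 2) P := by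
    have : ∀ ω, (Y ω - 1) ^ 2 = Y ω ^ 2 - 2 * Y ω ^ 1 + 1 := fun ω => by ring
    simp only [this]
    exact (i2.sub (i1.const_mul 2)).add (integrable_const _)
  rw [integral_eq_zero_iff_of_nonneg (fun _ => sq_nonneg _) hint] at hz
  filter_upwards [hz] with ω h
  have : Y ω - 1 = 0 := by simpa using h
  linarith

/-- The Caputo derivative of `t ↦ 𝔼 F(t^ν Y)` is `𝔼 F'(t^ν Y)`, for `ν < 1`. -/
lemma hasCaputoDerivAt_of_lt (hY : IsMittagLefflerVar ν P Y) (hν0 : 0 < ν) (hν1 : ν < 1)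
    {F G f : ℝ → ℝ} (hF : ∀ y, 0 < y → HasDerivAt F (G y) y) {C : ℝ}
    (hC : ∀ y, 0 < y → |G y| ≤ C)
    (hint : ∀ t, 0 < t → Integrable (fun ω => F (t ^ ν * Y ω)) P)
    (hf : ∀ t, 0 < t → f t = ∫ ω, F (t ^ ν * Y ω) ∂P) {t : ℝ} (ht : 0 < t) :
    HasCaputoDerivAt ν f (∫ ω, G (t ^ ν * Y ω) ∂P) t := by
  -- G is controlled only on the positive axis and need not be measurable; the truncated `deriv F`
  -- is measurable, bounded everywhere, and agrees with G where Y lives.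
  set G' : ℝ → ℝ := (Ioi 0).indicator (deriv F) with hG'
  have hG'm : Measurable G' := (measurable_deriv F).indicator measurableSet_Ioi
  have hGG : ∀ y, 0 < y → G' y = G y := fun y hy => by
    rw [hG', indicator_of_mem (mem_Ioi.2 hy), (hF y hy).deriv]
  have hC0 : 0 ≤ C := (abs_nonneg _).trans (hC 1 one_pos)
  have hG'C : ∀ y, |G' y| ≤ C := fun y => by
    by_cases hy : 0 < y
    · rw [hGG y hy]; exact hC y hy
    · rw [hG', indicator_of_notMem (by simpa using hy)]; simpa
  have hd : ∀ s, 0 < s →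
      HasDerivAt f (∫ ω, ν * s ^ (ν - 1) * Y ω * G' (s ^ ν * Y ω) ∂P) s := fun s hs => by
    refine (hY.hasDerivAt_integral_comp hν0 hν1.le (fun y hy => (hGG y hy).symm ▸ hF y hy) hG'm
      (fun y _ => hG'C y) hint hs).congr_of_eventuallyEq ?_
    filter_upwards [Ioi_mem_nhds hs] with r hr
    exact hf r hr
  have hrhs : ∫ ω, G (t ^ ν * Y ω) ∂P = ∫ ω, G' (t ^ ν * Y ω) ∂P := by
    refine integral_congr_ae ?_
    filter_upwards [hY.pos] with ω hω
    exact (hGG _ (by positivity)).symm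
  obtain ⟨hi, he⟩ := hY.caputo_identity hν0 hν1 ht hG'm hG'C
  have hΓ := Real.Gamma_pos_of_pos (sub_pos.2 hν1)
  have hinner : ∀ s ∈ Ioo 0 t, deriv f s / (t - s) ^ ν = Real.Gamma (1 - ν) *
      ∫ ω, caputoWeight ν t Y (s, ω) * G' (s ^ ν * Y ω) ∂P := by
    intro s hs
    have hts := sub_pos.2 hs.2
    rw [(hd s hs.1).deriv, div_eq_mul_inv, ← Real.rpow_neg hts.le, ← integral_mul_const,
      ← integral_const_mul]
    refine integral_congr_ae (Eventually.of_forall fun ω => ?_)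
    simp only [caputoWeight]
    field_simp
  have hIoo : IntegrableOn (fun s => deriv f s / (t - s) ^ ν) (Ioo 0 t) :=
    ((hi.integral_prod_left.const_mul (Real.Gamma (1 - ν))).congr
      ((ae_restrict_mem measurableSet_Ioo).mono fun s hs => (hinner s hs).symm))
  refine ⟨fun h => absurd h hν1.ne, fun _ s hs => (hd s hs.1).differentiableAt, fun _ => ?_,
    fun _ => ?_⟩
  · rw [intervalIntegrable_iff_integrableOn_Ioo_of_le ht.le]
    exact hIoo
  · rw [intervalIntegral.integral_of_le ht.le, integral_Ioc_eq_integral_Ioo,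
      setIntegral_congr_fun measurableSet_Ioo hinner, integral_const_mul, hrhs, ← he,
      integral_prod _ hi]
    field_simp

lemma integral_comp_eq_of_eq_one (hY : IsMittagLefflerVar 1 P Y) (F : ℝ → ℝ) (t : ℝ) :
    ∫ ω, F (t ^ (1 : ℝ) * Y ω) ∂P = F t := by
  have : ∀ᵐ ω ∂P, F (t ^ (1 : ℝ) * Y ω) = F t := by
    filter_upwards [hY.ae_eq_one] with ω h
    rw [h, Real.rpow_one, mul_one]
  rw [integral_congr_ae this]
  simp

lemma hasCaputoDerivAt_one (hY : IsMittagLefflerVar 1 P Y) {F G f : ℝ → ℝ}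
    (hF : ∀ y, 0 < y → HasDerivAt F (G y) y)
    (hf : ∀ t, 0 < t → f t = ∫ ω, F (t ^ (1 : ℝ) * Y ω) ∂P) {t : ℝ} (ht : 0 < t) :
    HasCaputoDerivAt 1 f (∫ ω, G (t ^ (1 : ℝ) * Y ω) ∂P) t := by
  refine ⟨fun _ => ?_, fun h => absurd h (lt_irrefl _), fun h => absurd h (lt_irrefl _),
    fun h => absurd h (lt_irrefl _)⟩
  rw [hY.integral_comp_eq_of_eq_one]
  refine (hF t ht).congr_of_eventuallyEq ?_
  filter_upwards [Ioi_mem_nhds ht] with r hr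
  rw [hf r hr, hY.integral_comp_eq_of_eq_one]

end IsMittagLefflerVar

end Caputo

/-! ### Maximum principle and uniqueness for the scalar equation -/

section Uniqueness

lemma HasCaputoDerivAt.sub {ν t a b : ℝ} {f g : ℝ → ℝ} (ht : 0 < t)
    (hf : HasCaputoDerivAt ν f a t) (hg : HasCaputoDerivAt ν g b t) :
    HasCaputoDerivAt ν (fun s => f s - g s) (a - b) t := by
  have hd : ν < 1 → ∀ s ∈ Ioo 0 t, deriv (fun s => f s - g s) s / (t - s) ^ ν =
      deriv f s / (t - s) ^ ν - deriv g s / (t - s) ^ ν := fun h s hs => by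
    rw [deriv_fun_sub (hf.differentiable h s hs) (hg.differentiable h s hs), sub_div]
  refine ⟨fun h => (hf.ordinary h).sub (hg.ordinary h),
    fun h s hs => (hf.differentiable h s hs).sub (hg.differentiable h s hs), fun h => ?_,
    fun h => ?_⟩
  · have h1 := (hf.integrable h).sub (hg.integrable h)
    rw [intervalIntegrable_iff_integrableOn_Ioo_of_le ht.le] at h1 ⊢
    exact h1.congr ((ae_restrict_mem measurableSet_Ioo).mono fun s hs => (hd h s hs).symm)
  · rw [← hf.eq h, ← hg.eq h, ← mul_sub, ← intervalIntegral.integral_sub (hf.integrable h)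
      (hg.integrable h)]
    congr 1
    simp only [intervalIntegral.integral_of_le ht.le, integral_Ioc_eq_integral_Ioo]
    exact setIntegral_congr_fun measurableSet_Ioo (hd h)

lemma HasCaputoDerivAt.neg {ν t a : ℝ} {f : ℝ → ℝ} (hf : HasCaputoDerivAt ν f a t) :
    HasCaputoDerivAt ν (fun s => -f s) (-a) t := by
  refine ⟨fun h => (hf.ordinary h).neg, fun h s hs => (hf.differentiable h s hs).neg, fun h => ?_,
    fun h => ?_⟩
  · simp only [deriv.fun_neg, neg_div]
    exact (hf.integrable h).neg
  · rw [← hf.eq h]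
    simp only [deriv.fun_neg, neg_div, intervalIntegral.integral_neg, mul_neg]

/-- The maximum principle: a positive maximum forces a positive Caputo derivative. -/
lemma HasCaputoDerivAt.pos_of_isMax {ν t d : ℝ} {f : ℝ → ℝ} (hν0 : 0 < ν) (hν1 : ν < 1)
    (ht : 0 < t) (hf : HasCaputoDerivAt ν f d t) (hdt : DifferentiableAt ℝ f t)
    (h0 : Tendsto f (𝓝[>] 0) (𝓝 0)) (hmax : ∀ s ∈ Ioo 0 t, f s ≤ f t) (hpos : 0 < f t) :
    0 < d := by
  -- The value of f at 0 is not prescribed; F replaces it by the limit, which gives continuity on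
  -- the closed interval.
  set F : ℝ → ℝ := fun s => if s ≤ 0 then 0 else f s with hF
  have hFf : ∀ s, 0 < s → F s = f s := fun s hs => if_neg (not_le.2 hs)
  have hFe : ∀ s, 0 < s → F =ᶠ[𝓝 s] f := fun s hs => by
    filter_upwards [Ioi_mem_nhds hs] with r hr using hFf r hr
  have hF0 : F 0 = 0 := if_pos le_rfl
  -- Integration by parts: g' is f'(s)(t-s)^{-ν} minus ν(f(t)-f(s))(t-s)^{-ν-1}, which is
  -- nonnegative at a maximum. Since g(t) = 0 and g(0) = -f(t) t^{-ν}, the Caputo integral is at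
  -- least f(t) t^{-ν}.
  set g : ℝ → ℝ := fun s => -((f t - F s) * (t - s) ^ (-ν)) with hg
  have hcont : ContinuousOn g (Icc 0 t) := by
    intro s hs
    rcases eq_or_lt_of_le hs.2 with rfl | hst
    · have hz : g s = 0 := by simp [hg, hFf s ht]
      obtain ⟨C, hC⟩ := hdt.hasDerivAt.isBigO_sub.bound
      rw [ContinuousWithinAt, hz]
      -- Differentiability of f at the endpoint beats the singular factor, leaving a power of
      -- exponent 1 - ν > 0.
      refine squeeze_zero_norm' (a := fun r => |C| * (s - r) ^ (1 - ν)) ?_ ?_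
      · filter_upwards [nhdsWithin_le_nhds hC, nhdsWithin_le_nhds (hFe s ht),
          eventually_mem_nhdsWithin] with r h1 h2 h3
        rcases eq_or_lt_of_le h3.2 with rfl | hr
        · rw [hz]; simp; positivity
        have hr' : 0 < s - r := sub_pos.2 hr
        rw [hg]
        simp only
        rw [h2, norm_neg, norm_mul, norm_sub_rev, Real.norm_of_nonneg (by positivity : 0 ≤ (s - r) ^ (-ν)),
          sub_eq_add_neg 1 ν, Real.rpow_add hr', Real.rpow_one, ← mul_assoc]
        rw [norm_sub_rev r s, Real.norm_of_nonneg hr'.le] at h1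
        gcongr
        exact h1.trans (mul_le_mul_of_nonneg_right (le_abs_self C) hr'.le)
      · have : Tendsto (fun r => |C| * (s - r) ^ (1 - ν)) (𝓝 s) (𝓝 (|C| * (s - s) ^ (1 - ν))) := by
          refine Tendsto.const_mul _ (Tendsto.rpow_const ?_ (Or.inr (by linarith)))
          exact tendsto_const_nhds.sub tendsto_id
        rw [sub_self, Real.zero_rpow (by linarith), mul_zero] at this
        exact this.mono_left nhdsWithin_le_nhds
    · have hFc : ContinuousWithinAt F (Icc 0 t) s := by
        rcases eq_or_lt_of_le hs.1 with rfl | hs0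
        · have h1 : ContinuousWithinAt F (Ioi 0) 0 := by
            rw [ContinuousWithinAt, hF0]
            refine h0.congr' ?_
            filter_upwards [eventually_mem_nhdsWithin] with r hr using (hFf r hr).symm
          exact (continuousWithinAt_Ioi_iff_Ici.1 h1).mono Icc_subset_Ici_self
        · exact ((hf.differentiable hν1 s ⟨hs0, hst⟩).continuousAt.congr
            (hFe s hs0).symm).continuousWithinAt
      refine ((continuousWithinAt_const.sub hFc).mul (ContinuousWithinAt.rpow_const ?_ ?_)).neg
      · exact continuousWithinAt_const.sub continuousWithinAt_id
      · exact Or.inl (sub_pos.2 hst).ne'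
  have hder : ∀ s ∈ Ioo 0 t, HasDerivWithinAt g
      (deriv f s / (t - s) ^ ν - (f t - f s) * (ν * (t - s) ^ (-ν - 1))) (Ioi s) s := by
    intro s hs
    have hts := sub_pos.2 hs.2
    have h1 : HasDerivAt F (deriv f s) s :=
      (hf.differentiable hν1 s hs).hasDerivAt.congr_of_eventuallyEq (hFe s hs.1)
    have h2 : HasDerivAt (fun r => (t - r) ^ (-ν)) (-1 * -ν * (t - s) ^ (-ν - 1)) s :=
      ((hasDerivAt_id s).const_sub t).rpow_const (Or.inl hts.ne')
    have h3 := (((hasDerivAt_const s (f t)).sub h1).mul h2).neg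
    refine HasDerivAt.hasDerivWithinAt ?_
    convert! h3 using 1
    rw [Real.rpow_neg hts.le, Pi.sub_apply, hFf s hs.1]
    field_simp
    ring
  have hint : IntegrableOn (fun s => deriv f s / (t - s) ^ ν) (Icc 0 t) := by
    rw [integrableOn_Icc_iff_integrableOn_Ioo,
      ← intervalIntegrable_iff_integrableOn_Ioo_of_le ht.le]
    exact hf.integrable hν1
  have key := intervalIntegral.sub_le_integral_of_hasDeriv_right_of_le ht.le hcont hder hint
    (fun s hs => by
      have hts := sub_pos.2 hs.2
      have := sub_nonneg.2 (hmax s hs)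
      have : 0 ≤ (f t - f s) * (ν * (t - s) ^ (-ν - 1)) := by positivity
      linarith)
  have hgt : g t = 0 := by simp [hg, hFf t ht]
  have hg0 : g 0 = -(f t * t ^ (-ν)) := by simp [hg, hF0]
  rw [hgt, hg0] at key
  have hΓ := Real.Gamma_pos_of_pos (sub_pos.2 hν1)
  rw [← hf.eq hν1]
  have : 0 < f t * t ^ (-ν) := by positivity
  exact mul_pos (by positivity) (by linarith)

/-- At a positive maximum on [0,t] the Caputo derivative would be positive, whereas the equation
makes it -λ f ≤ 0. -/
lemma le_zero_of_caputo {ν lam : ℝ} {f : ℝ → ℝ} (hν0 : 0 < ν) (hν1 : ν < 1) (hlam : 0 ≤ lam)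
    (hf : ∀ t, 0 < t → HasCaputoDerivAt ν f (-(lam * f t)) t)
    (h0 : Tendsto f (𝓝[>] 0) (𝓝 0)) {t : ℝ} (ht : 0 < t) : f t ≤ 0 := by
  by_contra! hpos
  -- `HasCaputoDerivAt` at s says nothing about differentiability at s itself; the equation at the
  -- later time s + 1 does.
  have hdiff : ∀ s, 0 < s → DifferentiableAt ℝ f s := fun s hs =>
    (hf (s + 1) (by linarith)).differentiable hν1 s ⟨hs, by linarith⟩
  set F : ℝ → ℝ := fun s => if s ≤ 0 then 0 else f s with hF
  have hFf : ∀ s, 0 < s → F s = f s := fun s hs => if_neg (not_le.2 hs)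
  have hF0 : F 0 = 0 := if_pos le_rfl
  have hcont : ContinuousOn F (Icc 0 t) := by
    intro s hs
    rcases eq_or_lt_of_le hs.1 with rfl | hs0
    · have h1 : ContinuousWithinAt F (Ioi 0) 0 := by
        rw [ContinuousWithinAt, hF0]
        refine h0.congr' ?_
        filter_upwards [eventually_mem_nhdsWithin] with r hr using (hFf r hr).symm
      exact (continuousWithinAt_Ioi_iff_Ici.1 h1).mono Icc_subset_Ici_self
    · refine ((hdiff s hs0).continuousAt.congr ?_).continuousWithinAt
      filter_upwards [Ioi_mem_nhds hs0] with r hr using (hFf r hr).symm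
  obtain ⟨u, hu, hmax⟩ := isCompact_Icc.exists_isMaxOn ⟨t, ht.le, le_rfl⟩ hcont
  have hut : f t ≤ F u := by
    rw [← hFf t ht]; exact hmax ⟨ht.le, le_rfl⟩
  have hu0 : 0 < u := by
    rcases eq_or_lt_of_le hu.1 with rfl | h
    · rw [hF0] at hut; linarith
    · exact h
  rw [hFf u hu0] at hut
  have hfu : 0 < f u := hpos.trans_le hut
  have := (hf u hu0).pos_of_isMax hν0 hν1 hu0 (hdiff u hu0) h0 (fun s hs => by
    have h1 := hmax (⟨hs.1.le, hs.2.le.trans hu.2⟩ : s ∈ Icc 0 t)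
    simpa only [mem_ofPred_eq, hFf s hs.1, hFf u hu0] using h1) hfu
  have : 0 ≤ lam * f u := by positivity
  linarith

/-- The only solution of `∂_t^ν f = -λ f`, `λ ≥ 0`, with vanishing initial value is zero. -/
lemma eq_zero_of_caputo {ν lam : ℝ} {f : ℝ → ℝ} (hν0 : 0 < ν) (hν1 : ν ≤ 1) (hlam : 0 ≤ lam)
    (hf : ∀ t, 0 < t → HasCaputoDerivAt ν f (-(lam * f t)) t)
    (h0 : Tendsto f (𝓝[>] 0) (𝓝 0)) {t : ℝ} (ht : 0 < t) : f t = 0 := by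
  rcases lt_or_eq_of_le hν1 with hν | rfl
  · refine le_antisymm (le_zero_of_caputo hν0 hν hlam hf h0 ht) ?_
    have h1 := le_zero_of_caputo (f := fun s => -f s) hν0 hν hlam
      (fun s hs => by simpa only [mul_neg] using (hf s hs).neg) (by simpa using h0.neg) ht
    linarith
  -- For ν = 1, the integrating factor: e^{λs} f(s) is constant on (0, ∞) and tends to 0.
  · set h : ℝ → ℝ := fun s => Real.exp (lam * s) * f s with hh
    have hd : ∀ s, 0 < s → HasDerivAt h 0 s := fun s hs => by
      have h1 := ((hasDerivAt_id s).const_mul lam).exp.mul ((hf s hs).ordinary rfl)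
      convert! h1 using 1
      simp only [id]
      ring
    have hconst : ∀ s ∈ Ioi (0 : ℝ), h s = h t := fun s hs =>
      (convex_Ioi (0 : ℝ)).is_const_of_fderivWithin_eq_zero (𝕜 := ℝ)
        (fun r hr => (hd r hr).differentiableAt.differentiableWithinAt)
        (fun r hr => by
          rw [fderivWithin_of_isOpen isOpen_Ioi hr]
          have := (hd r hr).hasFDerivAt.fderiv
          rw [this]; ext; simp) hs ht
    have hlim : Tendsto h (𝓝[>] 0) (𝓝 0) := by
      have h1 : Tendsto (fun s : ℝ => Real.exp (lam * s)) (𝓝[>] 0) (𝓝 (Real.exp (lam * 0))) :=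
        (Continuous.tendsto (by fun_prop) 0).mono_left nhdsWithin_le_nhds
      simpa using h1.mul h0
    have h2 : h t = 0 := by
      refine tendsto_nhds_unique (tendsto_const_nhds.congr' ?_) hlim
      filter_upwards [eventually_mem_nhdsWithin] with s hs using (hconst s hs).symm
    rw [hh] at h2
    exact (mul_eq_zero.1 h2).resolve_left (Real.exp_pos _).ne'

end Uniqueness

/-! ### The trigonometric kernel and Poisson summation -/

section Kernel

open FourierTransform SchwartzMap

lemma natCast_le_pow {n : ℕ} (hn : 1 ≤ n) (m : ℕ) : (m : ℝ) + 1 ≤ ((m : ℝ) + 1) ^ (2 * n) :=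
  le_self_pow₀ (by linarith [(Nat.cast_nonneg m : (0 : ℝ) ≤ m)]) (by omega)

lemma summable_pow_mul_exp {n : ℕ} (hn : 1 ≤ n) (j : ℕ) {s : ℝ} (hs : 0 < s) :
    Summable fun m : ℕ => ((m : ℝ) + 1) ^ j * Real.exp (-((m : ℝ) + 1) ^ (2 * n) * s) := by
  have h := (summable_nat_add_iff 1).2 (Real.summable_pow_mul_exp_neg_nat_mul j hs)
  refine Summable.of_nonneg_of_le (fun m => by positivity) (fun m => ?_) h
  have h1 := mul_le_mul_of_nonneg_right (natCast_le_pow hn m) hs.le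
  have h2 : Real.exp (-((m : ℝ) + 1) ^ (2 * n) * s) ≤ Real.exp (-s * ((m : ℝ) + 1)) :=
    Real.exp_le_exp.2 (by linarith)
  push_cast
  gcongr

/-- The trigonometric series `∑_{k ≥ 1} k^j e^{-k^{2n} s} cos(kθ + jπ/2)`, which is the `j`-th
derivative of `∑_{k ≥ 1} e^{-k^{2n} s} cos kθ`. -/
def ringKernel (n j : ℕ) (θ s : ℝ) : ℝ :=
  ∑' m : ℕ, ((m : ℝ) + 1) ^ j * Real.exp (-((m : ℝ) + 1) ^ (2 * n) * s) *
    Real.cos (((m : ℝ) + 1) * θ + j * (Real.pi / 2))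

lemma norm_ringKernel_term_le (n j : ℕ) (θ s : ℝ) (m : ℕ) :
    ‖((m : ℝ) + 1) ^ j * Real.exp (-((m : ℝ) + 1) ^ (2 * n) * s) *
      Real.cos (((m : ℝ) + 1) * θ + j * (Real.pi / 2))‖ ≤
    ((m : ℝ) + 1) ^ j * Real.exp (-((m : ℝ) + 1) ^ (2 * n) * s) := by
  rw [norm_mul, Real.norm_of_nonneg (by positivity)]
  exact mul_le_of_le_one_right (by positivity) (Real.abs_cos_le_one _)

lemma summable_ringKernel {n : ℕ} (hn : 1 ≤ n) (j : ℕ) (θ : ℝ) {s : ℝ} (hs : 0 < s) :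
    Summable fun m : ℕ => ((m : ℝ) + 1) ^ j * Real.exp (-((m : ℝ) + 1) ^ (2 * n) * s) *
    Real.cos (((m : ℝ) + 1) * θ + j * (Real.pi / 2)) :=
  (summable_pow_mul_exp hn j hs).of_norm_bounded (norm_ringKernel_term_le n j θ s)

lemma hasDerivAt_ringKernel_angle {n : ℕ} (hn : 1 ≤ n) (j : ℕ) (θ : ℝ) {s : ℝ} (hs : 0 < s) :
    HasDerivAt (fun x => ringKernel n j x s) (ringKernel n (j + 1) θ s) θ := by
  refine hasDerivAt_tsum (y₀ := 0)
    (g := fun (m : ℕ) x => ((m : ℝ) + 1) ^ j * Real.exp (-((m : ℝ) + 1) ^ (2 * n) * s) *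
      Real.cos (((m : ℝ) + 1) * x + j * (Real.pi / 2)))
    (g' := fun (m : ℕ) x => ((m : ℝ) + 1) ^ (j + 1) * Real.exp (-((m : ℝ) + 1) ^ (2 * n) * s) *
      Real.cos (((m : ℝ) + 1) * x + (j + 1 : ℕ) * (Real.pi / 2)))
    (summable_pow_mul_exp hn (j + 1) hs) (fun m x => ?_)
    (fun m x => norm_ringKernel_term_le n (j + 1) x s m) (summable_ringKernel hn j 0 hs) θ
  have h := ((((hasDerivAt_id x).const_mul ((m : ℝ) + 1)).add_const ((j : ℝ) * (Real.pi / 2))).cos).const_mul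
    (((m : ℝ) + 1) ^ j * Real.exp (-((m : ℝ) + 1) ^ (2 * n) * s))
  convert! h using 1
  simp only [id]
  have : ((m : ℝ) + 1) * x + ((j + 1 : ℕ) : ℝ) * (Real.pi / 2) =
      (((m : ℝ) + 1) * x + j * (Real.pi / 2)) + Real.pi / 2 := by push_cast; ring
  rw [this, Real.cos_add_pi_div_two]
  ring

/-- Raising j by 2n multiplies each term by k^{2n} and shifts its phase by nπ, a factor (-1)^n; the
time derivative brings down -k^{2n}. -/
lemma hasDerivAt_ringKernel_time {n : ℕ} (hn : 1 ≤ n) (j : ℕ) (θ : ℝ) {s : ℝ} (hs : 0 < s) :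
    HasDerivAt (fun r => ringKernel n j θ r) (-((-1) ^ n * ringKernel n (j + 2 * n) θ s)) s := by
  have hrw : -((-1) ^ n * ringKernel n (j + 2 * n) θ s) =
      ∑' m : ℕ, ((m : ℝ) + 1) ^ j * (-((m : ℝ) + 1) ^ (2 * n) *
        Real.exp (-((m : ℝ) + 1) ^ (2 * n) * s)) *
        Real.cos (((m : ℝ) + 1) * θ + j * (Real.pi / 2)) := by
    rw [ringKernel, ← tsum_mul_left, ← tsum_neg]
    refine tsum_congr fun m => ?_
    have : ((m : ℝ) + 1) * θ + ((j + 2 * n : ℕ) : ℝ) * (Real.pi / 2) =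
        (((m : ℝ) + 1) * θ + j * (Real.pi / 2)) + n * Real.pi := by push_cast; ring
    rw [this, Real.cos_add_nat_mul_pi, pow_add]
    have h1 : (-1 : ℝ) ^ n * (-1) ^ n = 1 := by rw [← mul_pow]; simp
    linear_combination -((m : ℝ) + 1) ^ j * ((m : ℝ) + 1) ^ (2 * n) *
        Real.exp (-((m : ℝ) + 1) ^ (2 * n) * s) *
        Real.cos (((m : ℝ) + 1) * θ + j * (Real.pi / 2)) * h1
  rw [hrw]
  -- On (s/2, ∞) the differentiated terms are dominated by their size at s/2, a summable series.
  refine hasDerivAt_tsum_of_isPreconnected (t := Ioi (s / 2)) (y₀ := s)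
    (g := fun (m : ℕ) r => ((m : ℝ) + 1) ^ j * Real.exp (-((m : ℝ) + 1) ^ (2 * n) * r) *
      Real.cos (((m : ℝ) + 1) * θ + j * (Real.pi / 2)))
    (g' := fun (m : ℕ) r => ((m : ℝ) + 1) ^ j * (-((m : ℝ) + 1) ^ (2 * n) *
        Real.exp (-((m : ℝ) + 1) ^ (2 * n) * r)) *
        Real.cos (((m : ℝ) + 1) * θ + j * (Real.pi / 2)))
    (summable_pow_mul_exp hn (j + 2 * n) (half_pos hs)) isOpen_Ioi isPreconnected_Ioi
    (fun m r hr => ?_) (fun m r hr => ?_) (mem_Ioi.2 (by linarith)) (summable_ringKernel hn j θ hs)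
    (mem_Ioi.2 (by linarith))
  · have h := ((((hasDerivAt_id r).const_mul (-((m : ℝ) + 1) ^ (2 * n))).exp).const_mul
      (((m : ℝ) + 1) ^ j)).mul_const (Real.cos (((m : ℝ) + 1) * θ + j * (Real.pi / 2)))
    convert! h using 1
    simp only [id]
    ring
  · have hr' : s / 2 ≤ r := le_of_lt hr
    have h0 : (0 : ℝ) ≤ ((m : ℝ) + 1) ^ (2 * n) := by positivity
    have h1 : Real.exp (-((m : ℝ) + 1) ^ (2 * n) * r) ≤
        Real.exp (-((m : ℝ) + 1) ^ (2 * n) * (s / 2)) := Real.exp_le_exp.2 (by nlinarith)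
    rw [norm_mul, norm_mul, norm_mul, norm_neg, Real.norm_of_nonneg h0,
      Real.norm_of_nonneg (Real.exp_pos _).le,
      Real.norm_of_nonneg (by positivity : (0 : ℝ) ≤ ((m : ℝ) + 1) ^ j), pow_add]
    refine (mul_le_of_le_one_right (by positivity) (Real.abs_cos_le_one _)).trans ?_
    rw [← mul_assoc]
    gcongr

section Schwartz

/-- Polynomials times e^{-ξ^{2n}s} are stable under differentiation. -/
lemma exists_iteratedDeriv_polynomial_mul_exp (n : ℕ) (s : ℝ) (m : ℕ) (p : Polynomial ℝ) :
    ∃ q : Polynomial ℝ, iteratedDeriv m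
      (fun ξ : ℝ => ((p.eval ξ * Real.exp (-ξ ^ (2 * n) * s) : ℝ) : ℂ)) =
      fun ξ : ℝ => ((q.eval ξ * Real.exp (-ξ ^ (2 * n) * s) : ℝ) : ℂ) := by
  induction m generalizing p with
  | zero => exact ⟨p, by simp⟩
  | succ m ih =>
    obtain ⟨q, hq⟩ := ih (p.derivative - p * (Polynomial.C (2 * n * s) * Polynomial.X ^ (2 * n - 1)))
    refine ⟨q, ?_⟩
    rw [iteratedDeriv_succ', ← hq]
    congr 1
    funext ξ
    have h1 : HasDerivAt (fun ξ : ℝ => -ξ ^ (2 * n) * s) (-(((2 * n : ℕ) : ℝ) * ξ ^ (2 * n - 1)) * s) ξ :=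
      ((hasDerivAt_pow (2 * n) ξ).neg).mul_const s
    have h2 := ((p.hasDerivAt ξ).mul h1.exp).ofReal_comp
    refine (HasDerivAt.deriv h2).trans ?_
    congr 1
    simp only [Polynomial.eval_sub, Polynomial.eval_mul, Polynomial.eval_C, Polynomial.eval_pow,
      Polynomial.eval_X]
    push_cast
    ring

lemma exists_abs_pow_mul_exp_le {n : ℕ} (hn : 1 ≤ n) {s : ℝ} (hs : 0 < s) (k : ℕ) :
    ∃ C : ℝ, ∀ ξ : ℝ, |ξ| ^ k * Real.exp (-ξ ^ (2 * n) * s) ≤ C := by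
  -- The 1 covers |ξ| ≤ 1. Otherwise |ξ|^k ≤ (y/s)^k with y = |ξ|^{2n} s, and y^k ≤ k! e^y.
  refine ⟨1 + k.factorial / s ^ k, fun ξ => ?_⟩
  have he : ξ ^ (2 * n) = |ξ| ^ (2 * n) := by rw [pow_mul, pow_mul, sq_abs]
  have hy : 0 ≤ |ξ| ^ (2 * n) * s := by positivity
  rw [he, neg_mul]
  have h1 : Real.exp (-(|ξ| ^ (2 * n) * s)) ≤ 1 := Real.exp_le_one_iff.2 (by linarith)
  rcases le_total |ξ| 1 with h | h
  · have h2 : |ξ| ^ k ≤ 1 := pow_le_one₀ (abs_nonneg _) h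
    have h3 : 0 ≤ (k.factorial : ℝ) / s ^ k := by positivity
    have h4 := mul_le_one₀ h2 (Real.exp_pos _).le h1
    linarith
  · have h2 := Real.pow_div_factorial_le_exp _ hy k
    have h3 : |ξ| ^ k ≤ (|ξ| ^ (2 * n)) ^ k := by
      rw [← pow_mul]
      exact pow_le_pow_right₀ h (by nlinarith)
    rw [Real.exp_neg]
    have h4 : (|ξ| ^ (2 * n)) ^ k * (Real.exp (|ξ| ^ (2 * n) * s))⁻¹ ≤ k.factorial / s ^ k := by
      rw [mul_inv_le_iff₀ (Real.exp_pos _)]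
      rw [mul_pow, div_le_iff₀ (by positivity)] at h2
      calc (|ξ| ^ (2 * n)) ^ k = ((|ξ| ^ (2 * n)) ^ k * s ^ k) / s ^ k := by field_simp
        _ ≤ (Real.exp (|ξ| ^ (2 * n) * s) * k.factorial) / s ^ k := by gcongr
        _ = _ := by ring
    calc _ ≤ (|ξ| ^ (2 * n)) ^ k * (Real.exp (|ξ| ^ (2 * n) * s))⁻¹ := by gcongr
      _ ≤ _ := by linarith

lemma exists_abs_polynomial_mul_exp_le {n : ℕ} (hn : 1 ≤ n) {s : ℝ} (hs : 0 < s) (k : ℕ)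
    (p : Polynomial ℝ) :
    ∃ C : ℝ, ∀ ξ : ℝ, |ξ| ^ k * |p.eval ξ * Real.exp (-ξ ^ (2 * n) * s)| ≤ C := by
  induction p using Polynomial.induction_on' with
  | add p q hp hq =>
    obtain ⟨C, hC⟩ := hp
    obtain ⟨D, hD⟩ := hq
    refine ⟨C + D, fun ξ => ?_⟩
    rw [Polynomial.eval_add, add_mul]
    have h := mul_le_mul_of_nonneg_left (abs_add_le (p.eval ξ * Real.exp (-ξ ^ (2 * n) * s))
      (q.eval ξ * Real.exp (-ξ ^ (2 * n) * s))) (by positivity : 0 ≤ |ξ| ^ k)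
    linarith [hC ξ, hD ξ]
  | monomial i a =>
    obtain ⟨C, hC⟩ := exists_abs_pow_mul_exp_le hn hs (k + i)
    refine ⟨|a| * C, fun ξ => ?_⟩
    rw [Polynomial.eval_monomial, abs_mul, abs_mul, abs_pow, abs_of_pos (Real.exp_pos _)]
    calc _ = |a| * (|ξ| ^ (k + i) * Real.exp (-ξ ^ (2 * n) * s)) := by rw [pow_add]; ring
      _ ≤ _ := by gcongr; exact hC ξ

/-- The function `ξ^j e^{-ξ^{2n} s}` as a Schwartz function. -/
lemma exists_schwartz {n : ℕ} (hn : 1 ≤ n) (j : ℕ) {s : ℝ} (hs : 0 < s) :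
    ∃ g : 𝓢(ℝ, ℂ), ∀ ξ, g ξ = ((ξ ^ j * Real.exp (-ξ ^ (2 * n) * s) : ℝ) : ℂ) := by
  refine ⟨⟨fun ξ => ((ξ ^ j * Real.exp (-ξ ^ (2 * n) * s) : ℝ) : ℂ), ?_, fun k m => ?_⟩,
    fun ξ => rfl⟩
  · have h : ContDiff ℝ ((⊤ : ℕ∞) : WithTop ℕ∞) fun ξ : ℝ => ξ ^ j * Real.exp (-ξ ^ (2 * n) * s) := by
      fun_prop
    exact Complex.ofRealCLM.contDiff.comp h
  · obtain ⟨q, hq⟩ := exists_iteratedDeriv_polynomial_mul_exp n s m (Polynomial.X ^ j)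
    obtain ⟨C, hC⟩ := exists_abs_polynomial_mul_exp_le hn hs k q
    refine ⟨C, fun ξ => ?_⟩
    simp only [Polynomial.eval_pow, Polynomial.eval_X] at hq
    rw [norm_iteratedFDeriv_eq_norm_iteratedDeriv, hq, Complex.norm_real]
    exact hC ξ

end Schwartz

/-- The substitution ξ = v/ε with ε = s^{1/(2n)} reduces every time to time 1. -/
lemma fourierInv_scaling {n : ℕ} (j : ℕ) {s ε : ℝ} (hε : 0 < ε)
    (hεs : ε ^ (2 * n) = s) (y : ℝ) :
    𝓕⁻ (fun ξ : ℝ => ((ξ ^ j * Real.exp (-ξ ^ (2 * n) * s) : ℝ) : ℂ)) y =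
      ((ε ^ (j + 1))⁻¹ : ℝ) *
        𝓕⁻ (fun ξ : ℝ => ((ξ ^ j * Real.exp (-ξ ^ (2 * n) * 1) : ℝ) : ℂ)) (y / ε) := by
  rw [Real.fourierInv_eq', Real.fourierInv_eq']
  have h := Measure.integral_comp_mul_left (fun v : ℝ =>
    Complex.exp (((2 * Real.pi * inner ℝ v (y / ε) : ℝ) : ℂ) * Complex.I) •
      ((v ^ j * Real.exp (-v ^ (2 * n) * 1) : ℝ) : ℂ)) ε
  rw [abs_of_pos (inv_pos.2 hε)] at h
  have h2 : ∀ v : ℝ, Complex.exp (((2 * Real.pi * inner ℝ (ε * v) (y / ε) : ℝ) : ℂ) * Complex.I) •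
      (((ε * v) ^ j * Real.exp (-(ε * v) ^ (2 * n) * 1) : ℝ) : ℂ) =
      ((ε ^ j : ℝ) : ℂ) * (Complex.exp (((2 * Real.pi * inner ℝ v y : ℝ) : ℂ) * Complex.I) •
      ((v ^ j * Real.exp (-v ^ (2 * n) * s) : ℝ) : ℂ)) := by
    intro v
    have e1 : inner ℝ (ε * v) (y / ε) = inner ℝ v y := by
      simp only [RCLike.inner_apply, conj_trivial]; field_simp
    have e2 : -(ε * v) ^ (2 * n) * 1 = -v ^ (2 * n) * s := by rw [← hεs, mul_pow]; ring
    rw [e1, e2, mul_pow]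
    push_cast
    simp only [smul_eq_mul]
    ring
  simp only [h2] at h
  rw [integral_const_mul] at h
  have hε' : ((ε : ℝ) : ℂ) ≠ 0 := by exact_mod_cast hε.ne'
  have h3 : ∀ (A B : ℂ), ((ε ^ j : ℝ) : ℂ) * A = ε⁻¹ • B → A = ((ε ^ (j + 1))⁻¹ : ℝ) * B := by
    intro A B hAB
    rw [Complex.real_smul] at hAB
    push_cast at hAB ⊢
    rw [pow_succ]
    field_simp
    field_simp at hAB
    linear_combination hAB
  exact h3 _ _ h

/-- Poisson summation for `ξ^j e^{-ξ^{2n} s}`: the periodised inverse Fourier transform is the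
trigonometric series `ringKernel`. -/
lemma tsum_fourierInv_eq {n : ℕ} (hn : 1 ≤ n) (j : ℕ) {s : ℝ} (hs : 0 < s) (θ : ℝ) :
    Complex.I ^ j * ∑' m : ℤ, 𝓕⁻ (fun ξ : ℝ => ((ξ ^ j * Real.exp (-ξ ^ (2 * n) * s) : ℝ) : ℂ))
      (θ / (2 * Real.pi) + m) = (((if j = 0 then 1 else 0) + 2 * ringKernel n j θ s : ℝ) : ℂ) := by
  obtain ⟨g, hg⟩ := exists_schwartz hn j hs
  have hgf : (g : ℝ → ℂ) = fun ξ : ℝ => ((ξ ^ j * Real.exp (-ξ ^ (2 * n) * s) : ℝ) : ℂ) := funext hg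
  -- Evaluated at θ/2π, so that the characters become e^{ikθ}.
  have hP := SchwartzMap.tsum_eq_tsum_fourier (𝓕⁻ g) (θ / (2 * Real.pi))
  rw [FourierTransform.fourier_fourierInv_eq, SchwartzMap.fourierInv_coe, hgf] at hP
  rw [hP, ← tsum_mul_left]
  refine HasSum.tsum_eq ?_
  set c : ℕ → ℝ := fun m => ((m : ℝ) + 1) ^ j * Real.exp (-((m : ℝ) + 1) ^ (2 * n) * s) with hc
  set α : ℕ → ℝ := fun m => ((m : ℝ) + 1) * θ + j * (Real.pi / 2) with hα
  have hI : Complex.I ^ j = Complex.exp (j * (Real.pi / 2 * Complex.I)) := by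
    rw [Complex.exp_nat_mul, Complex.exp_pi_div_two_mul_I]
  have hpi : (2 * Real.pi : ℂ) ≠ 0 := by
    have := Real.pi_ne_zero
    exact_mod_cast mul_ne_zero two_ne_zero this
  have hfour : ∀ k : ℤ, _root_.fourier k ((θ / (2 * Real.pi) : ℝ) : UnitAddCircle) =
      Complex.exp ((k * θ : ℝ) * Complex.I) := by
    intro k
    rw [fourier_coe_apply]
    congr 1
    push_cast
    field_simp
  -- The factor i^j supplies the phase jπ/2. At -k the sign (-1)^j conjugates that phase, so the
  -- terms at k and -k add up to a real cosine.
  have hp : ∀ m : ℕ, Complex.I ^ j * ((((((m : ℤ) + 1 : ℤ) : ℝ) ^ j * Real.exp (-(((m : ℤ) + 1 : ℤ) : ℝ) ^ (2 * n) * s) : ℝ) : ℂ) *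
      _root_.fourier ((m : ℤ) + 1) ((θ / (2 * Real.pi) : ℝ) : UnitAddCircle)) =
      c m * Complex.exp (α m * Complex.I) := by
    intro m
    rw [hfour, hI, hc, hα]
    push_cast
    rw [show ((((m : ℂ) + 1) * θ + j * (Real.pi / 2)) * Complex.I) =
      (j * (Real.pi / 2 * Complex.I)) + ((m : ℂ) + 1) * θ * Complex.I by ring, Complex.exp_add]
    ring
  have hm : ∀ m : ℕ, Complex.I ^ j * (((((-((m : ℤ) + 1) : ℤ) : ℝ) ^ j * Real.exp (-((-((m : ℤ) + 1) : ℤ) : ℝ) ^ (2 * n) * s) : ℝ) : ℂ) *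
      _root_.fourier (-((m : ℤ) + 1)) ((θ / (2 * Real.pi) : ℝ) : UnitAddCircle)) =
      c m * Complex.exp (-(α m) * Complex.I) := by
    intro m
    have e1 : Complex.I ^ j * (-1 : ℂ) ^ j = Complex.exp (-(j * (Real.pi / 2 * Complex.I))) := by
      rw [Complex.exp_neg, ← hI, ← inv_pow, Complex.inv_I, ← mul_pow, mul_neg_one]
    rw [hfour, hc, hα]
    push_cast
    rw [show (-(((m : ℂ) + 1) * θ + j * (Real.pi / 2)) * Complex.I) =
      (-(j * (Real.pi / 2 * Complex.I))) + (-1 + -(m : ℂ)) * θ * Complex.I by ring,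
      Complex.exp_add, ← e1]
    have e2' : (-1 + -(m : ℂ)) ^ (2 * n) = ((m : ℂ) + 1) ^ (2 * n) := by
      rw [pow_mul, pow_mul]; ring
    have e3' : (-1 + -(m : ℂ)) ^ j = (-1) ^ j * ((m : ℂ) + 1) ^ j := by
      rw [← neg_pow]; ring
    have e4 : -((m : ℂ) + 1) = -1 + -(m : ℂ) := by ring
    rw [e4, e2', e3']
    ring
  have hcs : Summable c := summable_pow_mul_exp hn j hs
  have hsum : ∀ β : ℕ → ℝ, Summable fun m => (c m : ℂ) * Complex.exp (β m * Complex.I) := by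
    intro β
    refine hcs.of_norm_bounded fun m => ?_
    rw [norm_mul, Complex.norm_exp_ofReal_mul_I, mul_one, Complex.norm_real,
      Real.norm_of_nonneg (by positivity)]
  have h1 := (hsum α).hasSum
  have h2 := (hsum fun m => -α m).hasSum
  simp only [Complex.ofReal_neg] at h2
  have h3 := HasSum.of_add_one_of_neg_add_one (f := fun k : ℤ => Complex.I ^ j *
      ((((k : ℝ) ^ j * Real.exp (-(k : ℝ) ^ (2 * n) * s) : ℝ) : ℂ) *
        _root_.fourier k ((θ / (2 * Real.pi) : ℝ) : UnitAddCircle)))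
    (by simpa only [hp] using h1) (by simpa only [hm] using h2)
  convert! h3 using 1
  have h0 : Complex.I ^ j * (((((0 : ℤ) : ℝ) ^ j * Real.exp (-((0 : ℤ) : ℝ) ^ (2 * n) * s) : ℝ) : ℂ) *
        _root_.fourier 0 ((θ / (2 * Real.pi) : ℝ) : UnitAddCircle)) =
      ((if j = 0 then 1 else 0 : ℝ) : ℂ) := by
    rcases eq_or_ne j 0 with rfl | hj
    · have : n ≠ 0 := by omega
      simp [this]
    · simp [hj]
  rw [h0, add_right_comm, ← h1.summable.tsum_add h2.summable, add_comm, Complex.ofReal_add,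
    ringKernel, ← tsum_mul_left, Complex.ofReal_tsum]
  congr 1
  refine tsum_congr fun m => ?_
  have := Complex.two_cos (α m)
  push_cast
  rw [← mul_add, ← this]
  push_cast [hc, hα]
  ring

lemma abs_int_sub_ge {δ x : ℝ} (hδ0 : 0 < δ) (hx : x ∈ Icc δ (1 - δ)) (m : ℤ) :
    δ / 2 * (|(m : ℝ)| + 1) ≤ |x + m| := by
  rcases le_or_gt 0 m with hm | hm
  · have hm' : (0 : ℝ) ≤ m := by exact_mod_cast hm
    rw [abs_of_nonneg hm', abs_of_nonneg (by linarith [hx.1])]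
    nlinarith [hx.1, hx.2]
  · have hm' : (m : ℝ) ≤ -1 := by exact_mod_cast (by omega : m ≤ -1)
    rw [abs_of_neg (by linarith), abs_of_nonpos (by linarith [hx.2])]
    nlinarith [hx.1, hx.2]

lemma summable_succ_sq_inv : Summable fun m : ℕ => (((m : ℝ) + 1) ^ 2)⁻¹ := by
  have := (summable_nat_add_iff 1).2 (Real.summable_nat_pow_inv.2 (by norm_num : 1 < 2))
  simpa using this

lemma summable_int_inv_sq : Summable fun m : ℤ => ((|(m : ℝ)| + 1) ^ 2)⁻¹ := by
  refine Summable.of_nat_of_neg (by simpa using summable_succ_sq_inv)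
    (by simpa using summable_succ_sq_inv)

/-- Away from the starting point the derivatives of the kernel are bounded uniformly in time. -/
lemma exists_abs_ringKernel_le {n : ℕ} (hn : 1 ≤ n) {j : ℕ} (hj : 1 ≤ j) {δ : ℝ} (hδ : 0 < δ) :
    ∃ C : ℝ, ∀ θ ∈ Icc δ (2 * Real.pi - δ), ∀ s : ℝ, 0 < s → |ringKernel n j θ s| ≤ C := by
  obtain ⟨g, hg⟩ := exists_schwartz hn j one_pos
  have hgf : (g : ℝ → ℂ) = fun ξ : ℝ => ((ξ ^ j * Real.exp (-ξ ^ (2 * n) * 1) : ℝ) : ℂ) := funext hg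
  -- Decay of order exactly j + 1 cancels the scaling factor ε^{-(j+1)} and leaves K |x+m|^{-(j+1)},
  -- free of s. The condition j ≥ 1 makes this summable over m.
  set K : ℝ := SchwartzMap.seminorm ℝ (j + 1) 0 (𝓕⁻ g) with hK
  have hK0 : 0 ≤ K := apply_nonneg _ _
  have hdec : ∀ y : ℝ, |y| ^ (j + 1) *
      ‖𝓕⁻ (fun ξ : ℝ => ((ξ ^ j * Real.exp (-ξ ^ (2 * n) * 1) : ℝ) : ℂ)) y‖ ≤ K := fun y => by
    rw [← hgf, ← SchwartzMap.fourierInv_coe]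
    exact SchwartzMap.norm_pow_mul_le_seminorm ℝ (𝓕⁻ g) (j + 1) y
  have hpi := Real.pi_pos
  set d : ℝ := δ / (2 * Real.pi) with hd
  have hd0 : 0 < d := by positivity
  set B : ℤ → ℝ := fun m => K * ((d / 2) ^ (j + 1))⁻¹ * ((|(m : ℝ)| + 1) ^ 2)⁻¹ with hB
  have hBs : Summable B := summable_int_inv_sq.mul_left _
  refine ⟨∑' m, B m, fun θ hθ s hs => ?_⟩
  set x : ℝ := θ / (2 * Real.pi) with hx
  have hxm : x ∈ Icc d (1 - d) := by
    constructor
    · rw [hx, hd]; have := hθ.1; gcongr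
    · rw [hx, hd, div_le_iff₀ (by positivity), sub_mul, div_mul_cancel₀ _ (by positivity), one_mul]
      exact hθ.2
  set ε : ℝ := s ^ (1 / ((2 * n : ℕ) : ℝ)) with hε
  have hε0 : 0 < ε := by positivity
  have hεs : ε ^ (2 * n) = s := by
    rw [hε, ← Real.rpow_natCast, ← Real.rpow_mul hs.le, one_div, inv_mul_cancel₀, Real.rpow_one]
    have : 2 * n ≠ 0 := by omega
    exact_mod_cast this
  have hterm : ∀ m : ℤ, ‖𝓕⁻ (fun ξ : ℝ => ((ξ ^ j * Real.exp (-ξ ^ (2 * n) * s) : ℝ) : ℂ))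
      (x + m)‖ ≤ B m := by
    intro m
    have h1 := abs_int_sub_ge hd0 hxm m
    have h2 : 0 < d / 2 * (|(m : ℝ)| + 1) := by positivity
    have h3 : 0 < |x + m| := h2.trans_le h1
    have h4 := hdec ((x + m) / ε)
    rw [fourierInv_scaling j hε0 hεs, norm_mul, Complex.norm_real,
      Real.norm_of_nonneg (by positivity)]
    rw [abs_div, abs_of_pos hε0, div_pow, div_mul_eq_mul_div, div_le_iff₀ (by positivity)] at h4
    have h5 : (ε ^ (j + 1))⁻¹ * ‖𝓕⁻ (fun ξ : ℝ => ((ξ ^ j * Real.exp (-ξ ^ (2 * n) * 1) : ℝ) : ℂ))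
        ((x + m) / ε)‖ ≤ K * (|x + m| ^ (j + 1))⁻¹ := by
      rw [inv_mul_le_iff₀ (by positivity), ← mul_assoc, ← div_eq_mul_inv, le_div_iff₀ (by positivity)]
      linarith
    refine h5.trans ?_
    rw [hB]
    simp only
    rw [mul_assoc]
    refine mul_le_mul_of_nonneg_left ?_ hK0
    rw [← mul_inv]
    refine inv_anti₀ (by positivity) ?_
    calc (d / 2) ^ (j + 1) * (|(m : ℝ)| + 1) ^ 2
        ≤ (d / 2) ^ (j + 1) * (|(m : ℝ)| + 1) ^ (j + 1) := by
          have : (1 : ℝ) ≤ |(m : ℝ)| + 1 := by linarith [abs_nonneg (m : ℝ)]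
          gcongr
          omega
      _ = (d / 2 * (|(m : ℝ)| + 1)) ^ (j + 1) := by rw [mul_pow]
      _ ≤ _ := by gcongr
  have hP := congrArg norm (tsum_fourierInv_eq hn j hs θ)
  rw [norm_mul, norm_pow, Complex.norm_I, one_pow, one_mul, if_neg (by omega), zero_add,
    Complex.norm_real, norm_mul, Real.norm_eq_abs, Real.norm_eq_abs] at hP
  have h6 := tsum_of_norm_bounded hBs.hasSum hterm
  rw [hP] at h6
  have : 0 ≤ |ringKernel n j θ s| := abs_nonneg _
  rw [abs_two] at h6
  linarith

end Kernel

/-! ### The signed law on the ring -/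

section RingLaw

open FourierTransform SchwartzMap

/-- The transition density of the circular pseudoprocess. -/
def ringHeat (n : ℕ) (θ s : ℝ) : ℝ := (1 / (2 * Real.pi)) * (1 + 2 * ringKernel n 0 θ s)

/-- The symbol is even, so the integral equals its conjugate and taking the real part in
`lineDensity` loses nothing. -/
lemma fourierInv_eq_lineDensity (n : ℕ) (t y : ℝ) :
    𝓕⁻ (fun ξ : ℝ => ((ξ ^ 0 * Real.exp (-ξ ^ (2 * n) * t) : ℝ) : ℂ)) y =
      ((2 * Real.pi * lineDensity n (2 * Real.pi * y) t : ℝ) : ℂ) := by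
  set J : ℂ := ∫ ξ : ℝ, Complex.exp (-Complex.I * ξ * ((2 * Real.pi * y : ℝ) : ℂ)) *
    (Real.exp (-ξ ^ (2 * n) * t) : ℂ) with hJ
  have heven : ∀ ξ : ℝ, (-ξ) ^ (2 * n) = ξ ^ (2 * n) := fun ξ => by rw [pow_mul, pow_mul, neg_sq]
  have h1 : ∫ ξ : ℝ, Complex.exp (Complex.I * ξ * ((2 * Real.pi * y : ℝ) : ℂ)) *
      (Real.exp (-ξ ^ (2 * n) * t) : ℂ) = J := by
    rw [hJ, ← integral_neg_eq_self]
    refine integral_congr_ae (Eventually.of_forall fun ξ => ?_)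
    simp only [heven]
    push_cast
    ring_nf
  have h2 : (starRingEnd ℂ) J = J := by
    rw [← h1, ← integral_conj, h1, hJ]
    refine integral_congr_ae (Eventually.of_forall fun ξ => ?_)
    simp only [map_mul, ← Complex.exp_conj, Complex.conj_I, Complex.conj_ofReal]
  have h3 : ((J.re : ℝ) : ℂ) = J := Complex.conj_eq_iff_re.1 h2
  have hpi := Real.pi_ne_zero
  have h4 : 2 * Real.pi * lineDensity n (2 * Real.pi * y) t = J.re := by
    rw [lineDensity, ← hJ]
    field_simp
  rw [h4, h3, Real.fourierInv_eq', ← h1]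
  refine integral_congr_ae (Eventually.of_forall fun ξ => ?_)
  simp only [RCLike.inner_apply, conj_trivial, pow_zero, one_mul, smul_eq_mul]
  congr 2
  push_cast
  ring

lemma integrable_lineDensity {n : ℕ} (hn : 1 ≤ n) {t : ℝ} (ht : 0 < t) :
    Integrable (fun x => lineDensity n x t) := by
  obtain ⟨g, hg⟩ := exists_schwartz hn 0 ht
  have h1 := (𝓕⁻ g).integrable (μ := volume)
  rw [SchwartzMap.fourierInv_coe, show (g : ℝ → ℂ) = _ from funext hg] at h1
  have h2 := h1.re
  simp only [fourierInv_eq_lineDensity] at h2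
  have hpi := Real.pi_pos
  have h3 := (h2.const_mul (1 / (2 * Real.pi))).comp_mul_left' (R := 1 / (2 * Real.pi)) (by positivity)
  convert! h3 using 1
  funext x
  have e : 2 * Real.pi * (1 / (2 * Real.pi) * x) = x := by field_simp
  simp only [e, RCLike.re_to_complex, Complex.ofReal_re]
  field_simp

lemma tsum_lineDensity {n : ℕ} (hn : 1 ≤ n) {t : ℝ} (ht : 0 < t) (y : ℝ) :
    ∑' m : ℤ, 2 * Real.pi * lineDensity n (2 * Real.pi * (y + m)) t =
      2 * Real.pi * ringHeat n (2 * Real.pi * y) t := by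
  have hpi := Real.pi_ne_zero
  have h := tsum_fourierInv_eq hn 0 ht (2 * Real.pi * y)
  have e : 2 * Real.pi * y / (2 * Real.pi) = y := by field_simp
  simp only [fourierInv_eq_lineDensity, e] at h
  rw [pow_zero, one_mul, if_pos trivial] at h
  rw [← Complex.ofReal_tsum, Complex.ofReal_inj] at h
  rw [h, ringHeat]
  field_simp

/-- Cut the line integral over the periodic preimage of A into periods, sum the translates under the
integral, and apply Poisson summation pointwise. -/
lemma ringLaw_apply {n : ℕ} (hn : 1 ≤ n) {t : ℝ} (ht : 0 < t) {A : Set Ring1}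
    (hA : MeasurableSet A) :
    ringLaw n t A = ∫ θ in Ico 0 (2 * Real.pi) ∩ (fun x : ℝ => (x : Ring1)) ⁻¹' A,
      ringHeat n θ t := by
  have hm : Measurable (fun x : ℝ => (x : Ring1)) := AddCircle.measurable_mk'
  have hpi := Real.pi_pos
  set B : Set ℝ := (fun x : ℝ => (x : Ring1)) ⁻¹' A with hB
  have hBm : MeasurableSet B := hm hA
  have hBper : ∀ (y : ℝ) (m : ℤ), 2 * Real.pi * (y + m) ∈ B ↔ 2 * Real.pi * y ∈ B := by
    intro y m
    have : ((2 * Real.pi * (y + m) : ℝ) : Ring1) = ((2 * Real.pi * y : ℝ) : Ring1) := by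
      have e : 2 * Real.pi * (y + m) = 2 * Real.pi * y + m • (2 * Real.pi) := by
        rw [zsmul_eq_mul]; ring
      rw [e, AddCircle.coe_add, AddCircle.coe_zsmul, AddCircle.coe_period, smul_zero, add_zero]
    simp only [hB, mem_preimage, this]
  have hu := integrable_lineDensity hn ht
  rw [ringLaw, VectorMeasure.map_apply _ hm hA, lineLaw, withDensityᵥ_apply hu hBm]
  -- Rescaled to period 1, so that the translates are by integers.
  set f : ℝ → ℝ := fun y => 2 * Real.pi * B.indicator (fun x => lineDensity n x t) (2 * Real.pi * y)
    with hf
  have hfi : Integrable f :=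
    (((hu.indicator hBm).comp_mul_left' (R := 2 * Real.pi) (by positivity))).const_mul _
  have hint : ∫ y, f y = ∫ x in B, lineDensity n x t := by
    rw [← integral_indicator hBm, hf, integral_const_mul,
      Measure.integral_comp_mul_left (B.indicator (fun x => lineDensity n x t)), smul_eq_mul,
      abs_of_pos (by positivity)]
    field_simp
  have hsum := hfi.hasSum_intervalIntegral_comp_add_int
  have hsumn := hfi.norm.hasSum_intervalIntegral_comp_add_int
  simp only [intervalIntegral.integral_of_le zero_le_one] at hsum hsumn
  have hswap := hasSum_integral_of_summable_integral_norm
    (μ := volume.restrict (Ioc (0 : ℝ) 1)) (F := fun (m : ℤ) y => f (y + m))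
    (fun m => (hfi.comp_add_right (m : ℝ)).integrableOn) hsumn.summable
  rw [← hint, hsum.unique hswap]
  have hpt : ∀ y : ℝ, ∑' m : ℤ, f (y + m) =
      2 * Real.pi * B.indicator (fun θ => ringHeat n θ t) (2 * Real.pi * y) := by
    intro y
    by_cases hy : 2 * Real.pi * y ∈ B
    · rw [indicator_of_mem hy, ← tsum_lineDensity hn ht]
      refine tsum_congr fun m => ?_
      rw [hf]
      simp only
      rw [indicator_of_mem ((hBper y m).2 hy)]
    · rw [indicator_of_notMem hy, mul_zero]
      have : ∀ m : ℤ, f (y + m) = 0 := fun m => by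
        rw [hf]
        simp only
        rw [indicator_of_notMem (fun h => hy ((hBper y m).1 h)), mul_zero]
      simp only [this, tsum_zero]
  simp only [hpt]
  rw [integral_const_mul, ← intervalIntegral.integral_of_le zero_le_one,
    intervalIntegral.mul_integral_comp_mul_left (2 * Real.pi)
      (f := B.indicator (fun θ => ringHeat n θ t)), mul_zero, mul_one,
    intervalIntegral.integral_of_le (by positivity), ← integral_Ico_eq_integral_Ioc,
    setIntegral_indicator hBm]

end RingLaw

/-! ### Cosine series paired with integrable functions -/

section Pairing

variable {α : Type*} [MeasurableSpace α] {μ : Measure α}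

lemma integrable_tsum_of_summable_integral_norm {F : ℕ → α → ℝ}
    (hF : ∀ i, Integrable (F i) μ) (hs : Summable fun i => ∫ a, ‖F i a‖ ∂μ) :
    Integrable (fun a => ∑' i, F i a) μ := by
  have h1 : ∫⁻ a, ∑' i, ‖F i a‖ₑ ∂μ ≠ ⊤ := by
    rw [lintegral_tsum fun i => (hF i).1.enorm]
    have (i : ℕ) : ∫⁻ a, ‖F i a‖ₑ ∂μ = ENNReal.ofReal (∫ a, ‖F i a‖ ∂μ) :=
      (ofReal_integral_norm_eq_lintegral_enorm (hF i)).symm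
    simp only [this]
    rw [← ENNReal.ofReal_tsum_of_nonneg (fun i => integral_nonneg fun _ => norm_nonneg _) hs]
    exact ENNReal.ofReal_ne_top
  have h2 : ∀ᵐ a ∂μ, Summable fun i => F i a := by
    filter_upwards [ae_lt_top' (AEMeasurable.tsum fun i => (hF i).1.enorm) h1] with a ha
    refine Summable.of_norm ?_
    exact NNReal.summable_coe.2 (ENNReal.tsum_coe_ne_top_iff_summable.1 ha.ne)
  refine ⟨aestronglyMeasurable_of_tendsto_ae atTop
    (f := fun (N : ℕ) a => ∑ i ∈ Finset.range N, F i a)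
    (fun N => (integrable_finsetSum _ fun i _ => hF i).1) ?_, ?_⟩
  · filter_upwards [h2] with a ha using ha.hasSum.tendsto_sum_nat
  · refine lt_of_le_of_lt (lintegral_mono fun a => ?_) (lt_top_iff_ne_top.2 h1)
    exact enorm_tsum_le_tsum_enorm

/-- The cosine series with coefficients `b`. -/
def cosSeries (b : ℕ → ℝ) (θ : ℝ) : ℝ :=
  (1 / (2 * Real.pi)) * (1 + 2 * ∑' m : ℕ, b m * Real.cos (((m : ℝ) + 1) * θ))

/-- The integral of `ψ` over one period against the cosine series with coefficients `b`. -/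
def cosPairing (ψ : ℝ → ℝ) (b : ℕ → ℝ) : ℝ :=
  (1 / (2 * Real.pi)) * ((∫ θ in Ico 0 (2 * Real.pi), ψ θ) +
    2 * ∑' m : ℕ, b m * ∫ θ in Ico 0 (2 * Real.pi), ψ θ * Real.cos (((m : ℝ) + 1) * θ))

lemma continuous_cosSeries {b : ℕ → ℝ} (hb : Summable fun m => |b m|) :
    Continuous (cosSeries b) := by
  refine continuous_const.mul (continuous_const.add (continuous_const.mul ?_))
  refine continuous_tsum (fun m => by fun_prop) hb fun m θ => ?_
  rw [norm_mul, Real.norm_eq_abs]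
  exact mul_le_of_le_one_right (abs_nonneg _) (Real.abs_cos_le_one _)

lemma integrableOn_mul_cos {ψ : ℝ → ℝ} (hψ : IntegrableOn ψ (Ico 0 (2 * Real.pi))) (k : ℝ) :
    IntegrableOn (fun θ => ψ θ * Real.cos (k * θ)) (Ico 0 (2 * Real.pi)) :=
  Integrable.mul_bdd (c := 1) hψ (Continuous.aestronglyMeasurable (by fun_prop))
    (Eventually.of_forall fun θ => Real.abs_cos_le_one _)

lemma abs_integral_mul_cos_le {ψ : ℝ → ℝ} (hψ : IntegrableOn ψ (Ico 0 (2 * Real.pi))) (k : ℝ) :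
    |∫ θ in Ico 0 (2 * Real.pi), ψ θ * Real.cos (k * θ)| ≤ ∫ θ in Ico 0 (2 * Real.pi), |ψ θ| := by
  refine (abs_integral_le_integral_abs).trans
    (integral_mono (integrableOn_mul_cos hψ k).abs hψ.abs fun θ => ?_)
  simp only [abs_mul]
  exact mul_le_of_le_one_right (abs_nonneg _) (Real.abs_cos_le_one _)

lemma integral_cosSeries_mul {b : ℕ → ℝ} (hb : Summable fun m => |b m|) {ψ : ℝ → ℝ}
    (hψ : IntegrableOn ψ (Ico 0 (2 * Real.pi))) :
    ∫ θ in Ico 0 (2 * Real.pi), cosSeries b θ * ψ θ = cosPairing ψ b := by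
  have hF : ∀ m : ℕ, IntegrableOn (fun θ => b m * (ψ θ * Real.cos (((m : ℝ) + 1) * θ)))
      (Ico 0 (2 * Real.pi)) := fun m => (integrableOn_mul_cos hψ _).const_mul _
  have hs : Summable fun m : ℕ => ∫ θ in Ico 0 (2 * Real.pi),
      ‖b m * (ψ θ * Real.cos (((m : ℝ) + 1) * θ))‖ := by
    refine Summable.of_nonneg_of_le (fun m => integral_nonneg fun _ => norm_nonneg _) (fun m => ?_)
      (hb.mul_right (∫ θ in Ico 0 (2 * Real.pi), |ψ θ|))
    rw [← integral_const_mul]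
    refine integral_mono (hF m).norm (hψ.abs.const_mul _) fun θ => ?_
    simp only [norm_mul, Real.norm_eq_abs]
    gcongr
    exact mul_le_of_le_one_right (abs_nonneg _) (Real.abs_cos_le_one _)
  have h1 := integral_tsum_of_summable_integral_norm hF hs
  have h2 := integrable_tsum_of_summable_integral_norm hF hs
  simp only [integral_const_mul] at h1
  have hpt : ∀ θ, cosSeries b θ * ψ θ = (1 / (2 * Real.pi)) *
      (ψ θ + 2 * ∑' m : ℕ, b m * (ψ θ * Real.cos (((m : ℝ) + 1) * θ))) := fun θ => by
    have : ∑' m : ℕ, b m * (ψ θ * Real.cos (((m : ℝ) + 1) * θ)) =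
        ψ θ * ∑' m : ℕ, b m * Real.cos (((m : ℝ) + 1) * θ) := by
      rw [← tsum_mul_left]
      exact tsum_congr fun m => by ring
    rw [this, cosSeries]
    ring
  simp only [hpt]
  rw [integral_const_mul, integral_add hψ (h2.const_mul 2), integral_const_mul, ← h1, cosPairing]

lemma ringHeat_eq_cosSeries (n : ℕ) (θ s : ℝ) :
    ringHeat n θ s = cosSeries (fun m => Real.exp (-((m : ℝ) + 1) ^ (2 * n) * s)) θ := by
  simp [ringHeat, ringKernel, cosSeries]

lemma summable_exp {n : ℕ} (hn : 1 ≤ n) {s : ℝ} (hs : 0 < s) :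
    Summable fun m : ℕ => |Real.exp (-((m : ℝ) + 1) ^ (2 * n) * s)| := by
  simpa [abs_of_pos (Real.exp_pos _)] using summable_pow_mul_exp hn 0 hs

lemma integrableOn_indicator_one {B : Set ℝ} (hB : MeasurableSet B) :
    IntegrableOn (B.indicator 1 : ℝ → ℝ) (Ico 0 (2 * Real.pi)) :=
  IntegrableOn.indicator (f := fun _ => (1 : ℝ)) (integrableOn_const measure_Ico_lt_top.ne) hB

/-- The signed law of the circular pseudoprocess in terms of Fourier coefficients. -/
lemma ringLaw_eq_cosPairing {n : ℕ} (hn : 1 ≤ n) {t : ℝ} (ht : 0 < t) {A : Set Ring1}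
    (hA : MeasurableSet A) :
    ringLaw n t A = cosPairing (((fun x : ℝ => (x : Ring1)) ⁻¹' A).indicator 1)
      (fun m => Real.exp (-((m : ℝ) + 1) ^ (2 * n) * t)) := by
  have hm : MeasurableSet ((fun x : ℝ => (x : Ring1)) ⁻¹' A) := AddCircle.measurable_mk' hA
  rw [ringLaw_apply hn ht hA, ← integral_cosSeries_mul (summable_exp hn ht)
    (integrableOn_indicator_one hm), ← setIntegral_indicator hm]
  refine integral_congr_ae (Eventually.of_forall fun θ => ?_)
  simp only [← ringHeat_eq_cosSeries]
  by_cases h : θ ∈ (fun x : ℝ => (x : Ring1)) ⁻¹' A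
  · simp only [indicator_of_mem h, Pi.one_apply, mul_one]
  · simp only [indicator_of_notMem h, mul_zero]

end Pairing

/-! ### Averaging over the random time -/

section Expectation

variable {Ω : Type*} [MeasurableSpace Ω] {P : Measure Ω} {ν : ℝ} {Y : Ω → ℝ}

lemma vFrac_eq_cosSeries (n : ℕ) (ν θ t : ℝ) :
    vFrac n ν θ t = cosSeries (fun m => mittagLeffler ν (-((m : ℝ) + 1) ^ (2 * n) * t ^ ν)) θ := rfl

namespace IsMittagLefflerVar

lemma mittagLeffler_nonneg (hY : IsMittagLefflerVar ν P Y) (hν : 0 < ν) (x : ℝ) :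
    0 ≤ mittagLeffler ν x := by
  rw [← hY.integral_exp hν]
  exact integral_nonneg fun _ => (Real.exp_pos _).le

/-- The decay C/x at x = k^{2n} t^ν gives terms O(k^{-2n}), and n ≥ 1 suffices. -/
lemma summable_abs_mittagLeffler (hY : IsMittagLefflerVar ν P Y) (hν : 0 < ν) {n : ℕ} (hn : 1 ≤ n)
    {t : ℝ} (ht : 0 < t) :
    Summable fun m : ℕ => |mittagLeffler ν (-((m : ℝ) + 1) ^ (2 * n) * t ^ ν)| := by
  obtain ⟨C, hC0, hC⟩ := hY.decay
  refine Summable.of_nonneg_of_le (fun m => abs_nonneg _) (fun m => ?_)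
    (summable_succ_sq_inv.mul_left (C / t ^ ν))
  rw [abs_of_nonneg (hY.mittagLeffler_nonneg hν _), ← hY.integral_exp hν, neg_mul]
  refine (hC _ (by positivity)).trans ?_
  have h1 : ((m : ℝ) + 1) ^ 2 ≤ ((m : ℝ) + 1) ^ (2 * n) :=
    pow_le_pow_right₀ (by linarith [(Nat.cast_nonneg m : (0 : ℝ) ≤ m)]) (by omega)
  calc C / (((m : ℝ) + 1) ^ (2 * n) * t ^ ν) ≤ C / (((m : ℝ) + 1) ^ 2 * t ^ ν) := by gcongr
    _ = _ := by field_simp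

variable [IsProbabilityMeasure P]

lemma mittagLeffler_le_one (hY : IsMittagLefflerVar ν P Y) (hν : 0 < ν) {x : ℝ} (hx : 0 ≤ x) :
    mittagLeffler ν (-x) ≤ 1 := by
  rw [← hY.integral_exp hν]
  have : ∫ ω, Real.exp (-x * Y ω) ∂P ≤ ∫ _, (1 : ℝ) ∂P := by
    refine integral_mono_ae (hY.integrable_exp hx) (integrable_const _) ?_
    filter_upwards [hY.nonneg] with ω hω
    exact Real.exp_le_one_iff.2 (by nlinarith)
  simpa using this

/-- Averaging an exponential series with bounded coefficients over the random time `t^ν Y`. -/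
lemma integral_tsum_exp (hY : IsMittagLefflerVar ν P Y) (hν : 0 < ν) {n : ℕ} (hn : 1 ≤ n)
    {t : ℝ} (ht : 0 < t) {c : ℕ → ℝ} {K : ℝ} (hc : ∀ m, |c m| ≤ K) :
    Integrable (fun ω => ∑' m : ℕ, Real.exp (-((m : ℝ) + 1) ^ (2 * n) * (t ^ ν * Y ω)) * c m) P ∧
    ∫ ω, ∑' m : ℕ, Real.exp (-((m : ℝ) + 1) ^ (2 * n) * (t ^ ν * Y ω)) * c m ∂P =
      ∑' m : ℕ, mittagLeffler ν (-((m : ℝ) + 1) ^ (2 * n) * t ^ ν) * c m := by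
  have he : ∀ (m : ℕ) (ω : Ω), -((m : ℝ) + 1) ^ (2 * n) * (t ^ ν * Y ω) =
      -(((m : ℝ) + 1) ^ (2 * n) * t ^ ν) * Y ω := fun m ω => by ring
  have hI : ∀ m : ℕ, Integrable (fun ω => Real.exp (-((m : ℝ) + 1) ^ (2 * n) * (t ^ ν * Y ω))) P :=
    fun m => by
      simp only [he]
      exact hY.integrable_exp (by positivity)
  have hE : ∀ m : ℕ, ∫ ω, Real.exp (-((m : ℝ) + 1) ^ (2 * n) * (t ^ ν * Y ω)) ∂P =
      mittagLeffler ν (-((m : ℝ) + 1) ^ (2 * n) * t ^ ν) := fun m => by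
    simp only [he]
    rw [hY.integral_exp hν, neg_mul]
  have hs : Summable fun m : ℕ =>
      ∫ ω, ‖Real.exp (-((m : ℝ) + 1) ^ (2 * n) * (t ^ ν * Y ω)) * c m‖ ∂P := by
    refine Summable.of_nonneg_of_le (fun m => integral_nonneg fun _ => norm_nonneg _) (fun m => ?_)
      ((hY.summable_abs_mittagLeffler hν hn ht).mul_right K)
    simp only [norm_mul, Real.norm_eq_abs, abs_of_pos (Real.exp_pos _)]
    rw [integral_mul_const, hE, abs_of_nonneg (hY.mittagLeffler_nonneg hν _)]
    exact mul_le_mul_of_nonneg_left (hc m) (hY.mittagLeffler_nonneg hν _)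
  refine ⟨integrable_tsum_of_summable_integral_norm (fun m => (hI m).mul_const _) hs, ?_⟩
  rw [← integral_tsum_of_summable_integral_norm (fun m => (hI m).mul_const _) hs]
  simp only [integral_mul_const, hE]

/-- Used twice: with ψ an indicator it yields the law of the time-changed process, with ψ a test
function the distributional equation. -/
lemma integral_cosPairing (hY : IsMittagLefflerVar ν P Y) (hν : 0 < ν) {n : ℕ} (hn : 1 ≤ n)
    {t : ℝ} (ht : 0 < t) {ψ : ℝ → ℝ} (hψ : IntegrableOn ψ (Ico 0 (2 * Real.pi))) :
    Integrable (fun ω => cosPairing ψ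
      fun m => Real.exp (-((m : ℝ) + 1) ^ (2 * n) * (t ^ ν * Y ω))) P ∧
    ∫ ω, cosPairing ψ (fun m => Real.exp (-((m : ℝ) + 1) ^ (2 * n) * (t ^ ν * Y ω))) ∂P =
      ∫ θ in Ico 0 (2 * Real.pi), vFrac n ν θ t * ψ θ := by
  obtain ⟨h1, h2⟩ := hY.integral_tsum_exp hν hn ht (fun m => abs_integral_mul_cos_le hψ ((m : ℝ) + 1))
  simp only [vFrac_eq_cosSeries]
  rw [integral_cosSeries_mul (hY.summable_abs_mittagLeffler hν hn ht) hψ]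
  refine ⟨((integrable_const _).add (h1.const_mul 2)).const_mul _, ?_⟩
  simp only [cosPairing]
  rw [integral_const_mul, integral_add (integrable_const _) (h1.const_mul 2), integral_const_mul, h2]
  simp

lemma integral_ringHeat (hY : IsMittagLefflerVar ν P Y) (hν : 0 < ν) {n : ℕ} (hn : 1 ≤ n)
    {t : ℝ} (ht : 0 < t) (θ : ℝ) :
    Integrable (fun ω => ringHeat n θ (t ^ ν * Y ω)) P ∧
    ∫ ω, ringHeat n θ (t ^ ν * Y ω) ∂P = vFrac n ν θ t := by
  obtain ⟨h1, h2⟩ := hY.integral_tsum_exp hν hn ht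
    (fun m : ℕ => Real.abs_cos_le_one (((m : ℝ) + 1) * θ))
  simp only [ringHeat_eq_cosSeries, vFrac_eq_cosSeries, cosSeries]
  refine ⟨((integrable_const _).add (h1.const_mul 2)).const_mul _, ?_⟩
  rw [integral_const_mul, integral_add (integrable_const _) (h1.const_mul 2), integral_const_mul, h2]
  simp

end IsMittagLefflerVar

variable [IsProbabilityMeasure P]

/-- The density of the time-changed pseudoprocess. -/
lemma IsStableSubordinator.timeChangedLaw_eq {H : ℝ≥0 → Ω → ℝ} (hH : IsStableSubordinator ν H P)
    (hν : 0 < ν) {n : ℕ} (hn : 1 ≤ n) {t : ℝ} (ht : 0 < t) {A : Set Ring1}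
    (hA : MeasurableSet A) :
    Integrable (fun ω => ringLaw n (inverseProcess H t ω) A) P ∧
    timeChangedLaw n P (inverseProcess H t) A =
      ∫ θ in Ico 0 (2 * Real.pi) ∩ (fun x : ℝ => (x : Ring1)) ⁻¹' A, vFrac n ν θ t := by
  have hY := hH.isMittagLefflerVar hν
  have hm : MeasurableSet ((fun x : ℝ => (x : Ring1)) ⁻¹' A) := AddCircle.measurable_mk' hA
  set ψ : ℝ → ℝ := ((fun x : ℝ => (x : Ring1)) ⁻¹' A).indicator 1 with hψ
  have hψi : IntegrableOn ψ (Ico 0 (2 * Real.pi)) := integrableOn_indicator_one hm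
  -- An explicit measurable function of time that equals the signed mass of A at every positive
  -- time, hence almost surely at L(t).
  set G : ℝ → ℝ := fun s => cosPairing ψ fun m => Real.exp (-((m : ℝ) + 1) ^ (2 * n) * s) with hG
  obtain ⟨h1, h2⟩ := hY.integral_cosPairing hν hn ht hψi
  have hYm : AEMeasurable (fun ω => t ^ ν * H 1 ω ^ (-ν)) P := (hY.measurable.const_mul _).aemeasurable
  have hLm := hH.aemeasurable_inverse ht
  have hGm : Measurable G := by
    simp only [hG, cosPairing]
    refine measurable_const.mul (measurable_const.add (measurable_const.mul ?_))
    exact Measurable.tsum fun m => by fun_prop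
  have hmap := hH.map_inverse hν ht
  have hcongr : (fun ω => ringLaw n (inverseProcess H t ω) A) =ᵐ[P]
      fun ω => G (inverseProcess H t ω) := by
    filter_upwards [hH.inverse_pos ht] with ω hω
    exact ringLaw_eq_cosPairing hn hω hA
  constructor
  · refine Integrable.congr ?_ hcongr.symm
    have h3 : Integrable G (P.map (inverseProcess H t)) := by
      rw [hmap]
      exact (integrable_map_measure hGm.aestronglyMeasurable hYm).2 h1
    exact (integrable_map_measure hGm.aestronglyMeasurable hLm).1 h3
  · rw [timeChangedLaw, integral_congr_ae hcongr,
      ← integral_map hLm hGm.aestronglyMeasurable, hmap,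
      integral_map hYm hGm.aestronglyMeasurable]
    refine h2.trans ?_
    rw [← setIntegral_indicator hm]
    refine integral_congr_ae (Eventually.of_forall fun θ => ?_)
    by_cases h : θ ∈ (fun x : ℝ => (x : Ring1)) ⁻¹' A
    · simp only [hψ, indicator_of_mem h, Pi.one_apply, mul_one]
    · simp only [hψ, indicator_of_notMem h, mul_zero]

end Expectation

/-! ### Fourier coefficients of smooth periodic functions -/

section TestFunctions

/-- Smooth `2π`-periodic functions. -/
def SmoothPeriodic (φ : ℝ → ℝ) : Prop :=
  ContDiff ℝ (⊤ : ℕ∞) φ ∧ Function.Periodic φ (2 * Real.pi)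

lemma negLaplacePow_zero (φ : ℝ → ℝ) : negLaplacePow 0 φ = φ := by
  funext θ
  simp [negLaplacePow]

lemma negLaplacePow_succ (p : ℕ) (φ : ℝ → ℝ) :
    negLaplacePow (p + 1) φ = fun θ => -deriv (deriv (negLaplacePow p φ)) θ := by
  funext θ
  have h1 : deriv (negLaplacePow p φ) = fun x => (-1) ^ p * iteratedDeriv (2 * p + 1) φ x := by
    funext x
    rw [iteratedDeriv_succ]
    exact deriv_const_mul_field _
  rw [h1, deriv_const_mul_field, ← iteratedDeriv_succ, negLaplacePow, pow_succ, mul_add]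
  ring

namespace SmoothPeriodic

variable {φ : ℝ → ℝ}

lemma deriv (h : SmoothPeriodic φ) : SmoothPeriodic (deriv φ) := by
  refine ⟨(contDiff_infty_iff_deriv.1 h.1).2, fun x => ?_⟩
  rw [← deriv_comp_add_const]
  congr 1
  funext y
  exact h.2 y

lemma neg (h : SmoothPeriodic φ) : SmoothPeriodic (fun θ => -φ θ) :=
  ⟨h.1.neg, fun x => by simp only [h.2 x]⟩

lemma negLaplacePow (h : SmoothPeriodic φ) (p : ℕ) : SmoothPeriodic (negLaplacePow p φ) := by
  induction p with
  | zero => rwa [negLaplacePow_zero]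
  | succ p ih => rw [negLaplacePow_succ]; exact ih.deriv.deriv.neg

lemma integrableOn (h : SmoothPeriodic φ) : IntegrableOn φ (Ico 0 (2 * Real.pi)) :=
  (h.1.continuous.integrableOn_Icc).mono_set Ico_subset_Icc_self

/-- Two integrations by parts; the boundary terms cancel because k is an integer. The phase β treats
cosines and sines together. -/
lemma integral_deriv_deriv_mul_cos (h : SmoothPeriodic φ) (k : ℤ) (β : ℝ) :
    ∫ θ in Ico 0 (2 * Real.pi), (_root_.deriv (_root_.deriv φ)) θ * Real.cos (k * θ + β) =
      -((k : ℝ) ^ 2 * ∫ θ in Ico 0 (2 * Real.pi), φ θ * Real.cos (k * θ + β)) := by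
  have hpi := Real.pi_pos
  have hd : ∀ {f : ℝ → ℝ}, SmoothPeriodic f → ∀ θ, HasDerivAt f (_root_.deriv f θ) θ :=
    fun hf θ => ((contDiff_infty_iff_deriv.1 hf.1).1 θ).hasDerivAt
  have hF : ∀ θ ∈ uIcc 0 (2 * Real.pi), HasDerivAt
      (fun θ => _root_.deriv φ θ * Real.cos (k * θ + β) + k * (φ θ * Real.sin (k * θ + β)))
      (_root_.deriv (_root_.deriv φ) θ * Real.cos (k * θ + β) +
        (k : ℝ) ^ 2 * (φ θ * Real.cos (k * θ + β))) θ := by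
    intro θ _
    have ha : HasDerivAt (fun θ : ℝ => k * θ + β) (k : ℝ) θ := by
      simpa using ((hasDerivAt_id θ).const_mul (k : ℝ)).add_const β
    have := ((hd h.deriv θ).mul ha.cos).add (((hd h θ).mul ha.sin).const_mul (k : ℝ))
    convert! this using 1
    ring
  have hc0 := h.1.continuous
  have hc2 := h.deriv.deriv.1.continuous
  have hi1 : IntervalIntegrable (fun θ => _root_.deriv (_root_.deriv φ) θ * Real.cos (k * θ + β))
      volume 0 (2 * Real.pi) := Continuous.intervalIntegrable (by fun_prop) _ _
  have hi2 : IntervalIntegrable (fun θ => (k : ℝ) ^ 2 * (φ θ * Real.cos (k * θ + β)))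
      volume 0 (2 * Real.pi) := Continuous.intervalIntegrable (by fun_prop) _ _
  have key := intervalIntegral.integral_eq_sub_of_hasDerivAt hF (hi1.add hi2)
  rw [intervalIntegral.integral_add hi1 hi2, intervalIntegral.integral_const_mul] at key
  have e1 : (k : ℝ) * (2 * Real.pi) + β = β + k * (2 * Real.pi) := by ring
  have e2 : φ (2 * Real.pi) = φ 0 := by simpa using h.2 0
  have e3 : _root_.deriv φ (2 * Real.pi) = _root_.deriv φ 0 := by simpa using h.deriv.2 0
  rw [e1, Real.cos_add_int_mul_two_pi, Real.sin_add_int_mul_two_pi, e2, e3, mul_zero, zero_add,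
    sub_self, intervalIntegral.integral_of_le (by positivity),
    intervalIntegral.integral_of_le (by positivity), ← integral_Ico_eq_integral_Ioc,
    ← integral_Ico_eq_integral_Ioc] at key
  linarith

lemma integral_negLaplacePow_mul_cos (h : SmoothPeriodic φ) (p : ℕ) (k : ℤ) (β : ℝ) :
    ∫ θ in Ico 0 (2 * Real.pi), CircPseudo.negLaplacePow p φ θ * Real.cos (k * θ + β) =
      (k : ℝ) ^ (2 * p) * ∫ θ in Ico 0 (2 * Real.pi), φ θ * Real.cos (k * θ + β) := by
  induction p with
  | zero => simp [negLaplacePow_zero]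
  | succ p ih =>
    simp only [negLaplacePow_succ, neg_mul]
    rw [integral_neg, (h.negLaplacePow p).integral_deriv_deriv_mul_cos, ih]
    ring

/-- One application of -∂² costs a factor k², and the resulting coefficient is at most the L¹ norm.
-/
lemma exists_coeff_le (h : SmoothPeriodic φ) : ∃ K : ℝ, ∀ (m : ℕ) (k : ℤ) (β : ℝ),
    |(k : ℝ)| = (m : ℝ) + 1 →
    |∫ θ in Ico 0 (2 * Real.pi), φ θ * Real.cos (k * θ + β)| ≤ K * (((m : ℝ) + 1) ^ 2)⁻¹ := by
  refine ⟨∫ θ in Ico 0 (2 * Real.pi), |CircPseudo.negLaplacePow 1 φ θ|, fun m k β hk => ?_⟩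
  have h1 := h.integral_negLaplacePow_mul_cos 1 k β
  have hi := (h.negLaplacePow 1).integrableOn
  have h2 : |∫ θ in Ico 0 (2 * Real.pi), CircPseudo.negLaplacePow 1 φ θ * Real.cos (k * θ + β)| ≤
      ∫ θ in Ico 0 (2 * Real.pi), |CircPseudo.negLaplacePow 1 φ θ| := by
    refine (abs_integral_le_integral_abs).trans (integral_mono_of_nonneg
      (Eventually.of_forall fun _ => abs_nonneg _) hi.abs (Eventually.of_forall fun θ => ?_))
    simp only [abs_mul]
    exact mul_le_of_le_one_right (abs_nonneg _) (Real.abs_cos_le_one _)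
  rw [h1, abs_mul, abs_pow, hk, mul_one] at h2
  rw [← div_eq_mul_inv, le_div_iff₀ (by positivity)]
  linarith

lemma integral_negLaplacePow (h : SmoothPeriodic φ) {p : ℕ} (hp : 1 ≤ p) :
    ∫ θ in Ico 0 (2 * Real.pi), CircPseudo.negLaplacePow p φ θ = 0 := by
  have h1 := h.integral_negLaplacePow_mul_cos p 0 0
  have : 2 * p ≠ 0 := by omega
  simpa [this] using h1

lemma coeff_negLaplacePow (h : SmoothPeriodic φ) (p m : ℕ) :
    ∫ θ in Ico 0 (2 * Real.pi), CircPseudo.negLaplacePow p φ θ * Real.cos (((m : ℝ) + 1) * θ) =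
      ((m : ℝ) + 1) ^ (2 * p) *
        ∫ θ in Ico 0 (2 * Real.pi), φ θ * Real.cos (((m : ℝ) + 1) * θ) := by
  have h1 := h.integral_negLaplacePow_mul_cos p ((m : ℤ) + 1) 0
  simpa using h1

lemma summable_coeff (h : SmoothPeriodic φ) :
    Summable fun m : ℕ => |∫ θ in Ico 0 (2 * Real.pi), φ θ * Real.cos (((m : ℝ) + 1) * θ)| := by
  obtain ⟨K, hK⟩ := h.exists_coeff_le
  refine Summable.of_nonneg_of_le (fun m => abs_nonneg _) (fun m => ?_)
    (summable_succ_sq_inv.mul_left K)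
  have h1 := hK m ((m : ℤ) + 1) 0 (by push_cast; exact abs_of_pos (by positivity))
  simpa using h1

/-- The cosine-Fourier series of a smooth periodic function at the origin. -/
lemma cosPairing_one (h : SmoothPeriodic φ) : cosPairing φ (fun _ => 1) = φ 0 := by
  have hpi := Real.pi_pos
  have : Fact (0 < 2 * Real.pi) := ⟨by positivity⟩
  have hper : Function.Periodic (fun x => (φ x : ℂ)) (2 * Real.pi) := fun x => by simp only [h.2 x]
  have hcont : Continuous fun x => (φ x : ℂ) := Complex.continuous_ofReal.comp h.1.continuous
  let f : C(AddCircle (2 * Real.pi), ℂ) := ⟨hper.lift, continuous_coinduced_dom.mpr hcont⟩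
  have hc := h.1.continuous
  -- The phases 0 and π/2 give the real and imaginary parts, as cos(x + π/2) = -sin x.
  have hcoef : ∀ k : ℤ, fourierCoeff f k = (((1 / (2 * Real.pi)) *
      ∫ θ in Ico 0 (2 * Real.pi), φ θ * Real.cos (k * θ + 0) : ℝ) : ℂ) +
      (((1 / (2 * Real.pi)) *
      ∫ θ in Ico 0 (2 * Real.pi), φ θ * Real.cos (k * θ + Real.pi / 2) : ℝ) : ℂ) * Complex.I := by
    intro k
    rw [fourierCoeff_eq_intervalIntegral f k 0, zero_add,
      intervalIntegral.integral_of_le (by positivity), ← integral_Ico_eq_integral_Ioc]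
    have e : ∀ x : ℝ, fourier (-k) (x : AddCircle (2 * Real.pi)) • f x =
        ((φ x * Real.cos (k * x + 0) : ℝ) : ℂ) +
          ((φ x * Real.cos (k * x + Real.pi / 2) : ℝ) : ℂ) * Complex.I := by
      intro x
      have hf : f x = (φ x : ℂ) := hper.lift_coe x
      have h1 : 2 * (Real.pi : ℂ) * Complex.I * ((-k : ℤ) : ℂ) * x / ((2 * Real.pi : ℝ) : ℂ) =
          ((-(k * x) : ℝ) : ℂ) * Complex.I := by
        have : (Real.pi : ℂ) ≠ 0 := by exact_mod_cast hpi.ne'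
        push_cast
        field_simp
      rw [fourier_coe_apply, h1, hf, Complex.exp_mul_I, ← Complex.ofReal_cos, ← Complex.ofReal_sin,
        Real.cos_neg, Real.sin_neg, Real.cos_add_pi_div_two, add_zero]
      push_cast
      rw [smul_eq_mul]
      ring
    simp only [e]
    have hint : ∀ β : ℝ, Integrable (fun x : ℝ => ((φ x * Real.cos (k * x + β) : ℝ) : ℂ))
        (volume.restrict (Ico 0 (2 * Real.pi))) := fun β => by
      have hcc : Continuous fun x : ℝ => φ x * Real.cos (k * x + β) := by fun_prop
      exact Integrable.ofReal (hcc.integrableOn_Icc.mono_set Ico_subset_Icc_self)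
    have i1 : Integrable (fun x : ℝ => ((φ x * Real.cos (k * x + 0) : ℝ) : ℂ))
        (volume.restrict (Ico 0 (2 * Real.pi))) := hint _
    have i2 : Integrable (fun x : ℝ => ((φ x * Real.cos (k * x + Real.pi / 2) : ℝ) : ℂ))
        (volume.restrict (Ico 0 (2 * Real.pi))) := hint _
    rw [integral_add i1 (i2.mul_const _), integral_mul_const, integral_complex_ofReal,
      integral_complex_ofReal, Complex.real_smul]
    push_cast
    ring
  obtain ⟨K, hK⟩ := h.exists_coeff_le
  have hbound : ∀ (m : ℕ) (k : ℤ), |(k : ℝ)| = (m : ℝ) + 1 →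
      ‖fourierCoeff f k‖ ≤ (1 / (2 * Real.pi)) * (2 * K) * (((m : ℝ) + 1) ^ 2)⁻¹ := by
    intro m k hk
    rw [hcoef]
    refine (norm_add_le _ _).trans ?_
    rw [norm_mul, Complex.norm_I, mul_one, Complex.norm_real, Complex.norm_real, norm_mul, norm_mul,
      Real.norm_of_nonneg (by positivity : 0 ≤ 1 / (2 * Real.pi)), Real.norm_eq_abs, Real.norm_eq_abs]
    have a1 := hK m k 0 hk
    have a2 := hK m k (Real.pi / 2) hk
    rw [← mul_add, mul_assoc]
    refine mul_le_mul_of_nonneg_left ?_ (by positivity)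
    linarith
  have hsum : Summable (fourierCoeff f) := by
    have hB := summable_succ_sq_inv.mul_left ((1 / (2 * Real.pi)) * (2 * K))
    refine Summable.of_add_one_of_neg_add_one ?_ ?_
    · refine hB.of_norm_bounded fun m => hbound m _ ?_
      push_cast; exact abs_of_pos (by positivity)
    · refine hB.of_norm_bounded fun m => hbound m _ ?_
      push_cast
      rw [← abs_neg, abs_of_pos] <;> ring_nf
      positivity
  have hs := (has_pointwise_sum_fourier_series_of_summable hsum
    ((0 : ℝ) : AddCircle (2 * Real.pi))).nat_add_neg
  have hf0 : f ((0 : ℝ) : AddCircle (2 * Real.pi)) = (φ 0 : ℂ) := hper.lift_coe 0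
  have hone : ∀ k : ℤ, fourier k ((0 : ℝ) : AddCircle (2 * Real.pi)) = (1 : ℂ) := fun k => by
    rw [fourier_coe_apply]; simp
  rw [hf0] at hs
  simp only [hone, smul_eq_mul, mul_one] at hs
  -- Real parts drop the sine coefficients, and the terms at k and -k merge into twice a cosine
  -- coefficient.
  have hre := Complex.hasSum_re hs
  have hre2 := ((hasSum_nat_add_iff' 1).2 hre).tsum_eq
  have hk : ∀ m : ℕ, (fourierCoeff f ((m + 1 : ℕ) : ℤ) + fourierCoeff f (-((m + 1 : ℕ) : ℤ))).re =
      (1 / (2 * Real.pi)) * 2 *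
        ∫ θ in Ico 0 (2 * Real.pi), φ θ * Real.cos (((m : ℝ) + 1) * θ) := by
    intro m
    have : ∀ θ : ℝ, Real.cos ((-(m + 1 : ℕ) : ℤ) * θ + 0) = Real.cos (((m : ℝ) + 1) * θ) := fun θ => by
      rw [add_zero]
      push_cast
      rw [neg_mul, Real.cos_neg]
    rw [hcoef, hcoef]
    simp only [Complex.add_re, Complex.ofReal_re, Complex.mul_re, Complex.I_re,
      Complex.I_im, Complex.ofReal_im, mul_zero, zero_mul, sub_zero, add_zero] at this ⊢
    simp only [this]
    push_cast
    ring
  have h0 : (fourierCoeff f 0).re = (1 / (2 * Real.pi)) * ∫ θ in Ico 0 (2 * Real.pi), φ θ := by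
    rw [hcoef]
    simp
  simp only [hk, Finset.sum_range_one, Nat.cast_zero, neg_zero, Complex.add_re, Complex.ofReal_re,
    h0, tsum_mul_left] at hre2
  simp only [cosPairing, one_mul]
  linarith

end SmoothPeriodic

end TestFunctions

/-! ### The equation in the sense of distributions -/

section Distribution

variable {Ω : Type*} [MeasurableSpace Ω] {P : Measure Ω} [IsProbabilityMeasure P] {ν : ℝ}
  {Y : Ω → ℝ}

namespace SmoothPeriodic

variable {φ : ℝ → ℝ}

lemma exp_le_one (n m : ℕ) {s : ℝ} (hs : 0 < s) : Real.exp (-((m : ℝ) + 1) ^ (2 * n) * s) ≤ 1 := by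
  have : (0 : ℝ) ≤ ((m : ℝ) + 1) ^ (2 * n) * s := by positivity
  exact Real.exp_le_one_iff.2 (by linarith)

lemma cosPairing_negLaplacePow (h : SmoothPeriodic φ) {n : ℕ} (hn : 1 ≤ n) (b : ℕ → ℝ) :
    cosPairing (CircPseudo.negLaplacePow n φ) b = (1 / (2 * Real.pi)) * (2 * ∑' m : ℕ,
      b m * (((m : ℝ) + 1) ^ (2 * n) *
        ∫ θ in Ico 0 (2 * Real.pi), φ θ * Real.cos (((m : ℝ) + 1) * θ))) := by
  rw [cosPairing, h.integral_negLaplacePow hn, zero_add]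
  simp only [h.coeff_negLaplacePow]

/-- The majorant comes from the smoothness of φ, through the summable coefficients of (-∂²)^n φ, and
not from the decay of the exponentials. It is therefore uniform over all positive times. -/
lemma hasDerivAt_cosPairing (h : SmoothPeriodic φ) {n : ℕ} (hn : 1 ≤ n) {s : ℝ} (hs : 0 < s) :
    HasDerivAt (fun r => cosPairing φ fun m => Real.exp (-((m : ℝ) + 1) ^ (2 * n) * r))
      (-cosPairing (CircPseudo.negLaplacePow n φ)
        fun m => Real.exp (-((m : ℝ) + 1) ^ (2 * n) * s)) s := by
  set c : ℕ → ℝ := fun m => ∫ θ in Ico 0 (2 * Real.pi), φ θ * Real.cos (((m : ℝ) + 1) * θ) with hc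
  have hA := (h.negLaplacePow n).summable_coeff
  simp only [h.coeff_negLaplacePow] at hA
  have key : HasDerivAt (fun r => ∑' m : ℕ, Real.exp (-((m : ℝ) + 1) ^ (2 * n) * r) * c m)
      (∑' m : ℕ, -(Real.exp (-((m : ℝ) + 1) ^ (2 * n) * s) * (((m : ℝ) + 1) ^ (2 * n) * c m))) s := by
    refine hasDerivAt_tsum_of_isPreconnected (t := Ioi 0) (y₀ := s)
      (g := fun (m : ℕ) r => Real.exp (-((m : ℝ) + 1) ^ (2 * n) * r) * c m)
      (g' := fun (m : ℕ) r =>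
        -(Real.exp (-((m : ℝ) + 1) ^ (2 * n) * r) * (((m : ℝ) + 1) ^ (2 * n) * c m)))
      hA isOpen_Ioi isPreconnected_Ioi (fun m r hr => ?_) (fun m r hr => ?_) (mem_Ioi.2 hs) ?_
      (mem_Ioi.2 hs)
    · have h1 := (((hasDerivAt_id r).const_mul (-((m : ℝ) + 1) ^ (2 * n))).exp).mul_const (c m)
      convert! h1 using 1
      simp only [id]
      ring
    · rw [norm_neg, norm_mul, Real.norm_of_nonneg (Real.exp_pos _).le, Real.norm_eq_abs]
      exact mul_le_of_le_one_left (abs_nonneg _) (exp_le_one n m hr)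
    · refine h.summable_coeff.of_norm_bounded fun m => ?_
      rw [norm_mul, Real.norm_of_nonneg (Real.exp_pos _).le, Real.norm_eq_abs]
      exact mul_le_of_le_one_left (abs_nonneg _) (exp_le_one n m hs)
  rw [h.cosPairing_negLaplacePow hn]
  convert! ((key.const_mul 2).const_add (∫ θ in Ico 0 (2 * Real.pi), φ θ)).const_mul
    (1 / (2 * Real.pi)) using 1
  rw [tsum_neg]
  ring

lemma exists_cosPairing_le (h : SmoothPeriodic φ) (n : ℕ) :
    ∃ C : ℝ, ∀ s : ℝ, 0 < s →
      |cosPairing φ fun m => Real.exp (-((m : ℝ) + 1) ^ (2 * n) * s)| ≤ C := by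
  refine ⟨|1 / (2 * Real.pi)| * (|∫ θ in Ico 0 (2 * Real.pi), φ θ| + |2| *
    ∑' m : ℕ, |∫ θ in Ico 0 (2 * Real.pi), φ θ * Real.cos (((m : ℝ) + 1) * θ)|), fun s hs => ?_⟩
  have h1 := tsum_of_norm_bounded h.summable_coeff.hasSum
    (f := fun m : ℕ => Real.exp (-((m : ℝ) + 1) ^ (2 * n) * s) *
      ∫ θ in Ico 0 (2 * Real.pi), φ θ * Real.cos (((m : ℝ) + 1) * θ)) (fun m => by
    rw [norm_mul, Real.norm_of_nonneg (Real.exp_pos _).le, Real.norm_eq_abs]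
    exact mul_le_of_le_one_left (abs_nonneg _) (exp_le_one n m hs))
  rw [cosPairing, abs_mul]
  refine mul_le_mul_of_nonneg_left ((abs_add_le _ _).trans ?_) (abs_nonneg _)
  rw [abs_mul]
  gcongr
  exact h1

end SmoothPeriodic

namespace IsMittagLefflerVar

/-- Squeeze: 1 - x 𝔼Y ≤ E_{ν,1}(-x) ≤ 1, from e^{-y} ≥ 1 - y. -/
lemma tendsto_mittagLeffler (hY : IsMittagLefflerVar ν P Y) (hν : 0 < ν) {a : ℝ} (ha : 0 ≤ a) :
    Tendsto (fun t : ℝ => mittagLeffler ν (-a * t ^ ν)) (𝓝[>] 0) (𝓝 1) := by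
  have hlow : ∀ x : ℝ, 0 ≤ x → 1 - x * ∫ ω, Y ω ∂P ≤ mittagLeffler ν (-x) := by
    intro x hx
    have i1 : Integrable Y P := by simpa using hY.integrable_pow 1
    rw [← hY.integral_exp hν, ← integral_const_mul]
    have : ∫ ω, (1 - x * Y ω) ∂P ≤ ∫ ω, Real.exp (-x * Y ω) ∂P := by
      refine integral_mono ((integrable_const _).sub (i1.const_mul x)) (hY.integrable_exp hx)
        fun ω => ?_
      have := Real.add_one_le_exp (-x * Y ω)
      simp only; linarith
    rw [integral_sub (integrable_const _) (i1.const_mul x)] at this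
    simpa using this
  have ht : Tendsto (fun t : ℝ => t ^ ν) (𝓝[>] 0) (𝓝 0) := by
    have := (Real.continuousAt_rpow_const 0 ν (Or.inr hν.le)).tendsto
    rw [Real.zero_rpow hν.ne'] at this
    exact this.mono_left nhdsWithin_le_nhds
  refine tendsto_of_tendsto_of_tendsto_of_le_of_le'
    (g := fun t : ℝ => 1 - a * t ^ ν * ∫ ω, Y ω ∂P) ?_ tendsto_const_nhds ?_ ?_
  · have := ((ht.const_mul a).mul_const (∫ ω, Y ω ∂P)).const_sub 1
    simpa using this
  · filter_upwards [eventually_mem_nhdsWithin] with t h0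
    rw [neg_mul]
    exact hlow _ (mul_nonneg ha (Real.rpow_nonneg (le_of_lt h0) _))
  · filter_upwards [eventually_mem_nhdsWithin] with t h0
    rw [neg_mul]
    exact hY.mittagLeffler_le_one hν (mul_nonneg ha (Real.rpow_nonneg (le_of_lt h0) _))

/-- The series solves the time-fractional equation on the ring in the sense of distributions. -/
lemma isRingSolution (hY : IsMittagLefflerVar ν P Y) (hν0 : 0 < ν) (hν1 : ν ≤ 1) {n : ℕ}
    (hn : 1 ≤ n) : IsRingSolution n ν (vFrac n ν) := by
  refine ⟨fun t ht => ?_, fun φ hφ hper t ht => ?_, fun φ hφ hper => ?_⟩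
  · exact ((continuous_cosSeries (hY.summable_abs_mittagLeffler hν0 hn ht)).integrableOn_Icc).mono_set
      Ico_subset_Icc_self
  · have h : SmoothPeriodic φ := ⟨hφ, hper⟩
    obtain ⟨C, hC⟩ := (h.negLaplacePow n).exists_cosPairing_le n
    have hf : ∀ t : ℝ, 0 < t → ∫ θ in Ico 0 (2 * Real.pi), vFrac n ν θ t * φ θ =
        ∫ ω, cosPairing φ (fun m => Real.exp (-((m : ℝ) + 1) ^ (2 * n) * (t ^ ν * Y ω))) ∂P :=
      fun t ht => (hY.integral_cosPairing hν0 hn ht h.integrableOn).2.symm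
    rw [← (hY.integral_cosPairing hν0 hn ht (h.negLaplacePow n).integrableOn).2, ← integral_neg]
    rcases lt_or_eq_of_le hν1 with hν | rfl
    · exact hY.hasCaputoDerivAt_of_lt hν0 hν
        (F := fun s => cosPairing φ fun m => Real.exp (-((m : ℝ) + 1) ^ (2 * n) * s))
        (G := fun s => -cosPairing (negLaplacePow n φ)
          fun m => Real.exp (-((m : ℝ) + 1) ^ (2 * n) * s))
        (fun y hy => h.hasDerivAt_cosPairing hn hy) (fun y hy => by rw [abs_neg]; exact hC y hy)
        (fun t ht => (hY.integral_cosPairing hν0 hn ht h.integrableOn).1) hf ht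
    · exact hY.hasCaputoDerivAt_one
        (F := fun s => cosPairing φ fun m => Real.exp (-((m : ℝ) + 1) ^ (2 * n) * s))
        (G := fun s => -cosPairing (negLaplacePow n φ)
          fun m => Real.exp (-((m : ℝ) + 1) ^ (2 * n) * s))
        (fun y hy => h.hasDerivAt_cosPairing hn hy) hf ht
  · have h : SmoothPeriodic φ := ⟨hφ, hper⟩
    rw [← h.cosPairing_one]
    have hlim : Tendsto (fun t => cosPairing φ
        fun m => mittagLeffler ν (-((m : ℝ) + 1) ^ (2 * n) * t ^ ν)) (𝓝[>] 0)
        (𝓝 (cosPairing φ fun _ => 1)) := by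
      refine Tendsto.const_mul _ (Tendsto.const_add _ (Tendsto.const_mul _ ?_))
      refine tendsto_tsum_of_dominated_convergence h.summable_coeff (fun m => ?_) ?_
      · exact (hY.tendsto_mittagLeffler hν0 (by positivity)).mul_const _
      · filter_upwards [eventually_mem_nhdsWithin] with t h0 m
        rw [norm_mul, Real.norm_eq_abs, Real.norm_eq_abs, abs_of_nonneg (hY.mittagLeffler_nonneg hν0 _)]
        refine mul_le_of_le_one_left (abs_nonneg _) ?_
        rw [neg_mul]
        exact hY.mittagLeffler_le_one hν0 (mul_nonneg (by positivity) (Real.rpow_nonneg (le_of_lt h0) _))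
    refine hlim.congr' ?_
    filter_upwards [eventually_mem_nhdsWithin] with t h0
    simp only [vFrac_eq_cosSeries]
    exact (integral_cosSeries_mul (hY.summable_abs_mittagLeffler hν0 hn h0) h.integrableOn).symm

end IsMittagLefflerVar

end Distribution

/-! ### Regularity and the pointwise equation -/

section Pointwise

lemma contDiffOn_of_hasDerivAt_family {U : Set ℝ} (hU : IsOpen U) {g : ℕ → ℝ → ℝ}
    (hg : ∀ j, ∀ x ∈ U, HasDerivAt (g j) (g (j + 1) x) x) (m j : ℕ) :
    ContDiffOn ℝ m (g j) U := by
  induction m generalizing j with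
  | zero =>
    exact contDiffOn_zero.2 fun x hx => (hg j x hx).continuousAt.continuousWithinAt
  | succ m ih =>
    push_cast
    rw [contDiffOn_succ_iff_deriv_of_isOpen hU]
    refine ⟨fun x hx => (hg j x hx).differentiableAt.differentiableWithinAt, by simp, ?_⟩
    exact (ih (j + 1)).congr fun x hx => (hg j x hx).deriv

lemma iteratedDeriv_of_hasDerivAt_family {U : Set ℝ} (hU : IsOpen U) {g : ℕ → ℝ → ℝ}
    (hg : ∀ j, ∀ x ∈ U, HasDerivAt (g j) (g (j + 1) x) x) (m j : ℕ) {x : ℝ} (hx : x ∈ U) :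
    iteratedDeriv m (g j) x = g (j + m) x := by
  induction m generalizing x with
  | zero => simp
  | succ m ih =>
    have : iteratedDeriv m (g j) =ᶠ[𝓝 x] g (j + m) := by
      filter_upwards [hU.mem_nhds hx] with y hy using ih hy
    rw [iteratedDeriv_succ, this.deriv_eq, (hg _ x hx).deriv, add_assoc]

namespace IsMittagLefflerVar

variable {Ω : Type*} [MeasurableSpace Ω] {P : Measure Ω} [IsProbabilityMeasure P] {ν : ℝ}
  {Y : Ω → ℝ}

/-- The random time can be arbitrarily small, so the derivative must be bounded uniformly over
positive times. `exists_abs_ringKernel_le` provides this on a closed interval around θ that avoids 0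
and 2π. -/
lemma hasDerivAt_integral_ringKernel (hY : IsMittagLefflerVar ν P Y) (hν : 0 < ν) {n : ℕ}
    (hn : 1 ≤ n) {t : ℝ} (ht : 0 < t) (j : ℕ) {θ : ℝ} (hθ : θ ∈ Ioo 0 (2 * Real.pi)) :
    HasDerivAt (fun x => ∫ ω, ringKernel n j x (t ^ ν * Y ω) ∂P)
      (∫ ω, ringKernel n (j + 1) θ (t ^ ν * Y ω) ∂P) θ := by
  have hYm := hY.measurable
  have hmeas : ∀ (j : ℕ) (x : ℝ), Measurable fun ω => ringKernel n j x (t ^ ν * Y ω) := fun j x =>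
    Measurable.tsum fun m => by fun_prop
  have hYpos : ∀ᵐ ω ∂P, 0 < t ^ ν * Y ω := by
    filter_upwards [hY.pos] with ω h
    positivity
  obtain ⟨δ, hδ0, hδ⟩ : ∃ δ : ℝ, 0 < δ ∧ θ ∈ Ioo δ (2 * Real.pi - δ) := by
    have h1 := hθ.1
    have h2 := sub_pos.2 hθ.2
    refine ⟨min θ (2 * Real.pi - θ) / 2, by positivity, ?_, ?_⟩
    · linarith [min_le_left θ (2 * Real.pi - θ)]
    · linarith [min_le_right θ (2 * Real.pi - θ)]
  have hint : Integrable (fun ω => ringKernel n j θ (t ^ ν * Y ω)) P := by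
    -- The uniform bound starts at j = 1; for j = 0 integrability comes from the convergent averaged
    -- series.
    rcases Nat.eq_zero_or_pos j with rfl | hj
    · simpa [ringKernel] using (hY.integral_tsum_exp hν hn ht
        (fun m : ℕ => Real.abs_cos_le_one (((m : ℝ) + 1) * θ))).1
    · obtain ⟨C, hC⟩ := exists_abs_ringKernel_le hn hj hδ0
      refine Integrable.of_bound (C := C) (hmeas j θ).aestronglyMeasurable ?_
      filter_upwards [hYpos] with ω h
      exact hC θ (Ioo_subset_Icc_self hδ) _ h
  obtain ⟨C, hC⟩ := exists_abs_ringKernel_le hn (Nat.succ_pos j) hδ0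
  refine (hasDerivAt_integral_of_dominated_loc_of_deriv_le (bound := fun _ => C)
    (F' := fun x ω => ringKernel n (j + 1) x (t ^ ν * Y ω)) (Icc_mem_nhds hδ.1 hδ.2)
    (Eventually.of_forall fun x => (hmeas j x).aestronglyMeasurable) hint
    (hmeas (j + 1) θ).aestronglyMeasurable ?_ (integrable_const _) ?_).2
  · filter_upwards [hYpos] with ω h x hx
    exact hC x hx _ h
  · filter_upwards [hYpos] with ω h x hx
    exact hasDerivAt_ringKernel_angle hn j x h

lemma vFrac_eq (hY : IsMittagLefflerVar ν P Y) (hν : 0 < ν) {n : ℕ} (hn : 1 ≤ n) {t : ℝ}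
    (ht : 0 < t) (θ : ℝ) :
    vFrac n ν θ t = (1 / (2 * Real.pi)) * (1 + 2 * ∫ ω, ringKernel n 0 θ (t ^ ν * Y ω) ∂P) := by
  have h1 : Integrable (fun ω => ringKernel n 0 θ (t ^ ν * Y ω)) P := by
    simpa [ringKernel] using (hY.integral_tsum_exp hν hn ht
      (fun m : ℕ => Real.abs_cos_le_one (((m : ℝ) + 1) * θ))).1
  rw [← (hY.integral_ringHeat hν hn ht θ).2]
  simp only [ringHeat]
  rw [integral_const_mul, integral_add (integrable_const _) (h1.const_mul 2), integral_const_mul]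
  simp

/-- Regularity of the series in the angle, given termwise differentiability of the averages. -/
lemma contDiffAt_vFrac (hY : IsMittagLefflerVar ν P Y) (hν : 0 < ν) {n : ℕ} (hn : 1 ≤ n) {t : ℝ}
    (ht : 0 < t) {U : Set ℝ} (hU : IsOpen U)
    (hd : ∀ j, ∀ x ∈ U, HasDerivAt (fun x => ∫ ω, ringKernel n j x (t ^ ν * Y ω) ∂P)
      (∫ ω, ringKernel n (j + 1) x (t ^ ν * Y ω) ∂P) x) {θ : ℝ} (hθ : θ ∈ U) :
    ContDiffAt ℝ ((2 * n : ℕ) : ℕ∞) (fun x => vFrac n ν x t) θ ∧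
    negLaplacePow n (fun x => vFrac n ν x t) θ =
      (-1) ^ n * ((1 / (2 * Real.pi)) * (2 * ∫ ω, ringKernel n (2 * n) θ (t ^ ν * Y ω) ∂P)) := by
  set g : ℕ → ℝ → ℝ := fun j x => (1 / (2 * Real.pi)) *
    ((if j = 0 then 1 else 0) + 2 * ∫ ω, ringKernel n j x (t ^ ν * Y ω) ∂P) with hg
  have hgd : ∀ j, ∀ x ∈ U, HasDerivAt (g j) (g (j + 1) x) x := fun j x hx => by
    have := (((hd j x hx).const_mul 2).const_add (if j = 0 then (1 : ℝ) else 0)).const_mul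
      (1 / (2 * Real.pi))
    convert! this using 1
    simp [hg]
  have hv : (fun x => vFrac n ν x t) = g 0 := by
    funext x
    rw [hY.vFrac_eq hν hn ht]
    simp [hg]
  rw [hv]
  constructor
  · exact (contDiffOn_of_hasDerivAt_family hU hgd (2 * n) 0).contDiffAt (hU.mem_nhds hθ)
  · have : 2 * n ≠ 0 := by omega
    rw [negLaplacePow, iteratedDeriv_of_hasDerivAt_family hU hgd _ _ hθ, zero_add]
    simp only [hg, if_neg this, zero_add]

lemma hasDerivAt_ringHeat {n : ℕ} (hn : 1 ≤ n) (θ : ℝ) {s : ℝ} (hs : 0 < s) :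
    HasDerivAt (ringHeat n θ)
      (-((-1) ^ n * ((1 / (2 * Real.pi)) * (2 * ringKernel n (2 * n) θ s)))) s := by
  have h := (((hasDerivAt_ringKernel_time hn 0 θ hs).const_mul 2).const_add 1).const_mul
    (1 / (2 * Real.pi))
  rw [zero_add] at h
  convert! h using 1
  ring

/-- The fractional equation holds pointwise, away from the starting point if `ν < 1`. -/
lemma pointwise_equation (hY : IsMittagLefflerVar ν P Y) (hν0 : 0 < ν) (hν1 : ν ≤ 1) {n : ℕ}
    (hn : 1 ≤ n) {θ : ℝ} (hθ : θ ∈ Ico 0 (2 * Real.pi)) (h : θ ≠ 0 ∨ ν = 1) {t : ℝ} (ht : 0 < t) :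
    ContDiffAt ℝ ((2 * n : ℕ) : ℕ∞) (fun x => vFrac n ν x t) θ ∧
    HasCaputoDerivAt ν (fun s => vFrac n ν θ s)
      (-negLaplacePow n (fun x => vFrac n ν x t) θ) t := by
  have hint : ∀ t : ℝ, 0 < t → Integrable (fun ω => ringHeat n θ (t ^ ν * Y ω)) P :=
    fun t ht => (hY.integral_ringHeat hν0 hn ht θ).1
  have hf : ∀ t : ℝ, 0 < t → vFrac n ν θ t = ∫ ω, ringHeat n θ (t ^ ν * Y ω) ∂P :=
    fun t ht => (hY.integral_ringHeat hν0 hn ht θ).2.symm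
  have hG : -((-1) ^ n * ((1 / (2 * Real.pi)) * (2 * ∫ ω, ringKernel n (2 * n) θ (t ^ ν * Y ω) ∂P))) =
      ∫ ω, -((-1) ^ n * ((1 / (2 * Real.pi)) * (2 * ringKernel n (2 * n) θ (t ^ ν * Y ω)))) ∂P := by
    rw [integral_neg, integral_const_mul, integral_const_mul, integral_const_mul]
  rcases lt_or_eq_of_le hν1 with hν | rfl
  · have hθ' : θ ∈ Ioo 0 (2 * Real.pi) :=
      ⟨lt_of_le_of_ne hθ.1 (h.resolve_right hν.ne).symm, hθ.2⟩
    obtain ⟨h1, h2⟩ := hY.contDiffAt_vFrac hν0 hn ht isOpen_Ioo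
      (fun j x hx => hY.hasDerivAt_integral_ringKernel hν0 hn ht j hx) hθ'
    refine ⟨h1, ?_⟩
    have hδ0 : 0 < min θ (2 * Real.pi - θ) := lt_min hθ'.1 (sub_pos.2 hθ'.2)
    obtain ⟨C, hC⟩ := exists_abs_ringKernel_le hn (by omega : 1 ≤ 2 * n) hδ0
    rw [h2, hG]
    refine hY.hasCaputoDerivAt_of_lt hν0 hν (F := ringHeat n θ)
      (C := 1 / (2 * Real.pi) * (2 * C))
      (G := fun s => -((-1) ^ n * ((1 / (2 * Real.pi)) * (2 * ringKernel n (2 * n) θ s))))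
      (fun y hy => hasDerivAt_ringHeat hn θ hy) (fun y hy => ?_) hint hf ht
    have hC' := hC θ ⟨min_le_left _ _, by linarith [min_le_right θ (2 * Real.pi - θ)]⟩ y hy
    have hpi := Real.pi_pos
    rw [abs_neg, abs_mul, abs_pow, abs_neg, abs_one, one_pow, one_mul, abs_mul, abs_mul, abs_two,
      abs_of_pos (by positivity : 0 < 1 / (2 * Real.pi))]
    gcongr
  -- For ν = 1 the average is evaluation at the fixed time t > 0, so the kernel can be
  -- differentiated at every angle, 0 included.
  · obtain ⟨h1, h2⟩ := hY.contDiffAt_vFrac hν0 hn ht isOpen_univ (θ := θ) (fun j x _ => by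
      have e : ∀ (j : ℕ) (x : ℝ), ∫ ω, ringKernel n j x (t ^ (1 : ℝ) * Y ω) ∂P = ringKernel n j x t :=
        fun j x => hY.integral_comp_eq_of_eq_one (ringKernel n j x) t
      simp only [e]
      exact hasDerivAt_ringKernel_angle hn j x ht) (mem_univ _)
    refine ⟨h1, ?_⟩
    rw [h2, hG]
    exact hY.hasCaputoDerivAt_one (F := ringHeat n θ)
      (G := fun s => -((-1) ^ n * ((1 / (2 * Real.pi)) * (2 * ringKernel n (2 * n) θ s))))
      (fun y hy => hasDerivAt_ringHeat hn θ hy) hf ht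

end IsMittagLefflerVar

end Pointwise

/-! ### Uniqueness on the ring -/

section UniqueSolution

lemma smoothPeriodic_cos (k : ℕ) (β : ℝ) : SmoothPeriodic fun θ => Real.cos (k * θ + β) := by
  refine ⟨by fun_prop, fun θ => ?_⟩
  have : (k : ℝ) * (θ + 2 * Real.pi) + β = k * θ + β + k * (2 * Real.pi) := by ring
  simp only [this, Real.cos_add_nat_mul_two_pi]

lemma negLaplacePow_cos (p k : ℕ) (β : ℝ) :
    negLaplacePow p (fun θ => Real.cos (k * θ + β)) =
      fun θ => (k : ℝ) ^ (2 * p) * Real.cos (k * θ + β) := by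
  induction p with
  | zero => simp [negLaplacePow_zero]
  | succ p ih =>
    have ha : ∀ θ : ℝ, HasDerivAt (fun θ : ℝ => k * θ + β) (k : ℝ) θ := fun θ => by
      simpa using ((hasDerivAt_id θ).const_mul (k : ℝ)).add_const β
    have h1 : deriv (fun θ : ℝ => (k : ℝ) ^ (2 * p) * Real.cos (k * θ + β)) =
        fun θ => (k : ℝ) ^ (2 * p) * (-Real.sin (k * θ + β) * k) := by
      funext θ
      exact ((ha θ).cos.const_mul _).deriv
    have h2 : ∀ θ : ℝ, deriv (fun θ : ℝ => (k : ℝ) ^ (2 * p) * (-Real.sin (k * θ + β) * k)) θ =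
        (k : ℝ) ^ (2 * p) * (-(Real.cos (k * θ + β) * k) * k) := fun θ =>
      ((((ha θ).sin.neg).mul_const (k : ℝ)).const_mul _).deriv
    rw [negLaplacePow_succ, ih, h1]
    funext θ
    rw [h2]
    ring

/-- An integrable function on one period all of whose Fourier coefficients vanish is zero. -/
lemma ae_eq_zero_of_fourier_coeff {g : ℝ → ℝ} (hg : IntegrableOn g (Ico 0 (2 * Real.pi)))
    (h : ∀ (k : ℕ) (β : ℝ), ∫ θ in Ico 0 (2 * Real.pi), g θ * Real.cos (k * θ + β) = 0) :
    ∀ᵐ θ ∂(volume.restrict (Ico 0 (2 * Real.pi))), g θ = 0 := by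
  have hpi := Real.pi_pos
  have : Fact (0 < 2 * Real.pi) := ⟨by positivity⟩
  have hmk : Continuous fun θ : ℝ => (θ : AddCircle (2 * Real.pi)) := AddCircle.continuous_mk' _
  have hgc : Integrable (fun θ => (g θ : ℂ)) (volume.restrict (Ico 0 (2 * Real.pi))) := hg.ofReal
  have hi : ∀ f : C(AddCircle (2 * Real.pi), ℂ),
      Integrable (fun θ : ℝ => (g θ : ℂ) * f θ) (volume.restrict (Ico 0 (2 * Real.pi))) := fun f =>
    hgc.mul_bdd (c := ‖f‖) (f.continuous.comp hmk).aestronglyMeasurable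
      (Eventually.of_forall fun θ => f.norm_coe_le_norm _)
  -- Integration against g is a bounded functional on the continuous functions of the circle. It
  -- vanishes on the characters, whose span is dense, so it is zero.
  let L : C(AddCircle (2 * Real.pi), ℂ) →ₗ[ℂ] ℂ :=
    { toFun := fun f => ∫ θ in Ico 0 (2 * Real.pi), (g θ : ℂ) * f θ
      map_add' := fun f₁ f₂ => by
        simp only [ContinuousMap.add_apply, mul_add]
        exact integral_add (hi f₁) (hi f₂)
      map_smul' := fun c f => by
        simp only [ContinuousMap.smul_apply, smul_eq_mul, RingHom.id_apply]
        rw [← integral_const_mul]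
        exact integral_congr_ae (Eventually.of_forall fun θ => by simp only; ring) }
  let Λ : C(AddCircle (2 * Real.pi), ℂ) →L[ℂ] ℂ := L.mkContinuous
    (∫ θ in Ico 0 (2 * Real.pi), ‖(g θ : ℂ)‖) fun f => by
      refine (norm_integral_le_integral_norm _).trans ?_
      rw [← integral_mul_const]
      refine integral_mono (hi f).norm (hgc.norm.mul_const _) fun θ => ?_
      simp only [norm_mul]
      exact mul_le_mul_of_nonneg_left (f.norm_coe_le_norm _) (norm_nonneg _)
  have hΛ : ∀ f, Λ f = ∫ θ in Ico 0 (2 * Real.pi), (g θ : ℂ) * f θ := fun f => rfl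
  have hcoef : ∀ (k : ℤ) (β : ℝ), ∫ θ in Ico 0 (2 * Real.pi), g θ * Real.cos (k * θ + β) = 0 := by
    intro k β
    obtain ⟨m, rfl | rfl⟩ := k.eq_nat_or_neg
    · simpa using h m β
    · refine Eq.trans ?_ (h m (-β))
      refine integral_congr_ae (Eventually.of_forall fun θ => ?_)
      simp only
      rw [← Real.cos_neg]
      push_cast
      ring_nf
  have hgi : ∀ (k : ℤ) (β : ℝ), Integrable (fun θ : ℝ => g θ * Real.cos (k * θ + β))
      (volume.restrict (Ico 0 (2 * Real.pi))) := fun k β =>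
    Integrable.mul_bdd (c := 1) hg (Continuous.aestronglyMeasurable (by fun_prop))
      (Eventually.of_forall fun θ => Real.abs_cos_le_one _)
  have hfour : ∀ k : ℤ, Λ (fourier k) = 0 := by
    intro k
    have e : ∀ θ : ℝ, (g θ : ℂ) * fourier k (θ : AddCircle (2 * Real.pi)) =
        ((g θ * Real.cos (k * θ + 0) : ℝ) : ℂ) -
          ((g θ * Real.cos (k * θ + Real.pi / 2) : ℝ) : ℂ) * Complex.I := by
      intro θ
      have h1 : 2 * (Real.pi : ℂ) * Complex.I * (k : ℂ) * θ / ((2 * Real.pi : ℝ) : ℂ) =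
          ((k * θ : ℝ) : ℂ) * Complex.I := by
        have : (Real.pi : ℂ) ≠ 0 := by exact_mod_cast hpi.ne'
        push_cast
        field_simp
      rw [fourier_coe_apply, h1, Complex.exp_mul_I, ← Complex.ofReal_cos, ← Complex.ofReal_sin,
        Real.cos_add_pi_div_two, add_zero]
      push_cast
      ring
    rw [hΛ]
    simp only [e]
    rw [integral_sub (hgi k 0).ofReal ((hgi k (Real.pi / 2)).ofReal.mul_const _),
      integral_mul_const, integral_complex_ofReal, integral_complex_ofReal, hcoef, hcoef]
    simp
  have hzero : ∀ f, Λ f = 0 := by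
    have h1 : (Submodule.span ℂ (range (fourier (T := 2 * Real.pi)))).topologicalClosure ≤
        LinearMap.ker Λ.toLinearMap := by
      refine Submodule.topologicalClosure_minimal _ (Submodule.span_le.2 ?_) Λ.isClosed_ker
      rintro _ ⟨k, rfl⟩
      exact hfour k
    rw [span_fourier_closure_eq_top] at h1
    exact fun f => h1 (Submodule.mem_top (x := f))
  -- A test function supported in the open interval vanishes at both ends, so it descends to a
  -- continuous function on the circle.
  have key : ∀ᵐ θ : ℝ, θ ∈ Ioo 0 (2 * Real.pi) → g θ = 0 := by
    refine isOpen_Ioo.ae_eq_zero_of_integral_contDiff_smul_eq_zero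
      ((hg.mono_set Ioo_subset_Ico_self).locallyIntegrableOn) fun ψ hψ _ hsupp => ?_
    have hout : ∀ θ, θ ∉ Ioo 0 (2 * Real.pi) → ψ θ = 0 := fun θ hθ =>
      image_eq_zero_of_notMem_tsupport fun hc => hθ (hsupp hc)
    have h0 : ψ 0 = 0 := hout 0 (by simp)
    have h1 : ψ (2 * Real.pi) = 0 := hout _ (by simp)
    let f : C(AddCircle (2 * Real.pi), ℂ) :=
      ⟨AddCircle.liftIco (2 * Real.pi) 0 fun θ => (ψ θ : ℂ),
        AddCircle.liftIco_continuous (by simp [h0, h1])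
          (Complex.continuous_ofReal.comp hψ.continuous).continuousOn⟩
    have h2 := hzero f
    rw [hΛ] at h2
    have h3 : ∫ θ in Ico 0 (2 * Real.pi), (g θ : ℂ) * f θ =
        ((∫ θ in Ico 0 (2 * Real.pi), ψ θ • g θ : ℝ) : ℂ) := by
      rw [← integral_complex_ofReal]
      refine setIntegral_congr_fun measurableSet_Ico fun θ hθ => ?_
      have : f θ = (ψ θ : ℂ) := AddCircle.liftIco_coe_apply (p := 2 * Real.pi) (a := 0)
        (f := fun θ => (ψ θ : ℂ)) (by rwa [zero_add])
      simp only [this, smul_eq_mul]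
      push_cast
      ring
    rw [h3, Complex.ofReal_eq_zero] at h2
    rwa [setIntegral_eq_integral_of_forall_compl_eq_zero] at h2
    intro θ hθ
    rw [hout θ fun hc => hθ (Ioo_subset_Ico_self hc), zero_smul]
  rw [ae_restrict_iff' measurableSet_Ico]
  have hne : ∀ᵐ θ : ℝ, θ ≠ 0 := by simp [ae_iff]
  filter_upwards [key, hne] with θ h1 h2 hθ
  exact h1 ⟨lt_of_le_of_ne hθ.1 h2.symm, hθ.2⟩

/-- Solutions on the ring are unique. -/
lemma IsRingSolution.ae_eq {n : ℕ} {ν : ℝ} (hν0 : 0 < ν) (hν1 : ν ≤ 1) {w v : ℝ → ℝ → ℝ}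
    (hw : IsRingSolution n ν w) (hv : IsRingSolution n ν v) {t : ℝ} (ht : 0 < t) :
    ∀ᵐ θ ∂(volume.restrict (Ico 0 (2 * Real.pi))), w θ t = v θ t := by
  have h0 : ∀ᵐ θ ∂(volume.restrict (Ico 0 (2 * Real.pi))), w θ t - v θ t = 0 := by
    refine ae_eq_zero_of_fourier_coeff ((hw.integrable t ht).sub (hv.integrable t ht)) fun k β => ?_
    have hφ := smoothPeriodic_cos k β
    have hcoef : ∀ u : ℝ → ℝ → ℝ, ∀ t : ℝ, ∫ θ in Ico 0 (2 * Real.pi),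
        u θ t * negLaplacePow n (fun θ => Real.cos (k * θ + β)) θ =
        (k : ℝ) ^ (2 * n) * ∫ θ in Ico 0 (2 * Real.pi), u θ t * Real.cos (k * θ + β) := by
      intro u t
      rw [negLaplacePow_cos, ← integral_const_mul]
      exact integral_congr_ae (Eventually.of_forall fun θ => by simp only; ring)
    have hi : ∀ u : ℝ → ℝ → ℝ, IsRingSolution n ν u → Integrable
        (fun θ : ℝ => u θ t * Real.cos (k * θ + β)) (volume.restrict (Ico 0 (2 * Real.pi))) :=
      fun u hu => Integrable.mul_bdd (c := 1) (hu.integrable t ht)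
        (Continuous.aestronglyMeasurable (by fun_prop))
        (Eventually.of_forall fun θ => Real.abs_cos_le_one _)
    -- The cosines are eigenfunctions of (-∂²)^n, so each coefficient of the difference solves the
    -- scalar equation with λ = k^{2n}; the two initial limits cancel.
    have key := eq_zero_of_caputo (lam := (k : ℝ) ^ (2 * n))
      (f := fun s => (∫ θ in Ico 0 (2 * Real.pi), w θ s * Real.cos (k * θ + β)) -
        ∫ θ in Ico 0 (2 * Real.pi), v θ s * Real.cos (k * θ + β)) hν0 hν1 (by positivity)
      (fun s hs => by
        have h1 := (hw.equation _ hφ.1 hφ.2 s hs).sub hs (hv.equation _ hφ.1 hφ.2 s hs)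
        rw [hcoef, hcoef] at h1
        convert! h1 using 1
        ring)
      (by simpa using (hw.initial _ hφ.1 hφ.2).sub (hv.initial _ hφ.1 hφ.2)) ht
    rw [← integral_sub (hi w hw) (hi v hv)] at key
    refine Eq.trans ?_ key
    exact integral_congr_ae (Eventually.of_forall fun θ => by simp only; ring)
  filter_upwards [h0] with θ h using sub_eq_zero.1 h

end UniqueSolution

end CircPseudo

end

theorem mainTheorem4 {Ω : Type*} [MeasurableSpace Ω] (P : Measure Ω) [IsProbabilityMeasure P]
    (n : ℕ) (hn : 1 ≤ n) (ν : ℝ) (hν0 : 0 < ν) (hν1 : ν ≤ 1)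
    (H : ℝ≥0 → Ω → ℝ) (hH : CircPseudo.IsStableSubordinator ν H P) :
    -- the series converges
    (∀ θ t : ℝ, 0 < t → Summable (fun j : ℕ =>
      CircPseudo.mittagLeffler ν (-((j : ℝ) + 1) ^ (2 * n) * t ^ ν) *
        Real.cos (((j : ℝ) + 1) * θ))) ∧
    -- its sum is the density of the signed law of the time-changed circular pseudoprocess
    (∀ t : ℝ, 0 < t → ∀ A : Set CircPseudo.Ring1, MeasurableSet A →
      Integrable (fun ω => CircPseudo.ringLaw n (CircPseudo.inverseProcess H t ω) A) P ∧
      CircPseudo.timeChangedLaw n P (CircPseudo.inverseProcess H t) A =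
        ∫ θ in Ico 0 (2 * Real.pi) ∩ (fun x : ℝ => (x : CircPseudo.Ring1)) ⁻¹' A,
          CircPseudo.vFrac n ν θ t) ∧
    -- it solves the problem on the whole ring, in the sense of distributions in the angle
    CircPseudo.IsRingSolution n ν (CircPseudo.vFrac n ν) ∧
    -- it is the only such solution
    (∀ w : ℝ → ℝ → ℝ, CircPseudo.IsRingSolution n ν w → ∀ t : ℝ, 0 < t →
      ∀ᵐ θ ∂(volume.restrict (Ico 0 (2 * Real.pi))), w θ t = CircPseudo.vFrac n ν θ t) ∧
    -- the equation holds pointwise away from the starting point (everywhere when `ν = 1`)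
    (∀ θ ∈ Ico 0 (2 * Real.pi), θ ≠ 0 ∨ ν = 1 → ∀ t : ℝ, 0 < t →
      ContDiffAt ℝ ((2 * n : ℕ) : ℕ∞) (fun x => CircPseudo.vFrac n ν x t) θ ∧
      CircPseudo.HasCaputoDerivAt ν (fun s => CircPseudo.vFrac n ν θ s)
        (-CircPseudo.negLaplacePow n (fun x => CircPseudo.vFrac n ν x t) θ) t) := by
  have hY := hH.isMittagLefflerVar hν0
  have hv := hY.isRingSolution hν0 hν1 hn
  refine ⟨fun θ t ht => ?_, fun t ht A hA => hH.timeChangedLaw_eq hν0 hn ht hA, hv,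
    fun w hw t ht => hw.ae_eq hν0 hν1 hv ht,
    fun θ hθ h t ht => hY.pointwise_equation hν0 hν1 hn hθ h ht⟩
  refine Summable.of_norm_bounded (hY.summable_abs_mittagLeffler hν0 hn ht) fun j => ?_
  rw [norm_mul, Real.norm_eq_abs, Real.norm_eq_abs]
  exact mul_le_of_le_one_right (abs_nonneg _) (Real.abs_cos_le_one _)
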